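/- Let $M$ be a free $\mathbb Z$-module of finite rank with a reduced root datum (a finite set of roots $\alpha\in M$ with coroots $\alpha^\vee\in M^\vee$), Weyl group $W$ generated by the reflections $s_\alpha(\lambda)=\lambda-\alpha^\vee(\lambda)\alpha$, and a fixed basis of simple roots $\alpha_1,\dots,\alpha_n$. Let $l$ be the length function on $W$, $w_0$ the longest element, $N=l(w_0)$. The torsion index $\mathfrak t$ is the positive generator of the image of $\Delta_{w_0}\colon S^N_{\mathbb Z}(M)\to\mathbb Z$, where $\Delta_{w_0}$ is the composition, along a reduced decomposition of $w_0$, of the operators $u\mapsto (u-s_\alpha(u))/\alpha$ on the symmetric algebra of $M$. Let $R$ be a commutative ring and $F$ a one-dimensional commutative formal group law over $R$. Let $R[[x_M]]$ be the completion of the polynomial ring $R[x_\lambda,\ \lambda\in M]$ at the kernel of the augmentation $x_\lambda\mapsto 0$, and let $R[[M]]_F$ be its quotient by the closure of the ideal generated by $x_0$ and the $x_{\lambda+\mu}-F(x_\lambda,x_\mu)$. Let $\varepsilon\colon R[[M]]_F\to R$ be the augmentation, $\mathcal I_F=\ker\varepsilon$, and $\mathcal I_F^m=R[[M]]_F$ for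 $m\le 0$. Let $\Delta_\alpha$ be the $R$-linear divided difference operator $\Delta_\alpha(u)=(u-s_\alpha(u))/x_\alpha$ on $R[[M]]_F$; in general the division is carried out generically and then specialized: the element $u-\sigma(u)$ of $R[[M\oplus\mathbb Z]]_F$, where $u$ is viewed in $R[[M\oplus\mathbb Z]]_F$ via $x_\lambda\mapsto x_{(\lambda,0)}$ and $\sigma(x_\lambda)=x_{(\lambda,-\alpha^\vee(\lambda))}$, is uniquely divisible by the regular element $y=x_{(0,1)}$, and $\Delta_\alpha(u)$ is the image of the quotient under $x_{(\lambda,m)}\mapsto x_{\lambda+m\alpha}$. Let $C_\alpha(u)=e_\alpha u-\Delta_\alpha(u)$, where $e_\alpha=g(x_\alpha,x_{-\alpha})$ and $F(x,y)=x+y-xy\,g(x,y)$. For a sequence $I=(i_1,\dots,i_k)$ put $\Delta_I=\Delta_{\alpha_{i_1}}\circ\cdots\circ\Delta_{\alpha_{i_k}}$ and $C_I=C_{\alpha_{i_1}}\circ\cdots\circ C_{\alpha_{i_k}}$. Let $\mathcal D(M)_F$ be the algebra of $R$-linear endomorphisms of $R[[M]]_F$ generated by all $\Delta_\alpha$ ($\alpha$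 a root) and by the multiplications by elements of $R[[M]]_F$; let $\mathcal D(M)_F^{(i)}$ be the $R[[M]]_F$-submodule generated by the $u\,\Delta_{\beta_1}\cdots\Delta_{\beta_k}$ with $\beta_j$ roots, $u\in\mathcal I_F^m$ and $m-k\ge i$. Let $\varepsilon\mathcal D(M)_F$ be the $R$-module of the linear forms $\varepsilon D$, $D\in\mathcal D(M)_F$, and $\varepsilon\mathcal D(M)_F^{(i)}$ the image of $\mathcal D(M)_F^{(i)}$. Let $\mathcal H(M)_F=\operatorname{Hom}_R(\varepsilon\mathcal D(M)_F,R)$, filtered by the submodules $\mathcal H(M)_F^{(i)}$, $i\in\mathbb Z$, of forms that vanish on $\varepsilon\mathcal D(M)_F^{(-i+1)}$, and let $c\colon R[[M]]_F\to\mathcal H(M)_F$ send $u$ to the evaluation at $u$. Let $A_\alpha$ and $B_\alpha$ be the endomorphisms of $\mathcal H(M)_F$ given by $A_\alpha(h)(\varepsilon D)=h(\varepsilon D C_\alpha)$ and $B_\alpha(h)(\varepsilon D)=h(\varepsilon D\Delta_\alpha)$, and $A_I$, $B_I$ their compositions along a sequence $I$, as above. Suppose that $\mathfrak t$ is regular in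 $R$ (that is, not a zero divisor). For a choice of reduced decompositions $J_w$ of all $w\in W$, let $(z^C_{J_w})_{w\in W}$ be the $R$-basis of $\mathcal H(M)_F$ such that $c(u)=\sum_w \varepsilon C_{J_w}(u)\,z^C_{J_w}$ for all $u$, and put $z_0=z^C_{J_{w_0}}$. Then, for any choice of reduced decompositions $I_w$ of all $w\in W$ and for every integer $i$, the elements $A_{I_w}(z_0)$ (resp. $B_{I_w}(z_0)$) with $l(w)\le N-i$ form an $R$-basis of $\mathcal H(M)_F^{(i)}$. In particular, the $A_{I_w}(z_0)$ (resp. $B_{I_w}(z_0)$), $w\in W$, form an $R$-basis of $\mathcal H(M)_F$. -/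

import Mathlib

open scoped nonZeroDivisors

noncomputable section

namespace FormalDemazure

/-! ### The ring `R⟦x_S⟧` and power series evaluated at two of its variables -/

section Completion

variable (R : Type*) [CommRing R] (S : Type*)

/-- The augmentation `R[x_S] → R`, sending every variable to `0`. -/
def polyAug : MvPolynomial S R →ₐ[R] R := MvPolynomial.aeval fun _ => 0

/-- The kernel of the augmentation `R[x_S] → R`. -/
def polyAugIdeal : Ideal (MvPolynomial S R) := RingHom.ker (polyAug R S)

/-- `R⟦x_S⟧`, the completion of the polynomial ring `R[x_S]` at the kernel of the augmentation. -/
abbrev CompletedPoly : Type _ := AdicCompletion (polyAugIdeal R S) (MvPolynomial S R)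

variable {R S}

lemma X_mem_polyAugIdeal (s : S) : (MvPolynomial.X s : MvPolynomial S R) ∈ polyAugIdeal R S := by
  simp [polyAugIdeal, polyAug, RingHom.mem_ker]

/-- The sum of the terms of total degree `k` of `∑ a i j x_s ^ i x_t ^ j`. -/
def homogPart (a : ℕ → ℕ → R) (s t : S) (k : ℕ) : MvPolynomial S R :=
  ∑ p ∈ Finset.HasAntidiagonal.antidiagonal k,
    MvPolynomial.C (a p.1 p.2) * MvPolynomial.X s ^ p.1 * MvPolynomial.X t ^ p.2

lemma homogPart_mem (a : ℕ → ℕ → R) (s t : S) (k : ℕ) :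
    homogPart a s t k ∈ polyAugIdeal R S ^ k := by
  refine Ideal.sum_mem _ fun p hp => ?_
  rw [Finset.HasAntidiagonal.mem_antidiagonal] at hp
  rw [← hp, pow_add, mul_assoc]
  exact Ideal.mul_mem_left _ _ (Ideal.mul_mem_mul
    (Ideal.pow_mem_pow (X_mem_polyAugIdeal s) _) (Ideal.pow_mem_pow (X_mem_polyAugIdeal t) _))

/-- The element `∑ a i j x_s ^ i x_t ^ j` of `R⟦x_S⟧`, as the limit of the partial sums
of the terms of total degree less than `n`. -/
def evalTwo (a : ℕ → ℕ → R) (s t : S) : CompletedPoly R S :=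
  AdicCompletion.mk (polyAugIdeal R S) (MvPolynomial S R)
    (AdicCompletion.AdicCauchySequence.mk _ _
      (fun n => ∑ k ∈ Finset.range n, homogPart a s t k) fun n => by
        rw [SModEq.comm, SModEq.sub_mem, Finset.sum_range_succ, add_sub_cancel_left]
        simpa using homogPart_mem a s t n)

lemma evalₐ_evalTwo (a : ℕ → ℕ → R) (s t : S) (n : ℕ) :
    AdicCompletion.evalₐ (polyAugIdeal R S) n (evalTwo a s t) =
      Ideal.Quotient.mk _ (∑ k ∈ Finset.range n, homogPart a s t k) := by
  simp [evalTwo]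

variable {T : Type*}

lemma rename_homogPart (f : S → T) (a : ℕ → ℕ → R) (s t : S) (k : ℕ) :
    MvPolynomial.rename f (homogPart a s t k) = homogPart a (f s) (f t) k := by
  simp [homogPart]

lemma polyAugIdeal_pow_le_comap (f : S → T) (n : ℕ) :
    polyAugIdeal R S ^ n ≤
      (polyAugIdeal R T ^ n).comap (MvPolynomial.rename f : _ →ₐ[R] MvPolynomial T R) := by
  have h : polyAugIdeal R S ≤
      (polyAugIdeal R T).comap (MvPolynomial.rename f : _ →ₐ[R] MvPolynomial T R) := by
    intro p hp
    simp only [polyAugIdeal, polyAug, RingHom.mem_ker, Ideal.mem_comap,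
      MvPolynomial.aeval_rename] at hp ⊢
    exact hp
  exact (Ideal.pow_right_mono h n).trans (Ideal.le_comap_pow _ n)

/-- The homomorphism `R⟦x_S⟧ → R[x_T] / 𝔪 ^ n` induced by `x_s ↦ x_{f s}`. -/
def completedMapAux (f : S → T) (n : ℕ) :
    CompletedPoly R S →ₐ[R] MvPolynomial T R ⧸ polyAugIdeal R T ^ n :=
  (Ideal.quotientMapₐ (polyAugIdeal R T ^ n) (MvPolynomial.rename f)
    (polyAugIdeal_pow_le_comap f n)).comp
      ((AdicCompletion.evalₐ (polyAugIdeal R S) n).restrictScalars R)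

lemma completedMapAux_compat (f : S → T) {m n : ℕ} (hle : m ≤ n) :
    (Ideal.Quotient.factorₐ R (Ideal.pow_le_pow_right hle)).comp (completedMapAux f n) =
      (completedMapAux f m : CompletedPoly R S →ₐ[R] _) := by
  ext x
  obtain ⟨y, rfl⟩ := AdicCompletion.mk_surjective _ _ x
  simp only [completedMapAux, AlgHom.comp_apply, AlgHom.restrictScalars_apply,
    AdicCompletion.evalₐ_mk]
  rw [← AdicCompletion.Ideal.mk_eq_mk _ hle]
  rfl

/-- The continuous homomorphism `R⟦x_S⟧ → R⟦x_T⟧` sending `x_s` to `x_{f s}`. -/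
def completedMap (f : S → T) : CompletedPoly R S →ₐ[R] CompletedPoly R T :=
  AdicCompletion.liftAlgHom (polyAugIdeal R T) (completedMapAux f)
    fun hle => completedMapAux_compat f hle

lemma evalₐ_completedMap (f : S → T) (n : ℕ) (x : CompletedPoly R S) :
    AdicCompletion.evalₐ (polyAugIdeal R T) n (completedMap f x) =
      Ideal.quotientMapₐ (polyAugIdeal R T ^ n) (MvPolynomial.rename f)
        (polyAugIdeal_pow_le_comap f n) (AdicCompletion.evalₐ (polyAugIdeal R S) n x) :=
  AdicCompletion.evalₐ_liftAlgHom (polyAugIdeal R T) (completedMapAux f)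
    (fun hle => completedMapAux_compat f hle) n x

lemma completedMap_of (f : S → T) (p : MvPolynomial S R) :
    completedMap f (AdicCompletion.of (polyAugIdeal R S) _ p) =
      AdicCompletion.of (polyAugIdeal R T) _ (MvPolynomial.rename f p) := by
  refine AdicCompletion.ext_evalₐ fun n => ?_
  rw [evalₐ_completedMap, AdicCompletion.evalₐ_of, AdicCompletion.evalₐ_of]
  rfl

lemma completedMap_evalTwo (f : S → T) (a : ℕ → ℕ → R) (s t : S) :
    completedMap f (evalTwo a s t) = evalTwo a (f s) (f t) := by
  refine AdicCompletion.ext_evalₐ fun n => ?_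
  rw [evalₐ_completedMap, evalₐ_evalTwo, evalₐ_evalTwo]
  simp only [← rename_homogPart f, ← map_sum]
  rfl

end Completion

/-! ### The formal group ring -/

section FormalGroupRing

variable {R : Type*} [CommRing R] (F : FormalGroup R)

/-- The coefficient of `x ^ i y ^ j` in `F (x, y)`. -/
def fglCoeff (i j : ℕ) : R :=
  MvPowerSeries.coeff (Finsupp.single 0 i + Finsupp.single 1 j) F.toPowerSeries

variable (M : Type*) [AddCommGroup M]

/-- The variable `x_lam` of `R⟦x_M⟧`. -/
def completedX (R : Type*) [CommRing R] {M : Type*} (lam : M) : CompletedPoly R M :=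
  AdicCompletion.of (polyAugIdeal R M) _ (MvPolynomial.X lam)

/-- The elements `x_0` and `x_{lam + mu} - F (x_lam, x_mu)` of `R⟦x_M⟧`. -/
def fgrGenerators : Set (CompletedPoly R M) :=
  {completedX R 0} ∪
    Set.range fun p : M × M => completedX R (p.1 + p.2) - evalTwo (fglCoeff F) p.1 p.2

/-- The closure of the ideal generated by `fgrGenerators`, in the topology of the completion:
a fundamental system of neighbourhoods of `0` consists of the kernels of the projections
`R⟦x_M⟧ → R[x_M] / 𝔪 ^ n`, where `𝔪` is the kernel of the augmentation. -/
def fgrIdeal : Ideal (CompletedPoly R M) :=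
  ⨅ n : ℕ, Ideal.span (fgrGenerators F M) ⊔
    RingHom.ker (AdicCompletion.evalₐ (polyAugIdeal R M) n)

/-- The formal group ring `R⟦M⟧_F`. -/
def FormalGroupRing : Type _ := CompletedPoly R M ⧸ fgrIdeal F M

instance : CommRing (FormalGroupRing F M) :=
  inferInstanceAs (CommRing (CompletedPoly R M ⧸ fgrIdeal F M))

instance : Algebra R (FormalGroupRing F M) :=
  inferInstanceAs (Algebra R (CompletedPoly R M ⧸ fgrIdeal F M))

/-- The quotient map `R⟦x_M⟧ → R⟦M⟧_F`. -/
def fgrMk : CompletedPoly R M →ₐ[R] FormalGroupRing F M := Ideal.Quotient.mkₐ R (fgrIdeal F M)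

variable {M}

/-- The class of `x_lam` in `R⟦M⟧_F`. -/
def fgrX (lam : M) : FormalGroupRing F M := fgrMk F M (completedX R lam)

variable (M) in
/-- The augmentation `R⟦x_M⟧ → R`. -/
def completedAug : CompletedPoly R M →ₐ[R] R :=
  (Ideal.Quotient.liftₐ (polyAugIdeal R M ^ 1) (polyAug R M) fun p hp => by
    rw [pow_one] at hp; exact hp).comp
      ((AdicCompletion.evalₐ (polyAugIdeal R M) 1).restrictScalars R)

lemma completedAug_eq_zero {y : CompletedPoly R M} (hy : y ∈ fgrIdeal F M) :
    completedAug M y = 0 := by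
  have h1 : fgrIdeal F M ≤ RingHom.ker (completedAug (R := R) M) := by
    refine (iInf_le _ 1).trans (sup_le (Ideal.span_le.2 ?_) ?_)
    · have hF : fglCoeff F 0 0 = 0 := by
        simpa [fglCoeff] using F.zero_constantCoeff
      have hX : ∀ lam : M, completedAug M (completedX R lam) = 0 := fun lam => by
        simp [completedAug, completedX, polyAug]
      rintro z (rfl | ⟨p, rfl⟩)
      · exact hX 0
      · simp only [SetLike.mem_coe, RingHom.mem_ker, map_sub, hX, zero_sub, neg_eq_zero]
        simp only [completedAug, AlgHom.comp_apply, AlgHom.restrictScalars_apply, evalₐ_evalTwo]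
        simp [homogPart, hF]
    · intro z hz
      rw [RingHom.mem_ker] at hz ⊢
      simp [completedAug, hz]
  exact h1 hy

variable (M) in
/-- The augmentation `ε : R⟦M⟧_F → R`. -/
def fgrAug : FormalGroupRing F M →ₐ[R] R :=
  Ideal.Quotient.liftₐ (fgrIdeal F M) (completedAug M) fun _ hy => completedAug_eq_zero F hy

variable (M) in
/-- The augmentation ideal `I_F` of `R⟦M⟧_F`. -/
def fgrAugIdeal : Ideal (FormalGroupRing F M) := RingHom.ker (fgrAug F M)

variable {M' : Type*} [AddCommGroup M']

lemma fgrIdeal_le_comap (f : M →+ M') :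
    fgrIdeal F M ≤ (fgrIdeal F M').comap (completedMap f : _ →ₐ[R] CompletedPoly R M') := by
  intro y hy
  rw [Ideal.mem_comap]
  simp only [fgrIdeal, Submodule.mem_iInf] at hy ⊢
  intro n
  have h : Ideal.span (fgrGenerators F M) ⊔
      RingHom.ker (AdicCompletion.evalₐ (polyAugIdeal R M) n) ≤
      (Ideal.span (fgrGenerators F M') ⊔
        RingHom.ker (AdicCompletion.evalₐ (polyAugIdeal R M') n)).comap
          (completedMap f : _ →ₐ[R] CompletedPoly R M') := by
    have hX : ∀ lam : M, completedMap (R := R) f (completedX R lam) = completedX R (f lam) :=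
      fun lam => by simp [completedX, completedMap_of]
    refine sup_le (Ideal.span_le.2 ?_) ?_
    · rintro z (rfl | ⟨p, rfl⟩)
      · refine Ideal.mem_sup_left (Ideal.subset_span (Or.inl ?_))
        change completedMap (R := R) f (completedX R 0) = _
        rw [hX, map_zero]
      · refine Ideal.mem_sup_left (Ideal.subset_span (Or.inr ⟨(f p.1, f p.2), ?_⟩))
        change _ = completedMap (R := R) f _
        rw [map_sub, hX, completedMap_evalTwo, map_add]
    · intro z hz
      refine Ideal.mem_sup_right ?_
      rw [RingHom.mem_ker] at hz ⊢
      change AdicCompletion.evalₐ _ n (completedMap f z) = 0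
      rw [evalₐ_completedMap, hz, map_zero]
  exact h (hy n)

/-- Functoriality in `M`: the homomorphism `R⟦M⟧_F → R⟦M'⟧_F` sending `x_lam` to `x_{f lam}`. -/
def fgrMap (f : M →+ M') : FormalGroupRing F M →ₐ[R] FormalGroupRing F M' :=
  Ideal.quotientMapₐ (fgrIdeal F M') (completedMap f) (fgrIdeal_le_comap F f)

lemma fgrMap_fgrX (f : M →+ M') (lam : M) : fgrMap F f (fgrX F lam) = fgrX F (f lam) := by
  have h : completedMap (R := R) f (completedX R lam) = completedX R (f lam) := by
    simp [completedX, completedMap_of]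
  change fgrMk F M' (completedMap (R := R) f (completedX R lam)) = _
  rw [h]
  rfl

lemma fgrMap_comp {M'' : Type*} [AddCommGroup M''] (g : M' →+ M'') (f : M →+ M')
    (u : FormalGroupRing F M) : fgrMap F g (fgrMap F f u) = fgrMap F (g.comp f) u := by
  obtain ⟨a, rfl⟩ := Ideal.Quotient.mk_surjective u
  change fgrMk F M'' (completedMap g (completedMap f a)) = fgrMk F M'' (completedMap (g.comp f) a)
  congr 1
  refine AdicCompletion.ext_evalₐ fun n => ?_
  simp only [evalₐ_completedMap]
  obtain ⟨p, hp⟩ := Ideal.Quotient.mk_surjective (AdicCompletion.evalₐ (polyAugIdeal R M) n a)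
  rw [← hp]
  change Ideal.Quotient.mk _ (MvPolynomial.rename g (MvPolynomial.rename f p)) =
    Ideal.Quotient.mk _ (MvPolynomial.rename (g.comp f) p)
  rw [MvPolynomial.rename_rename]
  rfl

lemma fgrMap_id (u : FormalGroupRing F M) : fgrMap F (AddMonoidHom.id M) u = u := by
  obtain ⟨a, rfl⟩ := Ideal.Quotient.mk_surjective u
  change fgrMk F M (completedMap (AddMonoidHom.id M) a) = fgrMk F M a
  congr 1
  refine AdicCompletion.ext_evalₐ fun n => ?_
  rw [evalₐ_completedMap]
  obtain ⟨p, hp⟩ := Ideal.Quotient.mk_surjective (AdicCompletion.evalₐ (polyAugIdeal R M) n a)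
  rw [← hp]
  change Ideal.Quotient.mk _ (MvPolynomial.rename id p) = _
  rw [MvPolynomial.rename_id_apply]

/-! ### The operators `Δ_α` and `C_α` -/

/-- The linear map `lam ↦ lam - φ lam • α` of `M`. -/
def reflectionHom (α : M) (φ : M →ₗ[ℤ] ℤ) : M →+ M :=
  (LinearMap.id - φ.smulRight α).toAddMonoidHom

/-- `lam ↦ (lam, - φ lam)`: the reflection `reflectionHom α φ`, with `α` replaced by the
generator `(0, 1)` of a free direct summand. -/
def genericReflection (φ : M →ₗ[ℤ] ℤ) : M →+ M × ℤ :=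
  (LinearMap.prod LinearMap.id (-φ)).toAddMonoidHom

/-- The specialization `(lam, n) ↦ lam + n • α`. -/
def specialize (α : M) : M × ℤ →+ M :=
  (LinearMap.coprod LinearMap.id (LinearMap.toSpanSingleton ℤ M α)).toAddMonoidHom

/-- `D` is the divided difference operator `u ↦ (u - s_α u) / x_α`, where
`s_α lam = lam - φ lam • α`. Since `x_α` may be a zero divisor in `R⟦M⟧_F`, the division is
carried out generically: in `R⟦M ⊕ ℤ⟧_F`, which is the ring of power series in `y = x_{(0, 1)}`
over `R⟦M⟧_F`, the image of `u` under `x_lam ↦ x_{(lam, 0)}` minus its image under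
`x_lam ↦ x_{(lam, - φ lam)} = x_{(lam, 0)} - φ lam ⬝ y` (formal difference and multiple) is
uniquely divisible by the regular element `y`; the quotient is then specialized at `y = x_α`. -/
def IsDemazure (α : M) (φ : M →ₗ[ℤ] ℤ) (D : Module.End R (FormalGroupRing F M)) : Prop :=
  ∀ u : FormalGroupRing F M, ∃ v : FormalGroupRing F (M × ℤ),
    fgrX F ((0, 1) : M × ℤ) * v =
      fgrMap F (AddMonoidHom.inl M ℤ) u - fgrMap F (genericReflection φ) u ∧
    D u = fgrMap F (specialize α) v

lemma IsDemazure.x_mul {F : FormalGroup R} {α : M} {φ : M →ₗ[ℤ] ℤ}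
    {D : Module.End R (FormalGroupRing F M)} (hD : IsDemazure F α φ D)
    (u : FormalGroupRing F M) :
    fgrX F α * D u = u - fgrMap F (reflectionHom α φ) u := by
  obtain ⟨v, hv, hDv⟩ := hD u
  have h1 : (specialize α).comp (AddMonoidHom.inl M ℤ) = AddMonoidHom.id M := by
    ext m; simp [specialize]
  have h2 : (specialize α).comp (genericReflection φ) = reflectionHom α φ := by
    ext m; simp [specialize, genericReflection, reflectionHom, sub_eq_add_neg]
  have h3 : specialize α ((0, 1) : M × ℤ) = α := by simp [specialize]
  have h := congrArg (fgrMap F (specialize α)) hv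
  rwa [map_mul, map_sub, fgrMap_fgrX, fgrMap_comp, fgrMap_comp, h1, h2, h3, fgrMap_id,
    ← hDv] at h

open Classical in
/-- The operator `Δ_α` attached to `α` and `φ = α^∨`. -/
def demazure (α : M) (φ : M →ₗ[ℤ] ℤ) : Module.End R (FormalGroupRing F M) :=
  if h : ∃ D, IsDemazure F α φ D then h.choose else 0

/-- The element `e_α = g (x_α, x_{-α})`, where `F (x, y) = x + y - x y g (x, y)`; the coefficient
of `x ^ i y ^ j` in `g` is minus the one of `x ^ (i + 1) y ^ (j + 1)` in `F`. -/
def eElt (α : M) : FormalGroupRing F M :=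
  fgrMk F M (evalTwo (fun i j => - fglCoeff F (i + 1) (j + 1)) α (-α))

/-- The operator `C_α : u ↦ e_α u - Δ_α u`. -/
def cOp (α : M) (φ : M →ₗ[ℤ] ℤ) : Module.End R (FormalGroupRing F M) :=
  Algebra.lmul R (FormalGroupRing F M) (eElt F α) - demazure F α φ

end FormalGroupRing

/-! ### Weyl group, words, torsion index -/

section Weyl

variable {ι M N : Type*} [AddCommGroup M] [AddCommGroup N]
  {P : RootPairing ι ℤ M N} (b : P.Base)

/-- The product `s_{i_1} ⋯ s_{i_l}` of the simple reflections in a word. -/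
def wordProd (I : List b.support) : P.weylGroup :=
  (I.map fun i => RootPairing.weylGroup.ofIdx P i).prod

/-- The length of an element of the Weyl group with respect to the simple reflections. -/
def weylLength (w : P.weylGroup) : ℕ :=
  sInf {n | ∃ I : List b.support, wordProd b I = w ∧ I.length = n}

/-- `I` is a reduced decomposition of `w`. -/
def IsReducedDecomp (I : List b.support) (w : P.weylGroup) : Prop :=
  wordProd b I = w ∧ I.length = weylLength b w

/-- `w` is the longest element of the Weyl group. -/
def IsLongest (w : P.weylGroup) : Prop :=
  ∀ v, weylLength b v ≤ weylLength b w

open Classical in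
variable (P) in
/-- The classical operator `u ↦ (u - s_α u) / α` on the symmetric algebra of `M` over `ℤ`, for the
root `α` of index `i`. -/
def symDemazure (i : ι) (u : SymmetricAlgebra ℤ M) : SymmetricAlgebra ℤ M :=
  if h : ∃ v, v * SymmetricAlgebra.ι ℤ M (P.root i) =
    u - SymmetricAlgebra.lift (SymmetricAlgebra.ι ℤ M ∘ₗ (P.reflection i).toLinearMap) u
  then h.choose else 0

/-- The composition `Δ_{i_1} ∘ ⋯ ∘ Δ_{i_l}` of classical operators. -/
def symDemazureWord (I : List b.support) (u : SymmetricAlgebra ℤ M) : SymmetricAlgebra ℤ M :=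
  I.foldr (fun i v => symDemazure P i v) u

/-- The torsion index: the positive generator of the image of the operator
`Δ_{w_0} : S^N(M) → S^0(M) = ℤ`, where `N` is the length of the longest element `w_0`. -/
def torsionIndex : ℕ :=
  sInf {n | 0 < n ∧ ∃ (w₀ : P.weylGroup) (I : List b.support), IsLongest b w₀ ∧
    IsReducedDecomp b I w₀ ∧
    ∃ a ∈ LinearMap.range (SymmetricAlgebra.ι ℤ M) ^ weylLength b w₀,
      symDemazureWord b I a = algebraMap ℤ (SymmetricAlgebra ℤ M) n}

end Weyl

/-! ### The algebra of operators, its augmentation, and the dual -/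

section Operators

variable {ι M N R : Type*} [AddCommGroup M] [AddCommGroup N] [CommRing R]
  (F : FormalGroup R) (P : RootPairing ι ℤ M N)

/-- `Δ_α` for the root `α` of index `i`. -/
def rootDel (i : ι) : Module.End R (FormalGroupRing F M) :=
  demazure F (P.root i) (P.coroot' i)

/-- `C_α` for the root `α` of index `i`. -/
def rootC (i : ι) : Module.End R (FormalGroupRing F M) :=
  cOp F (P.root i) (P.coroot' i)

variable {P} in
/-- `Δ_I = Δ_{i_1} ∘ ⋯ ∘ Δ_{i_l}` for a word `I` in the simple roots. -/
def delWord (b : P.Base) (I : List b.support) : Module.End R (FormalGroupRing F M) :=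
  (I.map fun i => rootDel F P i).prod

variable {P} in
/-- `C_I = C_{i_1} ∘ ⋯ ∘ C_{i_l}` for a word `I` in the simple roots. -/
def cWord (b : P.Base) (I : List b.support) : Module.End R (FormalGroupRing F M) :=
  (I.map fun i => rootC F P i).prod

/-- The algebra `𝒟(M)_F` of endomorphisms of `R⟦M⟧_F` generated by the `Δ_α`, for all roots `α`,
and by the multiplications by elements of `R⟦M⟧_F`. -/
def opAlgebra : Subalgebra R (Module.End R (FormalGroupRing F M)) :=
  Algebra.adjoin R (Set.range (rootDel F P) ∪ Set.range (Algebra.lmul R (FormalGroupRing F M)))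

lemma rootDel_mem (i : ι) : rootDel F P i ∈ opAlgebra F P :=
  Algebra.subset_adjoin (Or.inl ⟨i, rfl⟩)

lemma lmul_mem (u : FormalGroupRing F M) :
    Algebra.lmul R (FormalGroupRing F M) u ∈ opAlgebra F P :=
  Algebra.subset_adjoin (Or.inr ⟨u, rfl⟩)

lemma rootC_mem (i : ι) : rootC F P i ∈ opAlgebra F P :=
  sub_mem (lmul_mem F P _) (rootDel_mem F P i)

lemma delWord_mem (b : P.Base) (I : List b.support) : delWord F b I ∈ opAlgebra F P :=
  list_prod_mem fun D hD => by
    obtain ⟨i, -, rfl⟩ := List.mem_map.1 hD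
    exact rootDel_mem F P i

lemma cWord_mem (b : P.Base) (I : List b.support) : cWord F b I ∈ opAlgebra F P :=
  list_prod_mem fun D hD => by
    obtain ⟨i, -, rfl⟩ := List.mem_map.1 hD
    exact rootC_mem F P i

/-- The filtration piece `𝒟(M)_F^{(i)}`: the `R⟦M⟧_F`-submodule generated by the
`u Δ_{α_1} ⋯ Δ_{α_n}`, for roots `α_1, …, α_n` and `u ∈ I_F ^ m` with `m - n ≥ i`
(where `I_F ^ m` is `R⟦M⟧_F` for `m ≤ 0`). It is viewed as an `R`-module. -/
def opFil (i : ℤ) : Submodule R (Module.End R (FormalGroupRing F M)) :=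
  (Submodule.span (FormalGroupRing F M)
    {D : Module.End R (FormalGroupRing F M) |
      ∃ (m : ℤ) (l : List ι) (u : FormalGroupRing F M),
        i ≤ m - l.length ∧ u ∈ fgrAugIdeal F M ^ m.toNat ∧
        D = u • (l.map (rootDel F P)).prod}).restrictScalars R

/-- The map `D ↦ ε D` from `R`-linear endomorphisms of `R⟦M⟧_F` to `R`-linear forms. -/
def augComp (F : FormalGroup R) (M : Type*) [AddCommGroup M] :
    Module.End R (FormalGroupRing F M) →ₗ[R] Module.Dual R (FormalGroupRing F M) :=
  (fgrAug F M).toLinearMap.compRight R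

/-- The `R`-module `ε 𝒟(M)_F` of the linear forms `ε D`, for `D ∈ 𝒟(M)_F`. -/
def augOp : Submodule R (Module.Dual R (FormalGroupRing F M)) :=
  (Subalgebra.toSubmodule (opAlgebra F P)).map (augComp F M)

/-- The filtration piece `ε 𝒟(M)_F^{(i)}`, the image of `𝒟(M)_F^{(i)}`. -/
def augOpFil (i : ℤ) : Submodule R (Module.Dual R (FormalGroupRing F M)) :=
  (opFil F P i).map (augComp F M)

/-- The element `ε D` of `ε 𝒟(M)_F`. -/
def augOpMk (D : Module.End R (FormalGroupRing F M)) (hD : D ∈ opAlgebra F P) : augOp F P :=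
  ⟨augComp F M D, D, hD, rfl⟩

/-- `H(M)_F`, the `R`-dual of `ε 𝒟(M)_F`. -/
abbrev HMF : Type _ := Module.Dual R (augOp F P)

/-- The filtration piece `H(M)_F^{(i)}`: the forms that vanish on `ε 𝒟(M)_F^{(-i+1)}`. -/
def hFil (i : ℤ) : Submodule R (HMF F P) where
  carrier := {h | ∀ f : augOp F P, (f : Module.Dual R (FormalGroupRing F M)) ∈
    augOpFil F P (-i + 1) → h f = 0}
  add_mem' := fun h₁ h₂ f hf => by simp [h₁ f hf, h₂ f hf]
  zero_mem' := fun _ _ => rfl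
  smul_mem' := fun c h h₁ f hf => by simp [h₁ f hf]

/-- The characteristic map `c : R⟦M⟧_F → H(M)_F`, sending `u` to the evaluation at `u`. -/
def charMap : FormalGroupRing F M →ₗ[R] HMF F P :=
  LinearMap.compl₂ (LinearMap.applyₗ (R := R) (M := FormalGroupRing F M) (M₂ := R))
    (augOp F P).subtype

lemma charMap_apply (u : FormalGroupRing F M) (f : augOp F P) :
    charMap F P u f = (f : Module.Dual R (FormalGroupRing F M)) u := rfl

/-- Multiplication on the right by `D ∈ 𝒟(M)_F`, the endomorphism `ε E ↦ ε E D` of `ε 𝒟(M)_F`. -/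
def mulRight (D : Module.End R (FormalGroupRing F M)) (hD : D ∈ opAlgebra F P) :
    augOp F P →ₗ[R] augOp F P :=
  (LinearMap.lcomp R R D).restrict fun f hf => by
    obtain ⟨E, hE, rfl⟩ := hf
    exact ⟨E * D, (opAlgebra F P).mul_mem hE hD, rfl⟩

/-- The operator `A_α` on `H(M)_F`, the dual of right multiplication by `C_α`. -/
def opA (i : ι) : Module.End R (HMF F P) :=
  (mulRight F P (rootC F P i) (rootC_mem F P i)).dualMap

/-- The operator `B_α` on `H(M)_F`, the dual of right multiplication by `Δ_α`. -/
def opB (i : ι) : Module.End R (HMF F P) :=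
  (mulRight F P (rootDel F P i) (rootDel_mem F P i)).dualMap

lemma opA_apply (i : ι) (h : HMF F P) (D : Module.End R (FormalGroupRing F M))
    (hD : D ∈ opAlgebra F P) : opA F P i h (augOpMk F P D hD) =
      h (augOpMk F P (D * rootC F P i) (mul_mem hD (rootC_mem F P i))) := rfl

lemma opB_apply (i : ι) (h : HMF F P) (D : Module.End R (FormalGroupRing F M))
    (hD : D ∈ opAlgebra F P) : opB F P i h (augOpMk F P D hD) =
      h (augOpMk F P (D * rootDel F P i) (mul_mem hD (rootDel_mem F P i))) := rfl

variable {P} (b : P.Base)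

/-- `A_I = A_{i_1} ∘ ⋯ ∘ A_{i_l}`. -/
def wordA (I : List b.support) : Module.End R (HMF F P) := (I.map fun i => opA F P i).prod

/-- `B_I = B_{i_1} ∘ ⋯ ∘ B_{i_l}`. -/
def wordB (I : List b.support) : Module.End R (HMF F P) := (I.map fun i => opB F P i).prod

/-- `(z w)_w` is an `R`-basis of `H(M)_F` such that the characteristic map is
`c (u) = ∑_w ε C_{J_w} (u) z_w`, where `J` is a choice of reduced decompositions. -/
def IsCharBasis (J : P.weylGroup → List b.support) (z : P.weylGroup → HMF F P) : Prop :=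
  LinearIndependent R z ∧ Submodule.span R (Set.range z) = ⊤ ∧
    ∀ u, charMap F P u = ∑ᶠ w, fgrAug F M (cWord F b (J w) u) • z w

open Classical in
/-- The basis `(z_{J_w}^C)_w` of `H(M)_F` attached to a choice `J` of reduced decompositions. -/
def charBasis (J : P.weylGroup → List b.support) : P.weylGroup → HMF F P :=
  if h : ∃ z, IsCharBasis F b J z then h.choose else 0

end Operators

end FormalDemazure

end

namespace FormalDemazure

noncomputable section

/-! A basis of M identifies R⟦M⟧_F with a ring of power series in which the augmentation ideal I is
generated by the variables. Say that an operator has order k if it sends I^m into I^(m-k) for all m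
(`opOrder`): multiplications have order 0, divided differences order 1. The proof is a study of
leading terms for this order.

Braid relations may fail for Δ_α, but they hold for leading terms. Moving x_lam through Δ_I by the
twisted Leibniz rule gives, up to order l - 2 (l the length of I), a sum over the words with one
letter of I deleted (`delWord_mul_lmul`), and an operator whose twisted commutators with all x_lam
have small order has small order itself (`mem_opOrder_of_twisted`). By induction on length
(`delWord_filtration`), Δ_I has order l - 1 if I is not reduced, and two reduced words of the same
element give the same operator up to order l - 1.

An element of S^N(M) on which Δ_{w₀} takes the value t, the torsion index, lifts to some u in I^N
with ε Δ_K(u) = t for every reduced word K of w₀ (`exists_fgrAug_delWord_eq_torsionIndex`). The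
matrix of the ε Δ_{I_w} Δ_{I_{v⁻¹w₀}}(u) is then triangular for the length, with t on the diagonal.
As t is regular, the forms ε Δ_{I_w} are independent, and an operator of order k has no component in
lengths above k (`IsLeading.coeff_eq_zero`).

That the Δ_{I_w} span the algebra of operators (`opAlgebra_le_span`) is proved over M ⊕ Q, Q the
root lattice, where each root lifts to a primitive vector. There the same matrix shows that the span
is saturated with respect to the x_α; clearing denominators against the operators of the Weyl group,
it is stable under every Δ_α. The relations are then projected to M.

Since C_α is -Δ_α up to order 0, the C_I have the same leading terms up to sign, and both families
are treated at once (`IsLeading`). The form z₀ vanishes on operators of order less than N and is a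
unit on Δ_K for K a reduced word of w₀ (`IsTopForm`). Hence z₀(ε E_{I_v} E_{I_w}), with E = C or Δ,
is a unit for v w = w₀ and zero for the other pairs with l(v) + l(w) ≤ N: again a triangular matrix,
now invertible, which gives both the bases and the filtration. -/

open MvPowerSeries in
/-- The ideal generated by the variables of a ring of power series. -/
abbrev varIdeal (σ R : Type*) [CommRing R] : Ideal (MvPowerSeries σ R) :=
  Ideal.span (Set.range X)

/-! ### Powers of the ideal of variables, read on coefficients -/

section PowerSeriesIdeal

open MvPowerSeries Finsupp

variable {σ R : Type*} [CommRing R]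

lemma coeff_eq_zero_of_mem_varIdeal_pow {n : ℕ} {f : MvPowerSeries σ R}
    (hf : f ∈ varIdeal σ R ^ n) {d : σ →₀ ℕ} (hd : degree d < n) : coeff d f = 0 := by
  induction n generalizing f d with
  | zero => omega
  | succ n ih =>
    rw [pow_succ'] at hf
    induction hf using Submodule.mul_induction_on' with
    | mem_mul_mem g hg h hh =>
      classical
      rw [coeff_mul]
      refine Finset.sum_eq_zero fun p hp => ?_
      rw [Finset.HasAntidiagonal.mem_antidiagonal] at hp
      have hg0 : coeff 0 g = 0 := by
        have : varIdeal σ R ≤ RingHom.ker (constantCoeff (σ := σ) (R := R)) := by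
          rw [Ideal.span_le]
          rintro _ ⟨i, rfl⟩
          simp [RingHom.mem_ker]
        simpa [RingHom.mem_ker] using this hg
      by_cases h1 : p.1 = 0
      · rw [h1, hg0, zero_mul]
      · rw [ih hh, mul_zero]
        have h2 : 0 < degree p.1 := by
          rw [Nat.pos_iff_ne_zero, Ne, degree_eq_zero_iff]; exact h1
        have h3 : degree d = degree p.1 + degree p.2 := by rw [← hp, map_add]
        omega
    | add g hg h hh ihg ihh => rw [map_add, ihg, ihh, add_zero]

variable [Finite σ]

/-- For the converse, each nonconstant monomial is assigned to one variable dividing it. This splits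
f into finitely many series, the i-th divisible by X i with a quotient whose order is one less;
finiteness of σ makes the sum an element of the ideal. -/
lemma mem_varIdeal_pow_iff {n : ℕ} {f : MvPowerSeries σ R} :
    f ∈ varIdeal σ R ^ n ↔ ∀ d : σ →₀ ℕ, degree d < n → coeff d f = 0 := by
  refine ⟨fun hf d hd => coeff_eq_zero_of_mem_varIdeal_pow hf hd, fun hf => ?_⟩
  classical
  cases nonempty_fintype σ
  induction n generalizing f with
  | zero => simp
  | succ n ih =>
    rcases isEmpty_or_nonempty σ with hσ | hσ
    · have : f = 0 := by
        ext d
        rw [Subsingleton.elim d 0, hf 0 (by simp), map_zero]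
      rw [this]
      exact zero_mem _
    have hex : ∀ d : σ →₀ ℕ, d ≠ 0 → ∃ i, d i ≠ 0 := fun d hd => by
      by_contra! h
      exact hd (Finsupp.ext h)
    choose! pick hpick using hex
    let h : σ → MvPowerSeries σ R := fun i d => if d ≠ 0 ∧ pick d = i then coeff d f else 0
    have hh : ∀ i d, coeff d (h i) = if d ≠ 0 ∧ pick d = i then coeff d f else 0 := fun _ _ => rfl
    have hsum : f = ∑ i, h i := by
      ext d
      rw [map_sum]
      simp only [hh]
      by_cases hd : d = 0
      · subst hd
        simpa using hf 0 (by simp)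
      · simp [hd]
    rw [hsum]
    refine Ideal.sum_mem _ fun i _ => ?_
    have hdvd : X i ∣ h i := X_dvd_iff.2 fun m hm => by
      rw [hh, if_neg]
      rintro ⟨h1, rfl⟩
      exact hpick m h1 hm
    obtain ⟨g, hg⟩ := hdvd
    rw [hg, pow_succ']
    refine Ideal.mul_mem_mul (Ideal.subset_span ⟨i, rfl⟩) (ih fun d hd => ?_)
    have h1 : coeff (single i 1 + d) (h i) = coeff d g := by
      rw [hg, X, coeff_add_monomial_mul, one_mul]
    rw [← h1, hh]
    split_ifs
    · refine hf _ ?_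
      rw [map_add, degree_single]; omega
    · rfl

lemma mem_varIdeal_iff {f : MvPowerSeries σ R} : f ∈ varIdeal σ R ↔ constantCoeff f = 0 := by
  rw [← pow_one (varIdeal σ R), mem_varIdeal_pow_iff]
  simp only [Nat.lt_one_iff, degree_eq_zero_iff, forall_eq, coeff_zero_eq_constantCoeff]

lemma eq_of_sub_mem_varIdeal_pow {f g : MvPowerSeries σ R} (h : ∀ n, f - g ∈ varIdeal σ R ^ n) :
    f = g := by
  ext d
  have := mem_varIdeal_pow_iff.1 (h (degree d + 1)) d (by omega)
  rwa [map_sub, sub_eq_zero] at this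

lemma sub_truncTotal_mem (f : MvPowerSeries σ R) (n : ℕ) :
    f - (truncTotal n f : MvPowerSeries σ R) ∈ varIdeal σ R ^ n := by
  rw [mem_varIdeal_pow_iff]
  intro d hd
  rw [map_sub, MvPolynomial.coeff_coe, coeff_truncTotal _ hd, sub_self]

lemma truncTotal_eq_zero {f : MvPowerSeries σ R} {n : ℕ} (hf : f ∈ varIdeal σ R ^ n) :
    truncTotal n f = 0 := by
  ext d
  rw [coeff_truncTotal_eq_ite, MvPolynomial.coeff_zero]
  split_ifs with h
  · exact mem_varIdeal_pow_iff.1 hf d h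
  · rfl

end PowerSeriesIdeal

/-! ### Existence of formal inverses -/

section FormalInverse

open MvPowerSeries Finsupp

variable {σ R : Type*} [CommRing R] [Finite σ]

lemma hasSubst_pair {f g : MvPowerSeries σ R} (hf : f ∈ varIdeal σ R) (hg : g ∈ varIdeal σ R) :
    HasSubst ![f, g] := by
  refine hasSubst_of_constantCoeff_zero fun s => ?_
  rw [mem_varIdeal_iff] at hf hg
  fin_cases s <;> simpa

lemma coeff_subst_pair {f g : MvPowerSeries σ R} (hf : f ∈ varIdeal σ R) (hg : g ∈ varIdeal σ R)
    (H : MvPowerSeries (Fin 2) R) (e : σ →₀ ℕ) :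
    coeff e (subst ![f, g] H) =
      finsum fun d : Fin 2 →₀ ℕ => coeff d H * coeff e (f ^ d 0 * g ^ d 1) := by
  rw [coeff_subst (hasSubst_pair hf hg)]
  refine finsum_congr fun d => ?_
  rw [Finsupp.prod_fintype _ _ (by simp), Fin.prod_univ_two]
  simp

lemma pow_sub_pow_mem {A : Type*} [CommRing A] {K J : Ideal A} {g h : A} (hgh : g - h ∈ K)
    (hg : g ∈ J) (hh : h ∈ J) {k : ℕ} (hk : 2 ≤ k) : g ^ k - h ^ k ∈ J * K := by
  obtain ⟨k, rfl⟩ := Nat.exists_eq_add_of_le' hk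
  rw [← Commute.geom_sum₂_mul (Commute.all g h)]
  refine Ideal.mul_mem_mul (Ideal.sum_mem _ fun i hi => ?_) hgh
  rw [Finset.mem_range] at hi
  rcases Nat.eq_zero_or_pos i with rfl | hi0
  · exact Ideal.mul_mem_left _ _ (Ideal.pow_mem_of_mem _ hh _ (by omega))
  · exact Ideal.mul_mem_right _ _ (Ideal.pow_mem_of_mem _ hg _ hi0)

/-- A contraction estimate: in every monomial other than the pure linear one in the second variable,
replacing g by h costs g - h times a further factor without constant term. -/
lemma sub_mem_subst_sub {H : MvPowerSeries (Fin 2) R} (hH : coeff (single 1 1) H = 0)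
    {f g h : MvPowerSeries σ R} (hf : f ∈ varIdeal σ R) (hg : g ∈ varIdeal σ R)
    (hh : h ∈ varIdeal σ R) {n : ℕ} (hgh : g - h ∈ varIdeal σ R ^ n) :
    subst ![f, g] H - subst ![f, h] H ∈ varIdeal σ R ^ (n + 1) := by
  rw [mem_varIdeal_pow_iff]
  intro e he
  rw [map_sub, coeff_subst_pair hf hg, coeff_subst_pair hf hh, sub_eq_zero]
  refine finsum_congr fun d => ?_
  by_cases hd : d = single 1 1
  · rw [hd, hH, zero_mul, zero_mul]
  congr 1
  rw [← sub_eq_zero, ← map_sub, ← mul_sub]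
  refine mem_varIdeal_pow_iff.1 ?_ e he
  rw [pow_succ']
  rcases Nat.eq_zero_or_pos (d 0) with h0 | h0
  · rcases Nat.lt_or_ge (d 1) 2 with h1 | h1
    · interval_cases h2 : d 1
      · simp
      · exact absurd (by ext i; fin_cases i <;> simp [h0, h2]) hd
    · exact Ideal.mul_mem_left _ _ (pow_sub_pow_mem hgh hg hh h1)
  · refine Ideal.mul_mem_mul (Ideal.pow_mem_of_mem _ hf _ h0) ?_
    exact Ideal.mem_of_dvd _ (sub_dvd_pow_sub_pow _ _ _) hgh

variable (F : FormalGroup R)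

lemma subst_sub_X_one {f g : MvPowerSeries σ R} (hf : f ∈ varIdeal σ R) (hg : g ∈ varIdeal σ R) :
    subst ![f, g] (F.toPowerSeries - X 1) = subst ![f, g] F.toPowerSeries - g := by
  rw [subst_sub (hasSubst_pair hf hg), subst_X (hasSubst_pair hf hg)]
  rfl

lemma subst_pair_mem {f g : MvPowerSeries σ R} (hf : f ∈ varIdeal σ R) (hg : g ∈ varIdeal σ R) :
    subst ![f, g] F.toPowerSeries ∈ varIdeal σ R := by
  rw [mem_varIdeal_iff]
  refine constantCoeff_subst_eq_zero (hasSubst_pair hf hg) (fun i => ?_) F.zero_constantCoeff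
  rw [mem_varIdeal_iff] at hf hg
  fin_cases i <;> simpa

/-- The successive approximations of the formal inverse of `f`. -/
def formalNegAux (f : MvPowerSeries σ R) : ℕ → MvPowerSeries σ R
  | 0 => 0
  | n + 1 => formalNegAux f n - subst ![f, formalNegAux f n] F.toPowerSeries

/-- The map g ↦ g - F(f, g) is a contraction because F(x, y) - y has no linear term in y; its fixed
point is the inverse. -/
lemma exists_formal_neg {f : MvPowerSeries σ R} (hf : f ∈ varIdeal σ R) :
    ∃ g ∈ varIdeal σ R, subst ![f, g] F.toPowerSeries = 0 := by
  have hmem : ∀ n, formalNegAux F f n ∈ varIdeal σ R := fun n => by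
    induction n with
    | zero => exact zero_mem _
    | succ n ih => exact sub_mem ih (subst_pair_mem F hf ih)
  have hH : coeff (single 1 1) (F.toPowerSeries - X 1) = 0 := by
    rw [map_sub, F.lin_coeff_Y]; simp [coeff_X]
  have hstep : ∀ {n : ℕ} {g h : MvPowerSeries σ R}, g ∈ varIdeal σ R → h ∈ varIdeal σ R →
      g - h ∈ varIdeal σ R ^ n →
      (g - subst ![f, g] F.toPowerSeries) - (h - subst ![f, h] F.toPowerSeries) ∈
        varIdeal σ R ^ (n + 1) := fun {n g h} hg hh hgh => by
    have := sub_mem_subst_sub hH hf hg hh hgh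
    rw [subst_sub_X_one F hf hg, subst_sub_X_one F hf hh] at this
    rw [← neg_mem_iff]
    convert this using 1
    ring
  have hsucc : ∀ n, formalNegAux F f n - formalNegAux F f (n + 1) ∈ varIdeal σ R ^ n := fun n => by
    induction n with
    | zero => simp
    | succ n ih => exact hstep (hmem n) (hmem (n + 1)) ih
  have hcauchy : ∀ n k, formalNegAux F f n - formalNegAux F f (n + k) ∈ varIdeal σ R ^ n :=
    fun n k => by
    induction k with
    | zero => simp
    | succ k ih =>
      have := add_mem ih (Ideal.pow_le_pow_right (Nat.le_add_right n k) (hsucc (n + k)))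
      rwa [sub_add_sub_cancel] at this
  -- The limit of the iterates: coefficients of degree k no longer change from iterate k + 1 on.
  let g : MvPowerSeries σ R := fun d => coeff d (formalNegAux F f (degree d + 1))
  have hg : ∀ n, g - formalNegAux F f n ∈ varIdeal σ R ^ n := fun n => by
    rw [mem_varIdeal_pow_iff]
    intro d hd
    obtain ⟨k, rfl⟩ := Nat.exists_eq_add_of_lt hd
    have := mem_varIdeal_pow_iff.1 (hcauchy (degree d + 1) k) d (by omega)
    rw [map_sub, add_right_comm] at this
    rw [map_sub]
    exact this
  have hg1 : g ∈ varIdeal σ R := by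
    have := add_mem (by simpa using hg 1) (hmem 1)
    rwa [sub_add_cancel] at this
  refine ⟨g, hg1, ?_⟩
  refine eq_of_sub_mem_varIdeal_pow fun n => ?_
  rw [sub_zero]
  have h1 := sub_mem (hg (n + 1)) (hstep hg1 (hmem n) (hg n))
  refine Ideal.pow_le_pow_right (Nat.le_succ n) ?_
  convert h1 using 1
  simp only [formalNegAux]
  ring

end FormalInverse

end

end FormalDemazure

namespace FormalDemazure

noncomputable section

/-! ### The group of formal points -/

section Points

open MvPowerSeries Finsupp

variable {σ R : Type*} [CommRing R] [Finite σ] (F : FormalGroup R)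

/-- The power series without constant term, with the group structure given by `F`. -/
@[ext]
structure FormalPoints (F : FormalGroup R) (σ : Type*) where
  /-- The underlying power series. -/
  val : MvPowerSeries σ R
  mem : val ∈ varIdeal σ R

lemma hasSubst_of_mem {f : MvPowerSeries σ R} (hf : f ∈ varIdeal σ R) : PowerSeries.HasSubst f := by
  rw [mem_varIdeal_iff] at hf
  rw [PowerSeries.HasSubst, hf]
  exact IsNilpotent.zero

namespace FormalPoints

instance : Add (FormalPoints F σ) :=
  ⟨fun f g => ⟨subst ![f.1, g.1] F.toPowerSeries, subst_pair_mem F f.2 g.2⟩⟩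

instance : Zero (FormalPoints F σ) := ⟨⟨0, zero_mem _⟩⟩

instance : Neg (FormalPoints F σ) :=
  ⟨fun f => ⟨(exists_formal_neg F f.2).choose, (exists_formal_neg F f.2).choose_spec.1⟩⟩

lemma val_add (f g : FormalPoints F σ) : (f + g).val = subst ![f.1, g.1] F.toPowerSeries := rfl

omit [Finite σ] in
lemma val_zero : (0 : FormalPoints F σ).val = 0 := rfl

instance [F.IsComm] : AddCommGroup (FormalPoints F σ) where
  add_assoc f g h := FormalPoints.ext
    (F.assoc' (hasSubst_of_mem f.2) (hasSubst_of_mem g.2) (hasSubst_of_mem h.2))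
  zero_add f := FormalPoints.ext (F.zero_add (hasSubst_of_mem f.2))
  add_zero f := FormalPoints.ext (F.add_zero (hasSubst_of_mem f.2))
  add_comm f g := FormalPoints.ext (F.comm' (hasSubst_of_mem f.2) (hasSubst_of_mem g.2))
  neg_add_cancel f := FormalPoints.ext
    ((F.comm' (hasSubst_of_mem (exists_formal_neg F f.2).choose_spec.1) (hasSubst_of_mem f.2)).trans
      (exists_formal_neg F f.2).choose_spec.2)
  nsmul := nsmulRec
  zsmul := zsmulRec

end FormalPoints

/-- Compares substitution into F with the truncated sums that define `evalTwo`: a monomial of total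
degree at least n contributes to the n-th power of the ideal. -/
lemma subst_sub_sum_mem {f g : MvPowerSeries σ R} (hf : f ∈ varIdeal σ R) (hg : g ∈ varIdeal σ R)
    (n : ℕ) : subst ![f, g] F.toPowerSeries -
      ∑ k ∈ Finset.range n, ∑ p ∈ Finset.HasAntidiagonal.antidiagonal k,
        fglCoeff F p.1 p.2 • (f ^ p.1 * g ^ p.2) ∈ varIdeal σ R ^ n := by
  classical
  rw [mem_varIdeal_pow_iff]
  intro e he
  rw [map_sub, coeff_subst_pair hf hg, sub_eq_zero, Finset.sum_sigma', map_sum]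
  let φ : (Σ _ : ℕ, ℕ × ℕ) → (Fin 2 →₀ ℕ) := fun x => single 0 x.2.1 + single 1 x.2.2
  let s := (Finset.range n).sigma fun k => Finset.HasAntidiagonal.antidiagonal k
  have hinj : Set.InjOn φ s := by
    rintro ⟨k, i, j⟩ h1 ⟨k', i', j'⟩ h2 h
    have h0 := DFunLike.congr_fun h 0
    have h1' := DFunLike.congr_fun h 1
    simp only [Finset.coe_sigma, Set.mem_sigma_iff, Finset.mem_coe,
      Finset.HasAntidiagonal.mem_antidiagonal, s] at h1 h2
    simp [φ] at h0 h1'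
    obtain ⟨-, rfl⟩ := h1
    obtain ⟨-, rfl⟩ := h2
    subst h0; subst h1'; rfl
  rw [finsum_eq_sum_of_support_subset (s := s.image φ), Finset.sum_image hinj]
  · refine Finset.sum_congr rfl fun x _ => ?_
    simp [φ, fglCoeff]
  · intro d hd
    rw [Finset.coe_image]
    refine ⟨⟨d 0 + d 1, d 0, d 1⟩, ?_, by ext i; fin_cases i <;> simp [φ]⟩
    simp only [Finset.coe_sigma, Set.mem_sigma_iff, Finset.mem_coe,
      Finset.HasAntidiagonal.mem_antidiagonal, s, and_true, Finset.mem_range]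
    by_contra! hn
    refine hd ?_
    beta_reduce
    rw [mem_varIdeal_pow_iff.1 ?_ e he, mul_zero]
    refine Ideal.pow_le_pow_right hn ?_
    rw [pow_add]
    exact Ideal.mul_mem_mul (Ideal.pow_mem_pow hf _) (Ideal.pow_mem_pow hg _)

end Points

/-! ### Continuous evaluation of completed polynomials in power series -/

section CompletedEval

open MvPowerSeries Finsupp

variable {σ R S : Type*} [CommRing R] [Finite σ] (p : S → MvPowerSeries σ R)
  (hp : ∀ s, p s ∈ varIdeal σ R)

include hp in
lemma aeval_mem_varIdeal_pow (n : ℕ) : polyAugIdeal R S ^ n ≤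
    (varIdeal σ R ^ n).comap (MvPolynomial.aeval p : _ →ₐ[R] MvPowerSeries σ R) := by
  have h : polyAugIdeal R S ≤
      (varIdeal σ R).comap (MvPolynomial.aeval p : _ →ₐ[R] MvPowerSeries σ R) := by
    intro q hq
    rw [Ideal.mem_comap, mem_varIdeal_iff]
    have h1 : (MvPowerSeries.constantCoeff (R := R)).comp
        (MvPolynomial.aeval p : _ →ₐ[R] MvPowerSeries σ R).toRingHom =
        (polyAug R S).toRingHom := by
      refine MvPolynomial.ringHom_ext (fun r => ?_) fun s => ?_
      · simp [polyAug, MvPowerSeries.algebraMap_apply]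
      · have := mem_varIdeal_iff.1 (hp s)
        simp [polyAug, this]
    exact (DFunLike.congr_fun h1 q).trans hq
  exact (Ideal.pow_right_mono h n).trans (Ideal.le_comap_pow _ n)

/-- The homomorphism from `R⟦x_S⟧` to a quotient of a ring of power series induced by `p`. -/
def completedEvalAux (n : ℕ) : CompletedPoly R S →ₐ[R] MvPowerSeries σ R ⧸ varIdeal σ R ^ n :=
  (Ideal.quotientMapₐ (varIdeal σ R ^ n) (MvPolynomial.aeval p)
    (aeval_mem_varIdeal_pow p hp n)).comp
      ((AdicCompletion.evalₐ (polyAugIdeal R S) n).restrictScalars R)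

lemma completedEvalAux_compat {m n : ℕ} (hle : m ≤ n) :
    (Ideal.Quotient.factorₐ R (Ideal.pow_le_pow_right hle)).comp (completedEvalAux p hp n) =
      completedEvalAux p hp m := by
  ext x
  obtain ⟨y, rfl⟩ := AdicCompletion.mk_surjective _ _ x
  simp only [completedEvalAux, AlgHom.comp_apply, AlgHom.restrictScalars_apply,
    AdicCompletion.evalₐ_mk]
  rw [← AdicCompletion.Ideal.mk_eq_mk _ hle]
  rfl

/-- The continuous homomorphism from `R⟦x_S⟧` to a ring of power series sending `x_s` to `p s`. -/
def completedEval : CompletedPoly R S →ₐ[R] MvPowerSeries σ R :=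
  IsAdicComplete.liftAlgHom (varIdeal σ R) (completedEvalAux p hp)
    fun hle => completedEvalAux_compat p hp hle

lemma completedEval_sub_mem {n : ℕ} {x : CompletedPoly R S} {q : MvPolynomial S R}
    (h : AdicCompletion.evalₐ (polyAugIdeal R S) n x = Ideal.Quotient.mk _ q) :
    completedEval p hp x - MvPolynomial.aeval p q ∈ varIdeal σ R ^ n := by
  rw [← Ideal.Quotient.eq]
  have := IsAdicComplete.mk_liftAlgHom (varIdeal σ R) (completedEvalAux p hp)
    (fun hle => completedEvalAux_compat p hp hle) n x
  refine this.trans ?_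
  simp only [completedEvalAux, AlgHom.comp_apply, AlgHom.restrictScalars_apply, h]
  rfl

lemma completedEval_of (q : MvPolynomial S R) :
    completedEval p hp (AdicCompletion.of (polyAugIdeal R S) _ q) = MvPolynomial.aeval p q :=
  eq_of_sub_mem_varIdeal_pow fun n => completedEval_sub_mem p hp (AdicCompletion.evalₐ_of _ n q)

end CompletedEval

/-! ### Coordinates attached to a basis: the two comparison maps -/

section Coordinates

open MvPowerSeries Finsupp

variable {R : Type*} [CommRing R] (F : FormalGroup R) [F.IsComm]
  {M : Type*} [AddCommGroup M] {σ : Type*} [Finite σ] (e : Module.Basis σ ℤ M)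

/-- The homomorphism from `M` to the formal points sending the basis vectors to the variables. -/
def coordHom : M →+ FormalPoints F σ :=
  (e.constr ℤ fun i => (⟨X i, Ideal.subset_span ⟨i, rfl⟩⟩ : FormalPoints F σ)).toAddMonoidHom

/-- The power series expressing `x_lam` in terms of the variables attached to a basis. -/
def coordSeries (lam : M) : MvPowerSeries σ R := (coordHom F e lam).1

lemma coordSeries_mem (lam : M) : coordSeries F e lam ∈ varIdeal σ R := (coordHom F e lam).2

lemma coordSeries_basis (i : σ) : coordSeries F e (e i) = X i := by
  have : coordHom F e (e i) = ⟨X i, Ideal.subset_span ⟨i, rfl⟩⟩ := e.constr_basis ℤ _ i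
  rw [coordSeries, this]

lemma coordSeries_zero : coordSeries F e 0 = 0 := by
  rw [coordSeries, map_zero, FormalPoints.val_zero]

lemma coordSeries_add (lam mu : M) : coordSeries F e (lam + mu) =
    subst ![coordSeries F e lam, coordSeries F e mu] F.toPowerSeries := by
  rw [coordSeries, map_add, FormalPoints.val_add]; rfl

/-- Coordinates on `R⟦x_M⟧`. -/
def coordCompleted : CompletedPoly R M →ₐ[R] MvPowerSeries σ R :=
  completedEval (coordSeries F e) (coordSeries_mem F e)

lemma coordCompleted_X (lam : M) :
    coordCompleted F e (completedX R lam) = coordSeries F e lam := by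
  rw [coordCompleted, completedX, completedEval_of, MvPolynomial.aeval_X]

lemma coordCompleted_evalTwo (lam mu : M) :
    coordCompleted F e (evalTwo (fglCoeff F) lam mu) = coordSeries F e (lam + mu) := by
  refine eq_of_sub_mem_varIdeal_pow fun n => ?_
  have h1 := completedEval_sub_mem (coordSeries F e) (coordSeries_mem F e)
    (evalₐ_evalTwo (fglCoeff F) lam mu n)
  have h2 := subst_sub_sum_mem F (coordSeries_mem F e lam) (coordSeries_mem F e mu) n
  rw [← coordSeries_add] at h2
  convert sub_mem h1 h2 using 1
  simp [coordCompleted, homogPart, Algebra.smul_def, mul_assoc]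

lemma coordCompleted_mem_of_evalₐ_eq_zero {n : ℕ} {y : CompletedPoly R M}
    (hy : AdicCompletion.evalₐ (polyAugIdeal R M) n y = 0) :
    coordCompleted F e y ∈ varIdeal σ R ^ n := by
  have := completedEval_sub_mem (coordSeries F e) (coordSeries_mem F e) (q := 0)
    (hy.trans (map_zero _).symm)
  simpa [coordCompleted] using this

/-- The generators are killed by the group law of formal points; continuity and separatedness of the
power series ring take care of the closure. -/
lemma coordCompleted_eq_zero {y : CompletedPoly R M} (hy : y ∈ fgrIdeal F M) :
    coordCompleted F e y = 0 := by
  refine eq_of_sub_mem_varIdeal_pow fun n => ?_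
  rw [sub_zero]
  have h : Ideal.span (fgrGenerators F M) ⊔
      RingHom.ker (AdicCompletion.evalₐ (polyAugIdeal R M) n) ≤
      (varIdeal σ R ^ n).comap (coordCompleted F e) := by
    refine sup_le (Ideal.span_le.2 ?_) fun z hz => coordCompleted_mem_of_evalₐ_eq_zero F e hz
    rintro z (rfl | ⟨p, rfl⟩)
    · simp [coordCompleted_X, coordSeries_zero]
    · simp [coordCompleted_X, coordCompleted_evalTwo]
  exact h ((Submodule.mem_iInf _).1 hy n)

omit [Finite σ] in
omit [AddCommGroup M] in
lemma rename_mem_polyAugIdeal_pow (f : σ → M) {n : ℕ} {q : MvPolynomial σ R}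
    (hq : q ∈ MvPolynomial.idealOfVars σ R ^ n) :
    MvPolynomial.rename f q ∈ polyAugIdeal R M ^ n := by
  have h : MvPolynomial.idealOfVars σ R ≤
      (polyAugIdeal R M).comap (MvPolynomial.rename f : _ →ₐ[R] MvPolynomial M R) := by
    rw [Ideal.span_le]
    rintro _ ⟨i, rfl⟩
    simp [X_mem_polyAugIdeal]
  exact ((Ideal.pow_right_mono h n).trans (Ideal.le_comap_pow _ n)) hq

/-- The element of `R⟦x_M⟧` obtained from a power series by substituting `x_{e i}` for the variable
of index `i`. -/
def coordLift (f : MvPowerSeries σ R) : CompletedPoly R M :=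
  AdicCompletion.mk (polyAugIdeal R M) (MvPolynomial M R)
    (AdicCompletion.AdicCauchySequence.mk _ _
      (fun n => MvPolynomial.rename e (truncTotal n f)) fun n => by
        rw [SModEq.sub_mem, ← map_sub]
        simpa using rename_mem_polyAugIdeal_pow e
          (truncTotal_sub_truncTotal_mem_pow_idealOfVars le_rfl n.le_succ f))

lemma evalₐ_coordLift (f : MvPowerSeries σ R) (n : ℕ) :
    AdicCompletion.evalₐ (polyAugIdeal R M) n (coordLift e f) =
      Ideal.Quotient.mk _ (MvPolynomial.rename e (truncTotal n f)) := by
  simp [coordLift]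

lemma aeval_coordSeries_rename (q : MvPolynomial σ R) :
    MvPolynomial.aeval (coordSeries F e) (MvPolynomial.rename e q) = (q : MvPowerSeries σ R) := by
  have : (MvPolynomial.aeval (coordSeries F e)).comp (MvPolynomial.rename e) =
      (MvPolynomial.coeToMvPowerSeries.algHom R : MvPolynomial σ R →ₐ[R] MvPowerSeries σ R) := by
    ext1 i
    simp [coordSeries_basis]
  simpa using DFunLike.congr_fun this q

lemma coordCompleted_coordLift (f : MvPowerSeries σ R) :
    coordCompleted F e (coordLift e f) = f := by
  refine eq_of_sub_mem_varIdeal_pow fun n => ?_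
  have h1 := completedEval_sub_mem (coordSeries F e) (coordSeries_mem F e)
    (evalₐ_coordLift e f n)
  rw [aeval_coordSeries_rename] at h1
  convert sub_mem h1 (sub_truncTotal_mem f n) using 1
  simp [coordCompleted]

omit [AddCommGroup M] in
lemma of_mem_ker_evalₐ {n : ℕ} {q : MvPolynomial M R} (hq : q ∈ polyAugIdeal R M ^ n) :
    AdicCompletion.of (polyAugIdeal R M) _ q ∈
      RingHom.ker (AdicCompletion.evalₐ (polyAugIdeal R M) n) := by
  rw [RingHom.mem_ker, AdicCompletion.evalₐ_of]
  exact Ideal.Quotient.eq_zero_iff_mem.2 hq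

/-- The homomorphism from a ring of power series to a discrete quotient of `R⟦x_M⟧` sending the
variable of index `i` to the class of `x_{e i}`. -/
def coordQuot (n : ℕ) (K : Ideal (CompletedPoly R M))
    (hK : RingHom.ker (AdicCompletion.evalₐ (polyAugIdeal R M) n) ≤ K) :
    MvPowerSeries σ R →+* CompletedPoly R M ⧸ K :=
  (Ideal.Quotient.lift (MvPolynomial.idealOfVars σ R ^ n)
    (((Ideal.Quotient.mk K).comp (algebraMap (MvPolynomial M R) (CompletedPoly R M))).comp
      (MvPolynomial.rename e : MvPolynomial σ R →ₐ[R] MvPolynomial M R).toRingHom)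
    fun _ hq => Ideal.Quotient.eq_zero_iff_mem.2
      (hK (of_mem_ker_evalₐ (rename_mem_polyAugIdeal_pow e hq)))).comp
    (truncTotalAlgHom σ R n).toRingHom

section Quot

variable {n : ℕ} {K : Ideal (CompletedPoly R M)}
    (hK : RingHom.ker (AdicCompletion.evalₐ (polyAugIdeal R M) n) ≤ K)

lemma coordQuot_apply (f : MvPowerSeries σ R) : coordQuot e n K hK f =
    Ideal.Quotient.mk K
      (AdicCompletion.of (polyAugIdeal R M) _ (MvPolynomial.rename e (truncTotal n f))) := rfl

lemma coordQuot_eq_zero {f : MvPowerSeries σ R} (hf : f ∈ varIdeal σ R ^ n) :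
    coordQuot e n K hK f = 0 := by
  rw [coordQuot_apply, truncTotal_eq_zero hf, map_zero, map_zero, map_zero]

lemma coordQuot_coe (q : MvPolynomial σ R) : coordQuot e n K hK (q : MvPowerSeries σ R) =
    Ideal.Quotient.mk K (AdicCompletion.of (polyAugIdeal R M) _ (MvPolynomial.rename e q)) := by
  rw [coordQuot_apply, Ideal.Quotient.eq, ← map_sub, ← map_sub]
  refine hK (of_mem_ker_evalₐ (rename_mem_polyAugIdeal_pow e ?_))
  rw [MvPolynomial.mem_pow_idealOfVars_iff']
  intro d hd
  rw [MvPolynomial.coeff_sub, coeff_truncTotal _ hd, MvPolynomial.coeff_coe, sub_self]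

end Quot

end Coordinates

end

end FormalDemazure

namespace FormalDemazure

noncomputable section

/-! ### Cancellation in a truncated group law -/

section Cancellation

variable {B : Type*} [CommRing B]

/-- The value at `(a, b)` of the part of degree less than `n` of a power series in two variables. -/
def truncEval (c : ℕ → ℕ → B) (n : ℕ) (a b : B) : B :=
  ∑ k ∈ Finset.range n, ∑ p ∈ Finset.HasAntidiagonal.antidiagonal k,
    c p.1 p.2 * (a ^ p.1 * b ^ p.2)

/-- The difference of the two values is b - b' times 1 + (nilpotent): the coefficient of the linear
term in b gives the 1, which requires n ≥ 2, and every other term retains a factor a, b or b'. -/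
lemma truncEval_right_cancel {c : ℕ → ℕ → B} (hc : c 0 1 = 1) {n : ℕ} (hn : 2 ≤ n) {a b b' : B}
    (ha : IsNilpotent a) (hb : IsNilpotent b) (hb' : IsNilpotent b')
    (h : truncEval c n a b = truncEval c n a b') : b = b' := by
  classical
  let S : ℕ → B := fun j => ∑ i ∈ Finset.range j, b ^ i * b' ^ (j - 1 - i)
  have hS : ∀ j, b ^ j - b' ^ j = S j * (b - b') := fun j =>
    (Commute.geom_sum₂_mul (Commute.all b b') j).symm
  let f : (Σ _ : ℕ, ℕ × ℕ) → B := fun x => c x.2.1 x.2.2 * (a ^ x.2.1 * S x.2.2)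
  let s := (Finset.range n).sigma fun k => Finset.HasAntidiagonal.antidiagonal k
  have h1 : (∑ x ∈ s, f x) * (b - b') = 0 := by
    rw [truncEval, truncEval, ← sub_eq_zero, Finset.sum_sigma', Finset.sum_sigma',
      ← Finset.sum_sub_distrib] at h
    rw [← h, Finset.sum_mul]
    refine Finset.sum_congr rfl fun x _ => ?_
    rw [← mul_sub, ← mul_sub, hS]
    ring
  have h01 : (⟨1, 0, 1⟩ : Σ _ : ℕ, ℕ × ℕ) ∈ s := by
    simp only [s, Finset.mem_sigma, Finset.mem_range, Finset.HasAntidiagonal.mem_antidiagonal]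
    exact ⟨hn, trivial⟩
  have hf01 : f ⟨1, 0, 1⟩ = 1 := by simp [f, S, hc]
  have hnil : IsNilpotent (∑ x ∈ s.erase ⟨1, 0, 1⟩, f x) := by
    rw [← mem_nilradical]
    refine Ideal.sum_mem _ fun x hx => ?_
    obtain ⟨k, i, j⟩ := x
    simp only [s, Finset.mem_erase, Finset.mem_sigma, Finset.HasAntidiagonal.mem_antidiagonal] at hx
    refine Ideal.mul_mem_left _ _ ?_
    rcases Nat.eq_zero_or_pos i with rfl | hi
    · refine Ideal.mul_mem_left _ _ (Ideal.sum_mem _ fun l hl => ?_)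
      rw [Finset.mem_range] at hl
      change l < j at hl
      rcases Nat.eq_zero_or_pos l with rfl | hl0
      · refine Ideal.mul_mem_left _ _ (Ideal.pow_mem_of_mem _ (mem_nilradical.2 hb') _ ?_)
        by_contra hj
        have hj1 : j = 1 := by
          change ¬ 0 < j - 1 - 0 at hj
          omega
        subst hj1
        obtain ⟨h2, -, h3⟩ := hx
        simp at h3
        subst h3
        exact h2 rfl
      · exact Ideal.mul_mem_right _ _ (Ideal.pow_mem_of_mem _ (mem_nilradical.2 hb) _ hl0)
    · exact Ideal.mul_mem_right _ _ (Ideal.pow_mem_of_mem _ (mem_nilradical.2 ha) _ hi)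
  have hu : IsUnit (∑ x ∈ s, f x) := by
    rw [← Finset.add_sum_erase s f h01, hf01]
    exact hnil.isUnit_one_add
  exact sub_eq_zero.1 ((hu.mul_right_eq_zero).1 h1)

end Cancellation

/-! ### The isomorphism of the formal group ring with power series -/

section Coordinates

open MvPowerSeries Finsupp

variable {R : Type*} [CommRing R] (F : FormalGroup R) [F.IsComm]
  {M : Type*} [AddCommGroup M] {σ : Type*} [Finite σ] (e : Module.Basis σ ℤ M)

lemma ker_evalₐ_antitone {S : Type*} {m n : ℕ} (h : m ≤ n) :
    RingHom.ker (AdicCompletion.evalₐ (polyAugIdeal R S) n) ≤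
      RingHom.ker (AdicCompletion.evalₐ (polyAugIdeal R S) m) := by
  intro z hz
  rw [RingHom.mem_ker] at hz ⊢
  obtain ⟨y, rfl⟩ := AdicCompletion.mk_surjective _ _ z
  rw [AdicCompletion.evalₐ_mk] at hz ⊢
  rw [← AdicCompletion.Ideal.mk_eq_mk _ h]
  rw [Ideal.Quotient.eq_zero_iff_mem] at hz ⊢
  exact Ideal.pow_le_pow_right h hz

section Quot

variable {n : ℕ} {K : Ideal (CompletedPoly R M)}
    (hK : RingHom.ker (AdicCompletion.evalₐ (polyAugIdeal R M) n) ≤ K)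

omit [Finite σ] [F.IsComm] [AddCommGroup M] in
include hK in
lemma mk_evalTwo (a : ℕ → ℕ → R) (s t : M) : Ideal.Quotient.mk K (evalTwo a s t) =
    truncEval (fun i j => algebraMap R _ (a i j)) n
      (Ideal.Quotient.mk K (completedX R s)) (Ideal.Quotient.mk K (completedX R t)) := by
  have h : evalTwo a s t - AdicCompletion.of (polyAugIdeal R M) _
      (∑ k ∈ Finset.range n, homogPart a s t k) ∈ K := by
    refine hK ?_
    rw [RingHom.mem_ker, map_sub, evalₐ_evalTwo, AdicCompletion.evalₐ_of, sub_self]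
  rw [Ideal.Quotient.eq.2 h]
  let g : MvPolynomial M R →+* CompletedPoly R M ⧸ K :=
    (Ideal.Quotient.mk K).comp (algebraMap (MvPolynomial M R) (CompletedPoly R M))
  have hg : ∀ q, Ideal.Quotient.mk K (AdicCompletion.of (polyAugIdeal R M) _ q) = g q :=
    fun _ => rfl
  have hC : ∀ r, g (MvPolynomial.C r) = algebraMap R _ r := fun _ => rfl
  simp only [completedX, hg, truncEval, homogPart, map_sum, map_mul, map_pow, hC, mul_assoc]

lemma coordQuot_smul (r : R) (f : MvPowerSeries σ R) :
    coordQuot e n K hK (r • f) = algebraMap R _ r * coordQuot e n K hK f := by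
  rw [MvPowerSeries.smul_eq_C_mul, map_mul]
  congr 1
  have := coordQuot_coe e hK (MvPolynomial.C r)
  rw [MvPolynomial.coe_C, MvPolynomial.rename_C] at this
  exact this

omit [F.IsComm] in
lemma coordQuot_subst {f g : MvPowerSeries σ R} (hf : f ∈ varIdeal σ R) (hg : g ∈ varIdeal σ R) :
    coordQuot e n K hK (subst ![f, g] F.toPowerSeries) =
      truncEval (fun i j => algebraMap R _ (fglCoeff F i j)) n
        (coordQuot e n K hK f) (coordQuot e n K hK g) := by
  have := coordQuot_eq_zero e hK (subst_sub_sum_mem F hf hg n)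
  rw [map_sub, sub_eq_zero] at this
  rw [this]
  simp only [map_sum, coordQuot_smul, map_mul, map_pow, truncEval]

/-- Both sides are additive in lam for the truncated group law, so they agree on a subgroup. Closure
under negation comes from the cancellation of nilpotents, and the subgroup contains the basis. -/
lemma coordQuot_coordSeries (hn : 2 ≤ n) (hg : fgrGenerators F M ⊆ K) (lam : M) :
    coordQuot e n K hK (coordSeries F e lam) = Ideal.Quotient.mk K (completedX R lam) := by
  have hz : Ideal.Quotient.mk K (completedX R (0 : M)) = 0 :=
    Ideal.Quotient.eq_zero_iff_mem.2 (hg (Or.inl rfl))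
  have hadd : ∀ s t : M, Ideal.Quotient.mk K (completedX R (s + t)) =
      truncEval (fun i j => algebraMap R _ (fglCoeff F i j)) n
      (Ideal.Quotient.mk K (completedX R s)) (Ideal.Quotient.mk K (completedX R t)) := fun s t => by
    rw [← mk_evalTwo hK]
    exact Ideal.Quotient.eq.2 (hg (Or.inr ⟨(s, t), rfl⟩))
  have hadd' : ∀ s t : M, coordQuot e n K hK (coordSeries F e (s + t)) =
      truncEval (fun i j => algebraMap R _ (fglCoeff F i j)) n
      (coordQuot e n K hK (coordSeries F e s)) (coordQuot e n K hK (coordSeries F e t)) :=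
    fun s t => by
      rw [← coordQuot_subst F e hK (coordSeries_mem F e s) (coordSeries_mem F e t),
        coordSeries_add]
  have hnil : ∀ s : M, IsNilpotent (Ideal.Quotient.mk K (completedX R s)) := fun s => by
    refine ⟨n, ?_⟩
    rw [← map_pow]
    refine Ideal.Quotient.eq_zero_iff_mem.2 (hK ?_)
    rw [RingHom.mem_ker, map_pow, completedX, AdicCompletion.evalₐ_of, ← map_pow]
    exact Ideal.Quotient.eq_zero_iff_mem.2 (Ideal.pow_mem_pow (X_mem_polyAugIdeal s) n)
  have hnil' : ∀ s : M, IsNilpotent (coordQuot e n K hK (coordSeries F e s)) := fun s => by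
    refine ⟨n, ?_⟩
    rw [← map_pow]
    exact coordQuot_eq_zero e hK (Ideal.pow_mem_pow (coordSeries_mem F e s) n)
  let H : AddSubgroup M :=
    { carrier := {lam | coordQuot e n K hK (coordSeries F e lam) =
        Ideal.Quotient.mk K (completedX R lam)}
      zero_mem' := by
        change _ = _
        rw [coordSeries_zero, map_zero, hz]
      add_mem' := fun {s t} hs ht => by
        change _ = _ at hs ht ⊢
        rw [hadd, hadd', hs, ht]
      neg_mem' := fun {s} hs => by
        change _ = _ at hs ⊢
        have hc : algebraMap R (CompletedPoly R M ⧸ K) (fglCoeff F 0 1) = 1 := by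
          rw [fglCoeff, single_zero, zero_add, F.lin_coeff_Y, map_one]
        refine truncEval_right_cancel (c := fun i j => algebraMap R _ (fglCoeff F i j)) hc hn
          (hnil s) (hnil' (-s)) (hnil (-s)) ?_
        rw [← hadd, ← hs, ← hadd', add_neg_cancel, hz, coordSeries_zero, map_zero] }
  have htop : Submodule.span ℤ (Set.range e) ≤ AddSubgroup.toIntSubmodule H := by
    rw [Submodule.span_le]
    rintro _ ⟨i, rfl⟩
    change _ = _
    rw [coordSeries_basis]
    have := coordQuot_coe e hK (MvPolynomial.X i)
    rwa [MvPolynomial.coe_X, MvPolynomial.rename_X] at this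
  exact htop (by rw [e.span_eq]; trivial)

end Quot

/-- Injectivity of the coordinates. Modulo each neighbourhood K of the ideal, `coordQuot` recovers
the class of a polynomial from its power series; that of y is represented by a polynomial whose
series lies in the n-th power of the ideal, and this is killed. -/
lemma mem_fgrIdeal_of_coordCompleted_eq_zero {y : CompletedPoly R M}
    (hy : coordCompleted F e y = 0) : y ∈ fgrIdeal F M := by
  rw [fgrIdeal, Submodule.mem_iInf]
  intro m
  -- A smaller neighbourhood may be used; the shift by 2 ensures that the linear terms of F survive
  -- the truncation.
  refine sup_le_sup_left (ker_evalₐ_antitone (Nat.le_add_right m 2)) _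
    (?_ : y ∈ Ideal.span (fgrGenerators F M) ⊔ RingHom.ker
      (AdicCompletion.evalₐ (polyAugIdeal R M) (m + 2)))
  set n := m + 2 with hn
  set K := Ideal.span (fgrGenerators F M) ⊔ RingHom.ker
      (AdicCompletion.evalₐ (polyAugIdeal R M) n) with hKdef
  have hK : RingHom.ker (AdicCompletion.evalₐ (polyAugIdeal R M) n) ≤ K := le_sup_right
  have hg : fgrGenerators F M ⊆ K := fun z hz => Ideal.mem_sup_left (Ideal.subset_span hz)
  obtain ⟨q, hq⟩ := Ideal.Quotient.mk_surjective (AdicCompletion.evalₐ (polyAugIdeal R M) n y)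
  have h1 := completedEval_sub_mem (coordSeries F e) (coordSeries_mem F e) hq.symm
  change coordCompleted F e y - _ ∈ _ at h1
  rw [hy, zero_sub, neg_mem_iff] at h1
  have h2 : (coordQuot e n K hK).comp
      (MvPolynomial.aeval (coordSeries F e) : _ →ₐ[R] MvPowerSeries σ R).toRingHom =
      (Ideal.Quotient.mk K).comp (algebraMap (MvPolynomial M R) (CompletedPoly R M)) := by
    refine MvPolynomial.ringHom_ext (fun r => ?_) fun s => ?_
    · have := coordQuot_coe e hK (MvPolynomial.C r)
      rw [MvPolynomial.coe_C, MvPolynomial.rename_C] at this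
      change coordQuot e n K hK (MvPolynomial.aeval (coordSeries F e) (MvPolynomial.C r)) = _
      rw [MvPolynomial.aeval_C]
      exact this
    · change coordQuot e n K hK (MvPolynomial.aeval (coordSeries F e) (MvPolynomial.X s)) = _
      rw [MvPolynomial.aeval_X]
      exact coordQuot_coordSeries F e hK (by omega) hg s
  have h3 : Ideal.Quotient.mk K (AdicCompletion.of (polyAugIdeal R M) _ q) = 0 :=
    (DFunLike.congr_fun h2 q).symm.trans (coordQuot_eq_zero e hK h1)
  have h4 : y - AdicCompletion.of (polyAugIdeal R M) _ q ∈ K := hK (by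
    rw [RingHom.mem_ker, map_sub, AdicCompletion.evalₐ_of, ← hq]; exact sub_self _)
  have h5 := add_mem h4 (Ideal.Quotient.eq_zero_iff_mem.1 h3)
  rwa [sub_add_cancel] at h5

/-- A basis of `M` identifies `R⟦M⟧_F` with a ring of power series. -/
def coordEquiv : FormalGroupRing F M ≃ₐ[R] MvPowerSeries σ R :=
  AlgEquiv.ofBijective
    (Ideal.Quotient.liftₐ (fgrIdeal F M) (coordCompleted F e) fun _ hy =>
      coordCompleted_eq_zero F e hy)
    ⟨(injective_iff_map_eq_zero _).2 fun u hu => by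
        obtain ⟨y, rfl⟩ := Ideal.Quotient.mk_surjective u
        exact Ideal.Quotient.eq_zero_iff_mem.2 (mem_fgrIdeal_of_coordCompleted_eq_zero F e hu),
      fun f => ⟨fgrMk F M (coordLift e f), coordCompleted_coordLift F e f⟩⟩

lemma coordEquiv_mk (y : CompletedPoly R M) :
    coordEquiv F e (fgrMk F M y) = coordCompleted F e y := rfl

lemma coordEquiv_fgrX (lam : M) : coordEquiv F e (fgrX F lam) = coordSeries F e lam :=
  coordCompleted_X F e lam

lemma coordEquiv_basis (i : σ) : coordEquiv F e (fgrX F (e i)) = X i := by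
  rw [coordEquiv_fgrX, coordSeries_basis]

end Coordinates

end

end FormalDemazure

namespace FormalDemazure

noncomputable section

lemma mem_nonZeroDivisors_of_algEquiv {R A B : Type*} [CommRing R] [CommRing A] [CommRing B]
    [Algebra R A] [Algebra R B] (φ : A ≃ₐ[R] B) {a : A} (ha : φ a ∈ B⁰) : a ∈ A⁰ := by
  rw [mem_nonZeroDivisors_iff_right] at ha ⊢
  intro b hb
  have := ha (φ b) (by rw [← map_mul, hb, map_zero])
  exact (map_eq_zero_iff φ φ.injective).1 this

/-! ### The augmentation and its compatibility with functoriality -/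

section Augmentation

variable {R : Type*} [CommRing R] (F : FormalGroup R) {M M' : Type*} [AddCommGroup M]
  [AddCommGroup M']

omit [AddCommGroup M] in
lemma completedAug_of_evalₐ {y : CompletedPoly R M} {q : MvPolynomial M R}
    (h : AdicCompletion.evalₐ (polyAugIdeal R M) 1 y = Ideal.Quotient.mk _ q) :
    completedAug M y = polyAug R M q := by
  simp only [completedAug, AlgHom.comp_apply, AlgHom.restrictScalars_apply, h]
  rfl

lemma fgrAug_mk (y : CompletedPoly R M) : fgrAug F M (fgrMk F M y) = completedAug M y := rfl

lemma fgrMk_surjective : Function.Surjective (fgrMk F M) := Ideal.Quotient.mk_surjective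

lemma fgrAug_fgrX (lam : M) : fgrAug F M (fgrX F lam) = 0 := by
  rw [fgrX, fgrAug_mk, completedX,
    completedAug_of_evalₐ (AdicCompletion.evalₐ_of _ 1 (MvPolynomial.X lam))]
  simp [polyAug]

lemma mem_fgrAugIdeal {u : FormalGroupRing F M} : u ∈ fgrAugIdeal F M ↔ fgrAug F M u = 0 := Iff.rfl

lemma fgrX_mem (lam : M) : fgrX F lam ∈ fgrAugIdeal F M := fgrAug_fgrX F lam

lemma fgrAug_fgrMap (f : M →+ M') (u : FormalGroupRing F M) :
    fgrAug F M' (fgrMap F f u) = fgrAug F M u := by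
  obtain ⟨y, rfl⟩ := fgrMk_surjective F u
  change completedAug M' (completedMap f y) = completedAug M y
  obtain ⟨q, hq⟩ := Ideal.Quotient.mk_surjective (AdicCompletion.evalₐ (polyAugIdeal R M) 1 y)
  have h : AdicCompletion.evalₐ (polyAugIdeal R M') 1 (completedMap f y) =
      Ideal.Quotient.mk _ (MvPolynomial.rename f q) := by
    rw [evalₐ_completedMap, ← hq]; rfl
  rw [completedAug_of_evalₐ h, completedAug_of_evalₐ hq.symm, polyAug, polyAug,
    MvPolynomial.aeval_rename]
  rfl

lemma fgrMap_mem_pow (f : M →+ M') {n : ℕ} {u : FormalGroupRing F M}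
    (hu : u ∈ fgrAugIdeal F M ^ n) : fgrMap F f u ∈ fgrAugIdeal F M' ^ n := by
  have h : fgrAugIdeal F M ≤ (fgrAugIdeal F M').comap (fgrMap F f) := fun v hv => by
    rw [Ideal.mem_comap, mem_fgrAugIdeal, fgrAug_fgrMap]
    exact hv
  exact ((Ideal.pow_right_mono h n).trans (Ideal.le_comap_pow _ n)) hu

end Augmentation

/-! ### The augmentation ideal in coordinates -/

section Coordinates

open MvPowerSeries Finsupp

variable {R : Type*} [CommRing R] (F : FormalGroup R) [F.IsComm]
  {M : Type*} [AddCommGroup M] {σ : Type*} [Finite σ] (e : Module.Basis σ ℤ M)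

lemma constantCoeff_coordEquiv (u : FormalGroupRing F M) :
    constantCoeff (coordEquiv F e u) = fgrAug F M u := by
  obtain ⟨y, rfl⟩ := fgrMk_surjective F u
  obtain ⟨q, hq⟩ := Ideal.Quotient.mk_surjective (AdicCompletion.evalₐ (polyAugIdeal R M) 1 y)
  rw [coordEquiv_mk, fgrAug_mk, completedAug_of_evalₐ hq.symm]
  have h1 := completedEval_sub_mem (coordSeries F e) (coordSeries_mem F e) hq.symm
  have h2 : q - MvPolynomial.C (polyAug R M q) ∈ polyAugIdeal R M ^ 1 := by
    rw [pow_one, polyAugIdeal, RingHom.mem_ker, map_sub, sub_eq_zero]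
    simp [polyAug]
  have h3 := add_mem h1 (aeval_mem_varIdeal_pow _ (coordSeries_mem F e) 1 h2)
  rw [map_sub, MvPolynomial.aeval_C, sub_add_sub_cancel, pow_one, mem_varIdeal_iff, map_sub,
    sub_eq_zero] at h3
  exact h3.trans (by simp [MvPowerSeries.algebraMap_apply])

lemma map_fgrAugIdeal : (fgrAugIdeal F M).map (coordEquiv F e) = varIdeal σ R := by
  ext f
  rw [Ideal.mem_map_of_equiv (coordEquiv F e), mem_varIdeal_iff]
  constructor
  · rintro ⟨u, hu, rfl⟩
    rw [constantCoeff_coordEquiv]; exact hu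
  · intro hf
    refine ⟨(coordEquiv F e).symm f, ?_, by simp⟩
    rw [mem_fgrAugIdeal, ← constantCoeff_coordEquiv F e]
    simpa

lemma coordEquiv_mem_iff {n : ℕ} {u : FormalGroupRing F M} :
    coordEquiv F e u ∈ varIdeal σ R ^ n ↔ u ∈ fgrAugIdeal F M ^ n := by
  rw [← map_fgrAugIdeal F e, ← Ideal.map_pow, Ideal.mem_map_of_equiv (coordEquiv F e)]
  constructor
  · rintro ⟨v, hv, h⟩
    rwa [← (coordEquiv F e).injective h]
  · exact fun hu => ⟨u, hu, rfl⟩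

lemma fgrAugIdeal_eq_span : fgrAugIdeal F M = Ideal.span (Set.range fun i => fgrX F (e i)) := by
  have h : (fgrAugIdeal F M).map (coordEquiv F e) =
      (Ideal.span (Set.range fun i => fgrX F (e i))).map (coordEquiv F e) := by
    have hX : coordEquiv F e ∘ (fun i => fgrX F (e i)) = X :=
      funext fun i => coordEquiv_basis F e i
    rw [map_fgrAugIdeal, Ideal.map_span, ← Set.range_comp, hX]
  ext u
  have h2 : ∀ K : Ideal (FormalGroupRing F M), u ∈ K ↔ coordEquiv F e u ∈ K.map (coordEquiv F e) :=
    fun K => by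
      rw [Ideal.mem_map_of_equiv (coordEquiv F e)]
      constructor
      · exact fun hu => ⟨u, hu, rfl⟩
      · rintro ⟨v, hv, h⟩
        rwa [← (coordEquiv F e).injective h]
  rw [h2, h, ← h2]

lemma fgrX_basis_mem_nonZeroDivisors (i : σ) :
    fgrX F (e i) ∈ (FormalGroupRing F M)⁰ := by
  refine mem_nonZeroDivisors_of_algEquiv (coordEquiv F e) ?_
  rw [coordEquiv_basis]
  exact X_mem_nonzeroDivisors

/-- Divisibility by a variable is a condition on individual coefficients, so the ideal generated by
a coordinate is closed. -/
lemma dvd_of_forall_exists_sub_mem {i : σ} {u : FormalGroupRing F M}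
    (h : ∀ n, ∃ v, u - fgrX F (e i) * v ∈ fgrAugIdeal F M ^ n) : fgrX F (e i) ∣ u := by
  have h1 : X i ∣ coordEquiv F e u := X_dvd_iff.2 fun m hm => by
    obtain ⟨v, hv⟩ := h (degree m + 1)
    rw [← coordEquiv_mem_iff F e, map_sub, map_mul, coordEquiv_basis] at hv
    have := mem_varIdeal_pow_iff.1 hv m (by omega)
    rwa [map_sub, X_dvd_iff.1 (dvd_mul_right _ _) m hm, sub_zero] at this
  obtain ⟨g, hg⟩ := h1
  refine ⟨(coordEquiv F e).symm g, (coordEquiv F e).injective ?_⟩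
  rw [map_mul, coordEquiv_basis, hg]
  simp

lemma exists_aeval_sub_mem (u : FormalGroupRing F M) (n : ℕ) : ∃ q : MvPolynomial σ R,
    u - MvPolynomial.aeval (fun i => fgrX F (e i)) q ∈ fgrAugIdeal F M ^ n := by
  refine ⟨truncTotal n (coordEquiv F e u), ?_⟩
  rw [← coordEquiv_mem_iff F e, map_sub]
  convert sub_truncTotal_mem (coordEquiv F e u) n using 2
  have : ((coordEquiv F e : FormalGroupRing F M →ₐ[R] MvPowerSeries σ R)).comp
      (MvPolynomial.aeval (fun i => fgrX F (e i))) =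
      (MvPolynomial.coeToMvPowerSeries.algHom R : MvPolynomial σ R →ₐ[R] MvPowerSeries σ R) := by
    ext1 i
    simp [coordEquiv_basis]
  simpa using DFunLike.congr_fun this (truncTotal n (coordEquiv F e u))

/-- The endomorphism π sets the i-th coordinate to zero. The claim holds for polynomials in the
coordinates by induction, and passes to the limit because the principal ideal is closed. -/
lemma fgrX_basis_dvd_sub {i : σ} {π : M →+ M} (hπ : ∀ j, j ≠ i → π (e j) = e j)
    (hi : π (e i) = 0) (u : FormalGroupRing F M) : fgrX F (e i) ∣ u - fgrMap F π u := by
  have hX0 : fgrX F (0 : M) = 0 :=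
    Ideal.Quotient.eq_zero_iff_mem.2 ((Submodule.mem_iInf _).2 fun n =>
      Ideal.mem_sup_left (Ideal.subset_span (Or.inl rfl)))
  refine dvd_of_forall_exists_sub_mem F e fun n => ?_
  obtain ⟨q, hq⟩ := exists_aeval_sub_mem F e u n
  have h : ∀ q : MvPolynomial σ R, fgrX F (e i) ∣ MvPolynomial.aeval (fun i => fgrX F (e i)) q -
      fgrMap F π (MvPolynomial.aeval (fun i => fgrX F (e i)) q) := fun q => by
    induction q using MvPolynomial.induction_on with
    | C r => rw [MvPolynomial.aeval_C, AlgHom.commutes, sub_self]; exact dvd_zero _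
    | add p q hp hq =>
      rw [map_add, map_add, add_sub_add_comm]; exact dvd_add hp hq
    | mul_X p j hp =>
      have hj : fgrX F (e i) ∣ fgrX F (e j) - fgrMap F π (fgrX F (e j)) := by
        rw [fgrMap_fgrX]
        by_cases hj : j = i
        · subst hj
          rw [hi, hX0, sub_zero]
        · rw [hπ j hj, sub_self]; exact dvd_zero _
      rw [map_mul, map_mul, MvPolynomial.aeval_X]
      have := dvd_add (dvd_mul_of_dvd_left hp (fgrX F (e j)))
        (dvd_mul_of_dvd_right hj (fgrMap F π (MvPolynomial.aeval (fun i => fgrX F (e i)) p)))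
      convert this using 1
      ring
  obtain ⟨v, hv⟩ := h q
  refine ⟨v, ?_⟩
  rw [← hv]
  convert sub_mem hq (fgrMap_mem_pow F π hq) using 1
  rw [map_sub]
  ring

lemma mem_of_fgrX_basis_mul_mem {i : σ} {u : FormalGroupRing F M} {n : ℕ}
    (h : fgrX F (e i) * u ∈ fgrAugIdeal F M ^ (n + 1)) : u ∈ fgrAugIdeal F M ^ n := by
  rw [← coordEquiv_mem_iff F e] at h ⊢
  rw [map_mul, coordEquiv_basis, mem_varIdeal_pow_iff] at h
  rw [mem_varIdeal_pow_iff]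
  intro d hd
  rw [← h (single i 1 + d) (by rw [map_add, degree_single]; omega), X, coeff_add_monomial_mul,
    one_mul]

end Coordinates

/-! ### Coordinate-free consequences for primitive vectors -/

section Free

open MvPowerSeries

variable {R : Type*} [CommRing R] (F : FormalGroup R) [F.IsComm]
  {M : Type*} [AddCommGroup M] [Module.Free ℤ M] [Module.Finite ℤ M]

omit [F.IsComm] [Module.Free ℤ M] [Module.Finite ℤ M] in
lemma fgrX_zero : fgrX F (0 : M) = 0 :=
  Ideal.Quotient.eq_zero_iff_mem.2 ((Submodule.mem_iInf _).2 fun _ =>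
    Ideal.mem_sup_left (Ideal.subset_span (Or.inl rfl)))

omit [F.IsComm] [Module.Free ℤ M] [Module.Finite ℤ M] in
lemma fgrX_add (s t : M) : fgrX F (s + t) = fgrMk F M (evalTwo (fglCoeff F) s t) :=
  Ideal.Quotient.eq.2 ((Submodule.mem_iInf _).2 fun _ =>
    Ideal.mem_sup_left (Ideal.subset_span (Or.inr ⟨(s, t), rfl⟩)))

lemma fgrMk_mem_pow {n : ℕ} {y : CompletedPoly R M}
    (hy : AdicCompletion.evalₐ (polyAugIdeal R M) n y = 0) :
    fgrMk F M y ∈ fgrAugIdeal F M ^ n := by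
  rw [← coordEquiv_mem_iff F (Module.Free.chooseBasis ℤ M), coordEquiv_mk]
  exact coordCompleted_mem_of_evalₐ_eq_zero F _ hy

lemma fgrX_add_sub_mem (s t : M) :
    fgrX F (s + t) - (fgrX F s + fgrX F t) ∈ fgrAugIdeal F M ^ 2 := by
  rw [fgrX_add, fgrX, fgrX, ← map_add, ← map_sub]
  refine fgrMk_mem_pow F ?_
  have h00 : fglCoeff F 0 0 = 0 := by simpa [fglCoeff] using F.zero_constantCoeff
  have h10 : fglCoeff F 1 0 = 1 := by simpa [fglCoeff] using F.lin_coeff_X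
  have h01 : fglCoeff F 0 1 = 1 := by simpa [fglCoeff] using F.lin_coeff_Y
  rw [map_sub, map_add, evalₐ_evalTwo, completedX, completedX, AdicCompletion.evalₐ_of,
    AdicCompletion.evalₐ_of]
  have : Finset.HasAntidiagonal.antidiagonal 1 = ({(0, 1), (1, 0)} : Finset (ℕ × ℕ)) := rfl
  simp [Finset.sum_range_succ, homogPart, h00, h10, h01, this, add_comm]

lemma mem_nonZeroDivisors_of_fgrAug {u : FormalGroupRing F M} (hu : fgrAug F M u ∈ R⁰) :
    u ∈ (FormalGroupRing F M)⁰ := by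
  rw [← constantCoeff_coordEquiv F (Module.Free.chooseBasis ℤ M)] at hu
  exact mem_nonZeroDivisors_of_algEquiv (coordEquiv F (Module.Free.chooseBasis ℤ M))
    (MvPowerSeries.mem_nonZeroDivisors_of_constantCoeff hu)

/-- The endomorphism of `M` with image `ker f` that kills `β`. -/
def projAlong (β : M) (f : M →ₗ[ℤ] ℤ) : M →+ M := reflectionHom β f

omit [Module.Free ℤ M] [Module.Finite ℤ M] in
lemma projAlong_apply (β : M) (f : M →ₗ[ℤ] ℤ) (lam : M) :
    projAlong β f lam = lam - f lam • β := by simp [projAlong, reflectionHom]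

/-- A linear form with value 1 at β witnesses that β is primitive: it splits M as ker f ⊕ ℤβ. -/
lemma exists_basis_of_apply_eq_one {β : M} {f : M →ₗ[ℤ] ℤ} (hf : f β = 1) :
    ∃ (σ : Type) (_ : Finite σ) (e : Module.Basis σ ℤ M) (i : σ), e i = β ∧
      ∀ j, j ≠ i → f (e j) = 0 := by
  let E : (LinearMap.ker f × ℤ) ≃ₗ[ℤ] M :=
    { toFun := fun p => p.1 + p.2 • β
      map_add' := fun p q => by simp [add_smul]; abel
      map_smul' := fun c p => by simp [mul_smul]
      invFun := fun lam => (⟨lam - f lam • β, by simp [hf]⟩, f lam)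
      left_inv := fun p => by
        have := p.1.2
        rw [LinearMap.mem_ker] at this
        ext <;> simp [hf, this]
      right_inv := fun lam => by simp }
  let e0 := Module.finBasis ℤ (LinearMap.ker f)
  let e := (e0.prod (Module.Basis.singleton Unit ℤ)).map E
  refine ⟨_, inferInstance, e, Sum.inr (), by simp [e, E], ?_⟩
  rintro (j | j) hj
  · have := (e0 j).2
    rw [LinearMap.mem_ker] at this
    simp [e, E, this]
  · exact absurd rfl hj

variable {β : M} {f : M →ₗ[ℤ] ℤ} (hf : f β = 1)
include hf

lemma fgrX_mem_nonZeroDivisors : fgrX F β ∈ (FormalGroupRing F M)⁰ := by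
  obtain ⟨σ, _, e, i, rfl, -⟩ := exists_basis_of_apply_eq_one hf
  exact fgrX_basis_mem_nonZeroDivisors F e i

lemma fgrX_dvd_sub_fgrMap (u : FormalGroupRing F M) :
    fgrX F β ∣ u - fgrMap F (projAlong β f) u := by
  obtain ⟨σ, _, e, i, rfl, he⟩ := exists_basis_of_apply_eq_one hf
  refine fgrX_basis_dvd_sub F e (fun j hj => ?_) ?_ u
  · rw [projAlong_apply, he j hj, zero_smul, sub_zero]
  · rw [projAlong_apply, hf, one_smul, sub_self]

lemma mem_of_fgrX_mul_mem {u : FormalGroupRing F M} {n : ℕ}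
    (h : fgrX F β * u ∈ fgrAugIdeal F M ^ (n + 1)) : u ∈ fgrAugIdeal F M ^ n := by
  obtain ⟨σ, _, e, i, rfl, -⟩ := exists_basis_of_apply_eq_one hf
  exact mem_of_fgrX_basis_mul_mem F e h

/-- An element whose augmentation is regular is regular modulo a primitive `x_β`. -/
lemma fgrX_dvd_of_dvd_mul {d u : FormalGroupRing F M} (hd : fgrAug F M d ∈ R⁰)
    (h : fgrX F β ∣ d * u) : fgrX F β ∣ u := by
  obtain ⟨v, hv⟩ := h
  have h1 := congrArg (fgrMap F (projAlong β f)) hv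
  -- The projection along β kills x_β and preserves augmentations, so the image of d is still
  -- regular and the image of u must vanish.
  rw [map_mul, map_mul, fgrMap_fgrX, projAlong_apply, hf, one_smul, sub_self, fgrX_zero,
    zero_mul] at h1
  have h2 := mem_nonZeroDivisors_iff.1 (mem_nonZeroDivisors_of_fgrAug F
    (u := fgrMap F (projAlong β f) d) (by rwa [fgrAug_fgrMap])) |>.1 _ h1
  have h3 := fgrX_dvd_sub_fgrMap F hf u
  rwa [h2, sub_zero] at h3

end Free

end

end FormalDemazure

namespace FormalDemazure

noncomputable section

/-! ### Divided difference operators: existence, Leibniz rule, leading terms -/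

section Demazure

variable {R : Type*} [CommRing R] (F : FormalGroup R) [F.IsComm]
  {M : Type*} [AddCommGroup M] [Module.Free ℤ M] [Module.Finite ℤ M]

lemma fgrX_snd_mem_nonZeroDivisors :
    fgrX F ((0, 1) : M × ℤ) ∈ (FormalGroupRing F (M × ℤ))⁰ :=
  fgrX_mem_nonZeroDivisors F (f := LinearMap.snd ℤ M ℤ) rfl

lemma fgrX_snd_mul_cancel {u v : FormalGroupRing F (M × ℤ)}
    (h : fgrX F ((0, 1) : M × ℤ) * u = fgrX F ((0, 1) : M × ℤ) * v) : u = v := by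
  rw [← sub_eq_zero, ← mul_sub] at h
  exact sub_eq_zero.1 ((mem_nonZeroDivisors_iff.1 (fgrX_snd_mem_nonZeroDivisors F)).1 _ h)

variable (φ : M →ₗ[ℤ] ℤ)

/-- Both maps M → M ⊕ ℤ become equal after the projection (lam, n) ↦ (lam, 0), and y divides the
difference of any element and its projection. -/
lemma exists_generic_quotient (u : FormalGroupRing F M) :
    ∃ v, fgrX F ((0, 1) : M × ℤ) * v =
      fgrMap F (AddMonoidHom.inl M ℤ) u - fgrMap F (genericReflection φ) u := by
  have h1 := fgrX_dvd_sub_fgrMap F (β := ((0, 1) : M × ℤ)) (f := LinearMap.snd ℤ M ℤ) rfl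
    (fgrMap F (AddMonoidHom.inl M ℤ) u)
  have h2 := fgrX_dvd_sub_fgrMap F (β := ((0, 1) : M × ℤ)) (f := LinearMap.snd ℤ M ℤ) rfl
    (fgrMap F (genericReflection φ) u)
  have h3 : (projAlong ((0, 1) : M × ℤ) (LinearMap.snd ℤ M ℤ)).comp (AddMonoidHom.inl M ℤ) =
      (projAlong ((0, 1) : M × ℤ) (LinearMap.snd ℤ M ℤ)).comp (genericReflection φ) := by
    ext m <;> simp [projAlong_apply, genericReflection]
  have h4 := dvd_sub h1 h2
  rw [fgrMap_comp, fgrMap_comp, h3, sub_sub_sub_cancel_right] at h4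
  obtain ⟨v, hv⟩ := h4
  exact ⟨v, hv.symm⟩

/-- The generic divided difference operator. -/
def genericDemazure : FormalGroupRing F M →ₗ[R] FormalGroupRing F (M × ℤ) where
  toFun u := (exists_generic_quotient F φ u).choose
  map_add' u v := fgrX_snd_mul_cancel F (by
    rw [mul_add, (exists_generic_quotient F φ (u + v)).choose_spec,
      (exists_generic_quotient F φ u).choose_spec, (exists_generic_quotient F φ v).choose_spec,
      map_add, map_add]
    ring)
  map_smul' r u := fgrX_snd_mul_cancel F (by
    rw [RingHom.id_apply, mul_smul_comm, (exists_generic_quotient F φ (r • u)).choose_spec,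
      (exists_generic_quotient F φ u).choose_spec, map_smul, map_smul, smul_sub])

lemma fgrX_mul_genericDemazure (u : FormalGroupRing F M) :
    fgrX F ((0, 1) : M × ℤ) * genericDemazure F φ u =
      fgrMap F (AddMonoidHom.inl M ℤ) u - fgrMap F (genericReflection φ) u :=
  (exists_generic_quotient F φ u).choose_spec

variable (α : M)

lemma isDemazure_demazure : IsDemazure F α φ (demazure F α φ) := by
  have h : ∃ D, IsDemazure F α φ D :=
    ⟨(fgrMap F (specialize α)).toLinearMap ∘ₗ genericDemazure F φ, fun u =>
      ⟨genericDemazure F φ u, fgrX_mul_genericDemazure F φ u, rfl⟩⟩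
  rw [demazure, dif_pos h]
  exact h.choose_spec

lemma demazure_apply (u : FormalGroupRing F M) :
    demazure F α φ u = fgrMap F (specialize α) (genericDemazure F φ u) := by
  obtain ⟨v, hv, h⟩ := isDemazure_demazure F φ α u
  rw [h, fgrX_snd_mul_cancel F (hv.trans (fgrX_mul_genericDemazure F φ u).symm)]

lemma fgrX_mul_demazure (u : FormalGroupRing F M) :
    fgrX F α * demazure F α φ u = u - fgrMap F (reflectionHom α φ) u :=
  (isDemazure_demazure F φ α).x_mul u

/-- The twisted Leibniz rule is proved before specialization because y can be cancelled while x_α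
may be a zero divisor. -/
lemma genericDemazure_mul (u v : FormalGroupRing F M) : genericDemazure F φ (u * v) =
    genericDemazure F φ u * fgrMap F (AddMonoidHom.inl M ℤ) v +
      fgrMap F (genericReflection φ) u * genericDemazure F φ v := by
  refine fgrX_snd_mul_cancel F ?_
  rw [fgrX_mul_genericDemazure, mul_add, ← mul_assoc, fgrX_mul_genericDemazure, mul_left_comm,
    fgrX_mul_genericDemazure, map_mul, map_mul]
  ring

lemma demazure_mul (u v : FormalGroupRing F M) : demazure F α φ (u * v) =
    demazure F α φ u * v + fgrMap F (reflectionHom α φ) u * demazure F α φ v := by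
  have h1 : (specialize α).comp (AddMonoidHom.inl M ℤ) = AddMonoidHom.id M := by
    ext m; simp [specialize]
  have h2 : (specialize α).comp (genericReflection φ) = reflectionHom α φ := by
    ext m; simp [specialize, genericReflection, reflectionHom, sub_eq_add_neg]
  rw [demazure_apply, demazure_apply, demazure_apply, genericDemazure_mul, map_add, map_mul,
    map_mul, fgrMap_comp, fgrMap_comp, h1, h2, fgrMap_id]

/-- Division by the coordinate y loses exactly one power of the augmentation ideal, and
specialization loses none. -/
lemma demazure_mem_pow {n : ℕ} {u : FormalGroupRing F M} (hu : u ∈ fgrAugIdeal F M ^ (n + 1)) :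
    demazure F α φ u ∈ fgrAugIdeal F M ^ n := by
  rw [demazure_apply]
  refine fgrMap_mem_pow F _ ?_
  refine mem_of_fgrX_mul_mem F (β := ((0, 1) : M × ℤ)) (f := LinearMap.snd ℤ M ℤ) rfl ?_
  rw [fgrX_mul_genericDemazure]
  exact sub_mem (fgrMap_mem_pow F _ hu) (fgrMap_mem_pow F _ hu)

lemma fgrX_zsmul_sub_mem (n : ℤ) (lam : M) :
    fgrX F (n • lam) - n • fgrX F lam ∈ fgrAugIdeal F M ^ 2 := by
  have hneg : fgrX F (-lam) - -fgrX F lam ∈ fgrAugIdeal F M ^ 2 := by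
    have := fgrX_add_sub_mem F lam (-lam)
    rw [add_neg_cancel, fgrX_zero, zero_sub, neg_mem_iff] at this
    rwa [sub_neg_eq_add, add_comm]
  induction n with
  | zero => simp [fgrX_zero]
  | succ n ih =>
    have := add_mem (fgrX_add_sub_mem F ((n : ℤ) • lam) lam) ih
    rw [add_smul, one_smul, add_smul, one_smul]
    convert this using 1
    abel
  | pred n ih =>
    have := add_mem (add_mem (fgrX_add_sub_mem F ((-n : ℤ) • lam) (-lam)) ih) hneg
    rw [sub_smul, one_smul, sub_smul, one_smul, sub_eq_add_neg (_ • lam)]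
    convert this using 1
    abel

/-- Modulo squares x is additive, so x_{(lam, 0)} - x_{(lam, -φ lam)} is congruent to φ(lam) y; then
y is divided out. -/
lemma demazure_fgrX_sub_mem (lam : M) :
    demazure F α φ (fgrX F lam) - algebraMap R _ (φ lam : R) ∈ fgrAugIdeal F M := by
  have h : genericDemazure F φ (fgrX F lam) - algebraMap R _ (φ lam : R) ∈
      fgrAugIdeal F (M × ℤ) ^ 1 := by
    refine mem_of_fgrX_mul_mem F (β := ((0, 1) : M × ℤ)) (f := LinearMap.snd ℤ M ℤ) rfl ?_
    rw [mul_sub, fgrX_mul_genericDemazure, fgrMap_fgrX, fgrMap_fgrX]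
    have h1 : genericReflection φ lam = ((lam, 0) : M × ℤ) + (-φ lam) • ((0, 1) : M × ℤ) := by
      simp [genericReflection]
    have h2 : AddMonoidHom.inl M ℤ lam = (lam, 0) := rfl
    have h3 := add_mem (fgrX_add_sub_mem F ((lam, 0) : M × ℤ) ((-φ lam) • ((0, 1) : M × ℤ)))
      (fgrX_zsmul_sub_mem F (-φ lam) ((0, 1) : M × ℤ))
    rw [h1, h2, ← neg_mem_iff]
    convert h3 using 1
    rw [map_intCast, zsmul_eq_mul, Int.cast_neg]
    ring
  rw [pow_one] at h
  have := fgrMap_mem_pow F (specialize α) (n := 1) (by rwa [pow_one])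
  rwa [pow_one, map_sub, ← demazure_apply, AlgHom.commutes] at this

variable {M' : Type*} [AddCommGroup M'] [Module.Free ℤ M'] [Module.Finite ℤ M']

/-- Naturality in the lattice, needed to descend relations from M ⊕ Q to M. -/
lemma fgrMap_demazure (g : M' →+ M) {α' : M'} {φ' : M' →ₗ[ℤ] ℤ} (hα : g α' = α)
    (hφ : ∀ lam, φ (g lam) = φ' lam) (u : FormalGroupRing F M') :
    fgrMap F g (demazure F α' φ' u) = demazure F α φ (fgrMap F g u) := by
  let G : M' × ℤ →+ M × ℤ := g.prodMap (AddMonoidHom.id ℤ)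
  have h : fgrMap F G (genericDemazure F φ' u) = genericDemazure F φ (fgrMap F g u) := by
    refine fgrX_snd_mul_cancel F ?_
    have h1 : G (0, 1) = (0, 1) := by simp [G]
    have h2 : G.comp (AddMonoidHom.inl M' ℤ) = (AddMonoidHom.inl M ℤ).comp g := by
      ext m <;> simp [G]
    have h3 : G.comp (genericReflection φ') = (genericReflection φ).comp g := by
      ext m <;> simp [G, genericReflection, hφ]
    have h4 := congrArg (fgrMap F G) (fgrX_mul_genericDemazure F φ' u)
    rw [map_mul, fgrMap_fgrX, h1, map_sub, fgrMap_comp, fgrMap_comp, h2, h3] at h4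
    rw [h4, fgrX_mul_genericDemazure, fgrMap_comp, fgrMap_comp]
  have h5 : g.comp (specialize α') = (specialize α).comp G := by
    ext m <;> simp [G, specialize, hα]
  rw [demazure_apply, demazure_apply, ← h, fgrMap_comp, fgrMap_comp, h5]

end Demazure

end

end FormalDemazure

namespace FormalDemazure

noncomputable section

/-! ### The Weyl group: inversions, reduced words -/

section WeylAction

open RootPairing

variable {ι M N : Type*} [AddCommGroup M] [AddCommGroup N] {P : RootPairing ι ℤ M N}

lemma root_smul (w : P.weylGroup) (i : ι) : P.root (w • i) = w • P.root i :=
  RootPairing.Equiv.root_indexEquiv_eq_smul P i w.1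

lemma ofIdx_smul_idx (i j : ι) : weylGroup.ofIdx P i • j = P.reflectionPerm i j := rfl

lemma ofIdx_smul' (i : ι) (x : M) : weylGroup.ofIdx P i • x = P.reflection i x := rfl

lemma ofIdx_mul_self (i : ι) : weylGroup.ofIdx P i * weylGroup.ofIdx P i = 1 := by
  have h := RootPairing.Equiv.reflection_inv P i
  refine Subtype.ext ?_
  change RootPairing.Equiv.reflection P i * RootPairing.Equiv.reflection P i = 1
  rw [mul_eq_one_iff_inv_eq, h]

lemma ofIdx_inv (i : ι) : (weylGroup.ofIdx P i)⁻¹ = weylGroup.ofIdx P i :=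
  inv_eq_of_mul_eq_one_left (ofIdx_mul_self i)

lemma weylGroup_ext {v w : P.weylGroup} (h : ∀ x : M, v • x = w • x) : v = w :=
  Subtype.ext (RootPairing.Equiv.weightHom_injective P (LinearEquiv.ext h))

lemma weylGroup_induction {p : P.weylGroup → Prop} (one : p 1)
    (mul : ∀ i w, p w → p (weylGroup.ofIdx P i * w)) (w : P.weylGroup) : p w := by
  have key : ∀ (g : P.Aut) (hg : g ∈ P.weylGroup), ∀ v, p v → p (⟨g, hg⟩ * v) := by
    intro g hg
    induction hg using weylGroup.induction with
    | mem i => exact mul i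
    | one => intro v hv; exact (one_mul v).symm ▸ hv
    | mul x y hx hy ihx ihy =>
      intro v hv
      have := ihx _ (ihy v hv)
      rwa [← mul_assoc] at this
  have := key w.1 w.2 1 one
  rwa [mul_one] at this

lemma smul_zsmul_weyl (w : P.weylGroup) (n : ℤ) (x : M) : w • (n • x) = n • (w • x) :=
  smul_comm w.1 n x

lemma coroot'_smul (w : P.weylGroup) (i : ι) (x : M) :
    P.coroot' (w • i) (w • x) = P.coroot' i x := by
  induction w using weylGroup_induction generalizing i x with
  | one => simp
  | mul j v ih =>
    rw [mul_smul, mul_smul, ← ih i x, ofIdx_smul_idx, ofIdx_smul', coroot'_reflection,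
      ← ofIdx_smul_idx, ← ofIdx_smul_idx, ← mul_smul, ofIdx_mul_self, one_smul]

lemma ofIdx_smul_eq (i : ι) (x : M) :
    weylGroup.ofIdx P i • x = x - P.coroot' i x • P.root i := P.reflection_apply i x

lemma ofIdx_smul_conj (w : P.weylGroup) (i : ι) :
    weylGroup.ofIdx P (w • i) = w * weylGroup.ofIdx P i * w⁻¹ := by
  refine weylGroup_ext fun x => ?_
  have hx : x = w • (w⁻¹ • x) := by rw [smul_inv_smul]
  rw [mul_smul, mul_smul, ofIdx_smul_eq, ofIdx_smul_eq, smul_sub, smul_inv_smul,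
    smul_zsmul_weyl, root_smul]
  conv_lhs => rw [hx, coroot'_smul, ← hx]

/-- The index of the opposite root. -/
def negIdx (P : RootPairing ι ℤ M N) (i : ι) : ι := P.reflectionPerm i i

lemma root_negIdx (i : ι) : P.root (negIdx P i) = - P.root i := by simp [negIdx]

lemma smul_negIdx (w : P.weylGroup) (i : ι) : w • negIdx P i = negIdx P (w • i) :=
  P.root.injective (by rw [root_smul, root_negIdx, root_negIdx, root_smul, smul_neg])

lemma coroot'_negIdx (i : ι) (x : M) : P.coroot' (negIdx P i) x = - P.coroot' i x := by
  have h : weylGroup.ofIdx P i • x = x - P.coroot' i x • P.root i := ofIdx_smul_eq i x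
  have h2 := coroot'_smul (weylGroup.ofIdx P i) i (weylGroup.ofIdx P i • x)
  rw [← mul_smul, ofIdx_mul_self, one_smul, h, map_sub, map_smul] at h2
  change P.coroot' (P.reflectionPerm i i) x = _
  rw [← ofIdx_smul_idx, h2]
  simp only [root_coroot'_eq_pairing, pairing_same, smul_eq_mul]
  ring

lemma ofIdx_smul_self (i : ι) : weylGroup.ofIdx P i • i = negIdx P i := rfl

lemma ofIdx_negIdx (i : ι) : weylGroup.ofIdx P (negIdx P i) = weylGroup.ofIdx P i := by
  rw [← ofIdx_smul_self, ofIdx_smul_conj, ofIdx_inv, ofIdx_mul_self, one_mul]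

end WeylAction

section Words

open RootPairing

variable {ι M N : Type*} [AddCommGroup M] [AddCommGroup N]
  {P : RootPairing ι ℤ M N} (b : P.Base)

lemma wordProd_nil : wordProd b [] = 1 := rfl

lemma wordProd_cons (i : b.support) (I : List b.support) :
    wordProd b (i :: I) = weylGroup.ofIdx P i * wordProd b I := by simp [wordProd]

lemma wordProd_append (I K : List b.support) :
    wordProd b (I ++ K) = wordProd b I * wordProd b K := by simp [wordProd]

lemma wordProd_reverse (I : List b.support) : wordProd b I.reverse = (wordProd b I)⁻¹ := by
  induction I with
  | nil => simp [wordProd_nil]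
  | cons i I ih =>
    rw [List.reverse_cons, wordProd_append, ih, wordProd_cons, wordProd_cons, wordProd_nil,
      mul_one, mul_inv_rev, ofIdx_inv]

lemma weylLength_wordProd_le (I : List b.support) : weylLength b (wordProd b I) ≤ I.length :=
  Nat.sInf_le ⟨I, rfl, rfl⟩

variable {b} in
lemma isPos_negIdx {i : ι} : b.IsPos (negIdx P i) ↔ ¬ b.IsPos i := Base.IsPos.neg_iff_not b i

/-- The words obtained from `I` by deleting one letter, each with the index of the root `γ` such
that the product of the shortened word is that of `I` times `s_γ`. -/
def deletions : List b.support → List (ι × List b.support)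
  | [] => []
  | i :: I => ((wordProd b I)⁻¹ • (i : ι), I) :: (deletions I).map fun p => (p.1, i :: p.2)

lemma length_deletions (I : List b.support) : (deletions b I).length = I.length := by
  induction I with
  | nil => rfl
  | cons i I ih => simp [deletions, ih]

lemma length_of_mem_deletions {I : List b.support} {p : ι × List b.support}
    (hp : p ∈ deletions b I) : p.2.length + 1 = I.length := by
  induction I generalizing p with
  | nil => simp [deletions] at hp
  | cons i I ih =>
    rw [deletions, List.mem_cons, List.mem_map] at hp
    rcases hp with rfl | ⟨q, hq, rfl⟩
    · simp
    · simp [ih hq]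

lemma wordProd_of_mem_deletions {I : List b.support} {p : ι × List b.support}
    (hp : p ∈ deletions b I) : wordProd b p.2 = wordProd b I * weylGroup.ofIdx P p.1 := by
  induction I generalizing p with
  | nil => simp [deletions] at hp
  | cons i I ih =>
    rw [deletions, List.mem_cons, List.mem_map] at hp
    rcases hp with rfl | ⟨q, hq, rfl⟩
    · rw [wordProd_cons, ofIdx_smul_conj]
      have := ofIdx_mul_self (P := P) (i : ι)
      rw [inv_inv, mul_assoc, mul_assoc, mul_inv_cancel_left, ← mul_assoc, this, one_mul]
    · rw [wordProd_cons, ih hq, wordProd_cons, mul_assoc]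

variable [Finite ι] [P.IsReduced]

variable {b} in
lemma isPos_ofIdx_smul {i : b.support} {j : ι} (hj : b.IsPos j) (hij : j ≠ i) :
    b.IsPos (weylGroup.ofIdx P (i : ι) • j) :=
  Base.IsPos.reflectionPerm hj i.2 hij

/-- The set of inversions of `w`: the positive roots `γ` with `w γ` negative. -/
def inversions (w : P.weylGroup) : Finset ι :=
  (Set.toFinite {j : ι | b.IsPos j ∧ ¬ b.IsPos (w • j)}).toFinset

omit [P.IsReduced] in
lemma mem_inversions {w : P.weylGroup} {j : ι} :
    j ∈ inversions b w ↔ b.IsPos j ∧ ¬ b.IsPos (w • j) := by simp [inversions]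

/-- The simple reflection s_i permutes the positive roots other than α_i, so a new inversion j must
satisfy v j = α_i. -/
lemma eq_inv_smul_of_mem_inversions {i : b.support} {v : P.weylGroup} {j : ι}
    (hj : j ∈ inversions b (weylGroup.ofIdx P (i : ι) * v)) (hv : j ∉ inversions b v) :
    j = v⁻¹ • (i : ι) := by
  rw [mem_inversions] at hj hv
  rw [mul_smul] at hj
  by_contra hne
  refine hj.2 (isPos_ofIdx_smul (by by_contra h; exact hv ⟨hj.1, h⟩) fun h => hne ?_)
  rw [← h, inv_smul_smul]

lemma exists_mem_deletions {I : List b.support} {j : ι}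
    (hj : j ∈ inversions b (wordProd b I)) : ∃ K, (j, K) ∈ deletions b I := by
  induction I with
  | nil => rw [mem_inversions, wordProd_nil, one_smul] at hj; exact (hj.2 hj.1).elim
  | cons i I ih =>
    by_cases hI : j ∈ inversions b (wordProd b I)
    · obtain ⟨K, hK⟩ := ih hI
      exact ⟨i :: K, List.mem_cons_of_mem _ (List.mem_map.2 ⟨_, hK, rfl⟩)⟩
    · rw [wordProd_cons] at hj
      rw [eq_inv_smul_of_mem_inversions b hj hI]
      exact ⟨I, List.mem_cons_self⟩

lemma inversions_subset [DecidableEq ι] (I : List b.support) :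
    inversions b (wordProd b I) ⊆ ((deletions b I).map Prod.fst).toFinset := by
  intro j hj
  obtain ⟨K, hK⟩ := exists_mem_deletions b hj
  exact List.mem_toFinset.2 (List.mem_map.2 ⟨_, hK, rfl⟩)

lemma card_inversions_le (I : List b.support) :
    (inversions b (wordProd b I)).card ≤ I.length := by
  classical
  refine (Finset.card_le_card (inversions_subset b I)).trans
    ((List.toFinset_card_le _).trans ?_)
  rw [List.length_map, length_deletions]

lemma inversions_cons (i : b.support) (v : P.weylGroup) (h : b.IsPos (v⁻¹ • (i : ι))) :
    (inversions b (weylGroup.ofIdx P (i : ι) * v)).card = (inversions b v).card + 1 := by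
  classical
  have hn : v⁻¹ • (i : ι) ∉ inversions b v := by
    rw [mem_inversions, smul_inv_smul]
    exact fun h => h.2 (Base.isPos_of_mem_support i.2)
  rw [← Finset.card_insert_of_notMem hn]
  congr 1
  ext j
  rw [Finset.mem_insert]
  refine ⟨fun hj => ?_, ?_⟩
  · by_cases hv : j ∈ inversions b v
    · exact Or.inr hv
    · exact Or.inl (eq_inv_smul_of_mem_inversions b hj hv)
  · rintro (rfl | hj)
    · rw [mem_inversions, mul_smul, smul_inv_smul, ofIdx_smul_self, isPos_negIdx, not_not]
      exact ⟨h, Base.isPos_of_mem_support i.2⟩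
    · rw [mem_inversions] at hj ⊢
      refine ⟨hj.1, fun h2 => ?_⟩
      rw [mul_smul] at h2
      by_cases hji : weylGroup.ofIdx P (i : ι) • v • j = (i : ι)
      · have h3 : v • j = negIdx P i := by
          rw [← ofIdx_smul_self, ← smul_left_cancel_iff (weylGroup.ofIdx P (i : ι)), hji,
            ← mul_smul, ofIdx_mul_self, one_smul]
        have h4 : j = negIdx P (v⁻¹ • (i : ι)) := by
          rw [← smul_negIdx, ← h3, inv_smul_smul]
        rw [h4, isPos_negIdx] at hj
        exact hj.1 h
      · have := isPos_ofIdx_smul h2 hji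
        rw [← mul_smul, ofIdx_mul_self, one_smul] at this
        exact hj.2 this

lemma exists_wordProd (w : P.weylGroup) : ∃ I, wordProd b I = w := by
  have key : ∀ j : ι, ∃ I, wordProd b I = weylGroup.ofIdx P j := by
    intro j
    induction j using b.induction_reflect with
    | h₀ j ih => rw [← negIdx, ofIdx_negIdx]; exact ih
    | h₁ j hj => exact ⟨[⟨j, hj⟩], by simp [wordProd]⟩
    | h₂ j k ih hk =>
      obtain ⟨I, hI⟩ := ih
      refine ⟨⟨k, hk⟩ :: (I ++ [⟨k, hk⟩]), ?_⟩
      rw [← ofIdx_smul_idx, ofIdx_smul_conj, ofIdx_inv, wordProd_cons, wordProd_append, hI,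
        wordProd_cons, wordProd_nil, mul_one, mul_assoc]
  induction w using weylGroup_induction with
  | one => exact ⟨[], rfl⟩
  | mul j v ih =>
    obtain ⟨I, hI⟩ := key j
    obtain ⟨K, hK⟩ := ih
    exact ⟨I ++ K, by rw [wordProd_append, hI, hK]⟩

lemma exists_isReducedDecomp (w : P.weylGroup) : ∃ I, IsReducedDecomp b I w :=
  Nat.sInf_mem (s := {n | ∃ I : List b.support, wordProd b I = w ∧ I.length = n})
    (by obtain ⟨I, hI⟩ := exists_wordProd b w; exact ⟨_, I, hI, rfl⟩)

/-- Write w = s_i v. If v⁻¹ α_i were negative, its opposite would be an inversion of v, hence the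
root of a deletion in the word of v; the shortened word has product s_i v = w and is two letters
shorter than the given reduced word. -/
lemma IsReducedDecomp.length_eq_card {I : List b.support} {w : P.weylGroup}
    (h : IsReducedDecomp b I w) : I.length = (inversions b w).card := by
  induction I generalizing w with
  | nil =>
    have := card_inversions_le b ([] : List b.support)
    rw [h.1] at this
    simp only [List.length_nil] at this ⊢
    omega
  | cons i I ih =>
    have hI : IsReducedDecomp b I (wordProd b I) := by
      refine ⟨rfl, le_antisymm ?_ (weylLength_wordProd_le b I)⟩
      obtain ⟨K, hK, hl⟩ := exists_isReducedDecomp b (wordProd b I)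
      have h2 := weylLength_wordProd_le b (i :: K)
      rw [wordProd_cons, hK, ← wordProd_cons, h.1, ← h.2, List.length_cons, List.length_cons] at h2
      omega
    by_cases hp : b.IsPos ((wordProd b I)⁻¹ • (i : ι))
    · rw [← h.1, wordProd_cons, inversions_cons b i _ hp, ← ih hI, List.length_cons]
    · exfalso
      have hmem : negIdx P ((wordProd b I)⁻¹ • (i : ι)) ∈ inversions b (wordProd b I) := by
        rw [mem_inversions, isPos_negIdx, smul_negIdx, smul_inv_smul, isPos_negIdx, not_not]
        exact ⟨hp, Base.isPos_of_mem_support i.2⟩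
      obtain ⟨K, hK⟩ := exists_mem_deletions b hmem
      have h1 := length_of_mem_deletions b hK
      have h2 := wordProd_of_mem_deletions b hK
      simp only [ofIdx_negIdx, ofIdx_smul_conj, inv_inv] at h2
      rw [mul_assoc, mul_inv_cancel_left, ← wordProd_cons, h.1] at h2
      have h3 := weylLength_wordProd_le b K
      rw [h2, ← h.2, List.length_cons] at h3
      simp only at h1
      omega

lemma weylLength_eq_card (w : P.weylGroup) : weylLength b w = (inversions b w).card := by
  obtain ⟨I, hI⟩ := exists_isReducedDecomp b w
  rw [← hI.2, hI.length_eq_card b]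

/-- A word is reduced if it is as short as possible. -/
def IsReducedWord (I : List b.support) : Prop := I.length = weylLength b (wordProd b I)

variable {b}

omit [Finite ι] [P.IsReduced] in
lemma IsReducedDecomp.isReducedWord {I : List b.support} {w : P.weylGroup}
    (h : IsReducedDecomp b I w) : IsReducedWord b I := by rw [IsReducedWord, h.1, h.2]

/-- The inversions are among the deletion roots and are as many as the letters, so no root repeats.
A sum over the deletions of a reduced word thus becomes a sum over the inversions of its product. -/
lemma IsReducedWord.nodup_deletions {I : List b.support} (h : IsReducedWord b I) :
    ((deletions b I).map Prod.fst).Nodup := by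
  classical
  rw [← Multiset.coe_nodup, ← Multiset.toFinset_card_eq_card_iff_nodup]
  refine le_antisymm (Multiset.toFinset_card_le _) ?_
  have := Finset.card_le_card (inversions_subset b I)
  rw [← weylLength_eq_card, ← h] at this
  simpa [length_deletions] using this

lemma IsReducedWord.toFinset_deletions [DecidableEq ι] {I : List b.support}
    (h : IsReducedWord b I) :
    ((deletions b I).map Prod.fst).toFinset = inversions b (wordProd b I) := by
  refine (Finset.eq_of_subset_of_card_le (inversions_subset b I) ?_).symm
  rw [← weylLength_eq_card, ← h]
  refine (List.toFinset_card_le _).trans ?_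
  rw [List.length_map, length_deletions]

lemma weylLength_ofIdx_mul (i : b.support) (v : P.weylGroup) :
    weylLength b (weylGroup.ofIdx P (i : ι) * v) = weylLength b v + 1 ∨
      weylLength b (weylGroup.ofIdx P (i : ι) * v) + 1 = weylLength b v := by
  by_cases h : b.IsPos (v⁻¹ • (i : ι))
  · left; rw [weylLength_eq_card, weylLength_eq_card, inversions_cons b i v h]
  · right
    rw [weylLength_eq_card, weylLength_eq_card, ← inversions_cons b i _ ?_, ← mul_assoc,
      ofIdx_mul_self, one_mul]
    rwa [mul_inv_rev, ofIdx_inv, mul_smul, ofIdx_smul_self, smul_negIdx, isPos_negIdx]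

omit [Finite ι] [P.IsReduced] in
lemma weylLength_one : weylLength b (1 : P.weylGroup) = 0 :=
  Nat.le_zero.1 (weylLength_wordProd_le b [])

lemma eq_one_of_weylLength_eq_zero {w : P.weylGroup} (h : weylLength b w = 0) : w = 1 := by
  obtain ⟨I, hI, hl⟩ := exists_isReducedDecomp b w
  rw [h, List.length_eq_zero_iff] at hl
  rw [← hI, hl, wordProd_nil]

lemma weylLength_mul_le (v w : P.weylGroup) :
    weylLength b (v * w) ≤ weylLength b v + weylLength b w := by
  obtain ⟨I, hI, hl⟩ := exists_isReducedDecomp b v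
  obtain ⟨K, hK, hk⟩ := exists_isReducedDecomp b w
  rw [← hl, ← hk, ← List.length_append, ← hI, ← hK, ← wordProd_append]
  exact weylLength_wordProd_le b _

lemma weylLength_inv (w : P.weylGroup) : weylLength b w⁻¹ = weylLength b w := by
  have key : ∀ w : P.weylGroup, weylLength b w⁻¹ ≤ weylLength b w := fun w => by
    obtain ⟨I, hI, hl⟩ := exists_isReducedDecomp b w
    rw [← hl, ← I.length_reverse, ← hI, ← wordProd_reverse]
    exact weylLength_wordProd_le b _
  refine le_antisymm (key w) ?_
  simpa using key w⁻¹

/-- If w₀ α_i were positive for a simple root α_i, then s_i w₀⁻¹ would be longer than w₀; the other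
positive roots follow by adding simple roots. -/
lemma IsLongest.not_isPos {w₀ : P.weylGroup} (h : IsLongest b w₀) {j : ι} (hj : b.IsPos j) :
    ¬ b.IsPos (w₀ • j) := by
  refine Base.IsPos.induction_on_add (p := fun j => ¬ b.IsPos (w₀ • j)) hj (fun i hi => ?_)
    fun i j k hk hi hj => ?_
  · intro hp
    have h1 := inversions_cons b ⟨i, hi⟩ w₀⁻¹ (by rwa [inv_inv])
    rw [← weylLength_eq_card, ← weylLength_eq_card, weylLength_inv] at h1
    have := h (weylGroup.ofIdx P i * w₀⁻¹)
    simp only at h1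
    omega
  · have hj' : ¬ b.IsPos (w₀ • j) := by
      intro hp
      have h1 := inversions_cons b ⟨j, hj⟩ w₀⁻¹ (by rwa [inv_inv])
      rw [← weylLength_eq_card, ← weylLength_eq_card, weylLength_inv] at h1
      have := h (weylGroup.ofIdx P j * w₀⁻¹)
      simp only at h1
      omega
    rw [← isPos_negIdx] at hi hj' ⊢
    refine Base.IsPos.add hi hj' ?_
    rw [root_negIdx, root_negIdx, root_negIdx, root_smul, root_smul, root_smul, hk, smul_add,
      neg_add]

/-- Since w₀ makes every positive root negative, the positive roots split according to the sign of
their image under w⁻¹ into the inversions of w₀ w⁻¹ and those of w⁻¹. -/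
lemma IsLongest.weylLength_mul_inv {w₀ : P.weylGroup} (h : IsLongest b w₀) (w : P.weylGroup) :
    weylLength b (w₀ * w⁻¹) + weylLength b w = weylLength b w₀ := by
  classical
  rw [← weylLength_inv w, weylLength_eq_card, weylLength_eq_card, weylLength_eq_card,
    ← Finset.card_union_of_disjoint]
  · congr 1
    ext j
    simp only [Finset.mem_union, mem_inversions, mul_smul]
    refine ⟨fun hj => ?_, fun hj => ?_⟩
    · rcases hj with hj | hj <;> exact ⟨hj.1, h.not_isPos hj.1⟩
    · by_cases hp : b.IsPos (w⁻¹ • j)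
      · exact Or.inl ⟨hj.1, h.not_isPos hp⟩
      · exact Or.inr ⟨hj.1, hp⟩
  · rw [Finset.disjoint_left]
    intro j hj hj2
    rw [mem_inversions] at hj hj2
    rw [mul_smul] at hj
    rw [← isPos_negIdx] at hj2
    have := h.not_isPos hj2.2
    rw [smul_negIdx, isPos_negIdx, not_not] at this
    exact hj.2 this

lemma IsLongest.eq_of_weylLength_eq {w₀ : P.weylGroup} (h : IsLongest b w₀) {w : P.weylGroup}
    (hw : weylLength b w = weylLength b w₀) : w = w₀ := by
  have := h.weylLength_mul_inv w
  exact (mul_inv_eq_one.1 (eq_one_of_weylLength_eq_zero (b := b) (by omega))).symm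

end Words

end

end FormalDemazure

namespace FormalDemazure

noncomputable section

/-! ### Operators and the filtration by powers of the augmentation ideal -/

section OperatorOrder

variable {R : Type*} [CommRing R] (F : FormalGroup R) {M : Type*} [AddCommGroup M]

variable (M) in
/-- The operators `D` with `D (I ^ m) ⊆ I ^ (m - k)` for all `m`, where `I` is the augmentation
ideal. -/
def opOrder (k : ℤ) : Submodule R (Module.End R (FormalGroupRing F M)) where
  carrier := {D | ∀ m n : ℕ, (n : ℤ) ≤ m - k → ∀ u ∈ fgrAugIdeal F M ^ m, D u ∈ fgrAugIdeal F M ^ n}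
  add_mem' := fun h₁ h₂ m n h u hu => add_mem (h₁ m n h u hu) (h₂ m n h u hu)
  zero_mem' := fun _ n _ _ _ => zero_mem (fgrAugIdeal F M ^ n)
  smul_mem' := fun c D hD m n h u hu => by
    rw [LinearMap.smul_apply, Algebra.smul_def]
    exact Ideal.mul_mem_left _ _ (hD m n h u hu)

lemma opOrder_mono {j k : ℤ} (h : j ≤ k) : opOrder F M j ≤ opOrder F M k :=
  fun _ hD m n hn => hD m n (by omega)

variable {F}

lemma mul_mem_opOrder {j k : ℤ} {D E : Module.End R (FormalGroupRing F M)}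
    (hD : D ∈ opOrder F M j) (hE : E ∈ opOrder F M k) : D * E ∈ opOrder F M (j + k) :=
  fun m n hn u hu => by
    refine hD (m - k).toNat n (by omega) _ ?_
    by_cases h : 0 ≤ (m : ℤ) - k
    · exact hE m _ (by omega) u hu
    · rw [Int.toNat_of_nonpos (by omega), pow_zero, Ideal.one_eq_top]
      trivial

lemma mul_mem_opOrder_of_le {j k l : ℤ} {D E : Module.End R (FormalGroupRing F M)}
    (hD : D ∈ opOrder F M j) (hE : E ∈ opOrder F M k) (h : j + k ≤ l) : D * E ∈ opOrder F M l :=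
  opOrder_mono F h (mul_mem_opOrder hD hE)

lemma lmul_mem_opOrder {d : ℕ} {u : FormalGroupRing F M} (hu : u ∈ fgrAugIdeal F M ^ d) :
    Algebra.lmul R (FormalGroupRing F M) u ∈ opOrder F M (-d) := by
  intro m n hn v hv
  have h : u * v ∈ fgrAugIdeal F M ^ (d + m) := by
    rw [pow_add]; exact Ideal.mul_mem_mul hu hv
  exact Ideal.pow_le_pow_right (by omega) h

lemma lmul_mem_opOrder_zero (u : FormalGroupRing F M) :
    Algebra.lmul R (FormalGroupRing F M) u ∈ opOrder F M 0 :=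
  lmul_mem_opOrder (d := 0) (by rw [pow_zero, Ideal.one_eq_top]; trivial)

lemma smul_mem_opOrder {k : ℤ} (u : FormalGroupRing F M)
    {D : Module.End R (FormalGroupRing F M)} (hD : D ∈ opOrder F M k) : u • D ∈ opOrder F M k :=
  fun m n hn v hv => Ideal.mul_mem_left _ u (hD m n hn v hv)

lemma one_mem_opOrder : (1 : Module.End R (FormalGroupRing F M)) ∈ opOrder F M 0 :=
  fun _ _ hn _ hu => Ideal.pow_le_pow_right (by omega) hu

lemma smul_eq_lmul_mul (u : FormalGroupRing F M) (D : Module.End R (FormalGroupRing F M)) :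
    u • D = Algebra.lmul R (FormalGroupRing F M) u * D := rfl

lemma lmul_intCast (n : ℤ) :
    Algebra.lmul R (FormalGroupRing F M) (algebraMap R _ (n : R)) =
      n • (1 : Module.End R (FormalGroupRing F M)) := by
  rw [AlgHom.commutes, map_intCast, zsmul_one]

end OperatorOrder

/-! ### Leading terms of words in divided differences -/

section Demazure

variable {R : Type*} [CommRing R] (F : FormalGroup R) [F.IsComm] {M : Type*} [AddCommGroup M]
  [Module.Free ℤ M] [Module.Finite ℤ M]

/-- No bound on the order of E is assumed. Induction on m: the power I^(m+1) is generated by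
products x_lam v with v in I^m, and E(x_lam v) is the twisted commutator applied to v plus x_{σ lam}
E v. Both lie in I^(m+1-(k-1)). For m = 0 the exponent is not positive because k ≥ 1. -/
lemma mem_opOrder_of_twisted (σ : M → M) {k : ℤ} (hk : 1 ≤ k)
    {E : Module.End R (FormalGroupRing F M)}
    (hE : ∀ lam : M, E * Algebra.lmul R _ (fgrX F lam) - Algebra.lmul R _ (fgrX F (σ lam)) * E ∈
      opOrder F M (k - 2)) : E ∈ opOrder F M (k - 1) := by
  suffices h : ∀ m : ℕ, ∀ u ∈ fgrAugIdeal F M ^ m, E u ∈ fgrAugIdeal F M ^ ((m : ℤ) - (k - 1)).toNat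
    from fun m n hn u hu => Ideal.pow_le_pow_right (by omega) (h m u hu)
  intro m
  induction m with
  | zero =>
    intro u _
    have : ((0 : ℕ) - (k - 1)).toNat = 0 := by omega
    rw [this, pow_zero, Ideal.one_eq_top]
    trivial
  | succ m ih =>
    intro u hu
    have key : ∀ (lam : M), ∀ v ∈ fgrAugIdeal F M ^ m,
        E (fgrX F lam * v) ∈ fgrAugIdeal F M ^ (((m + 1 : ℕ) : ℤ) - (k - 1)).toNat := by
      intro lam v hv
      have h1 := hE lam m (((m + 1 : ℕ) : ℤ) - (k - 1)).toNat
      by_cases hmk : ((m + 1 : ℕ) : ℤ) - (k - 1) ≤ 0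
      · rw [Int.toNat_of_nonpos hmk, pow_zero, Ideal.one_eq_top]; trivial
      · have h2 := h1 (by push_cast at hmk ⊢; omega) v hv
        have h3 : fgrX F (σ lam) * E v ∈
            fgrAugIdeal F M ^ (1 + ((m : ℤ) - (k - 1)).toNat) := by
          rw [pow_add, pow_one]
          exact Ideal.mul_mem_mul (fgrX_mem F _) (ih v hv)
        have h4 := add_mem h2 (Ideal.pow_le_pow_right (n := 1 + ((m : ℤ) - (k - 1)).toNat)
          (m := (((m + 1 : ℕ) : ℤ) - (k - 1)).toNat) (by push_cast; omega) h3)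
        have h5 : (E * Algebra.lmul R _ (fgrX F lam) - Algebra.lmul R _ (fgrX F (σ lam)) * E) v +
          fgrX F (σ lam) * E v = E (fgrX F lam * v) := sub_add_cancel _ _
        rwa [h5] at h4
    rw [pow_succ'] at hu
    induction hu using Submodule.mul_induction_on' with
    | mem_mul_mem a ha v hv =>
      rw [fgrAugIdeal_eq_span F (Module.Free.chooseBasis ℤ M)] at ha
      induction ha using Submodule.span_induction generalizing v with
      | mem x hx =>
        obtain ⟨j, rfl⟩ := hx
        exact key _ v hv
      | zero => rw [zero_mul, map_zero]; exact zero_mem _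
      | add x y _ _ hx hy => rw [add_mul, map_add]; exact add_mem (hx v hv) (hy v hv)
      | smul c x _ hx =>
        rw [smul_eq_mul, mul_comm c x, mul_assoc]
        exact hx _ (Ideal.mul_mem_left _ _ hv)
    | add x _ y _ hx hy => rw [map_add]; exact add_mem hx hy

variable {ι N : Type*} [AddCommGroup N] (P : RootPairing ι ℤ M N)

/-- The action of an element of the Weyl group on `R⟦M⟧_F`. -/
def weylMap {P : RootPairing ι ℤ M N} (w : P.weylGroup) :
    FormalGroupRing F M →ₐ[R] FormalGroupRing F M :=
  fgrMap F (DistribSMul.toAddMonoidHom M w)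

omit [F.IsComm] [Module.Free ℤ M] [Module.Finite ℤ M] in
lemma weylMap_fgrX {P : RootPairing ι ℤ M N} (w : P.weylGroup) (lam : M) :
    weylMap F w (fgrX F lam) = fgrX F (w • lam) := fgrMap_fgrX F _ lam

omit [F.IsComm] [Module.Free ℤ M] [Module.Finite ℤ M] in
lemma fgrMap_reflectionHom (i : ι) :
    fgrMap F (reflectionHom (P.root i) (P.coroot' i)) =
      weylMap F (RootPairing.weylGroup.ofIdx P i) := by
  rw [weylMap]
  refine congrArg _ (AddMonoidHom.ext fun x => ?_)
  exact (ofIdx_smul_eq i x).symm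

lemma rootDel_mem_opOrder (i : ι) : rootDel F P i ∈ opOrder F M 1 := by
  intro m n hn u hu
  rcases m with _ | m
  · have : n = 0 := by omega
    rw [this, pow_zero, Ideal.one_eq_top]; trivial
  · exact Ideal.pow_le_pow_right (by omega) (demazure_mem_pow F _ _ hu)

lemma rootDel_mul_lmul (i : ι) (u : FormalGroupRing F M) :
    rootDel F P i * Algebra.lmul R _ u =
      Algebra.lmul R _ (weylMap F (RootPairing.weylGroup.ofIdx P i) u) * rootDel F P i +
        Algebra.lmul R _ (rootDel F P i u) := by
  refine LinearMap.ext fun v => ?_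
  change demazure F _ _ (u * v) = _ * demazure F _ _ v + demazure F _ _ u * v
  rw [demazure_mul, fgrMap_reflectionHom, add_comm]

variable {P} (b : P.Base)

omit [F.IsComm] [Module.Free ℤ M] [Module.Finite ℤ M] in
lemma delWord_nil : delWord F b [] = 1 := rfl

omit [F.IsComm] [Module.Free ℤ M] [Module.Finite ℤ M] in
lemma delWord_cons (i : b.support) (I : List b.support) :
    delWord F b (i :: I) = rootDel F P i * delWord F b I := by simp [delWord]

omit [F.IsComm] [Module.Free ℤ M] [Module.Finite ℤ M] in
lemma delWord_append (I K : List b.support) :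
    delWord F b (I ++ K) = delWord F b I * delWord F b K := by simp [delWord]

lemma delWord_mem_opOrder (I : List b.support) : delWord F b I ∈ opOrder F M I.length := by
  induction I with
  | nil => exact one_mem_opOrder
  | cons i I ih =>
    rw [delWord_cons]
    exact mul_mem_opOrder_of_le (rootDel_mem_opOrder F P _) ih (by simp; omega)

/-- When x_lam moves left past a letter, either the letter stays and x is reflected, or the letter
disappears and differentiates x. The derivative is an integer modulo I, and this error in I costs
one further order. -/
lemma delWord_mul_lmul (I : List b.support) (lam : M) :
    delWord F b I * Algebra.lmul R _ (fgrX F lam) -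
        Algebra.lmul R _ (fgrX F (wordProd b I • lam)) * delWord F b I -
      ((deletions b I).map fun p => P.coroot' p.1 lam • delWord F b p.2).sum ∈
      opOrder F M (I.length - 2) := by
  induction I with
  | nil => simp [deletions, wordProd_nil, delWord_nil]
  | cons i I ih =>
    set v := wordProd b I with hv
    have h1 := mul_mem_opOrder (rootDel_mem_opOrder F P (i : ι)) ih
    have h2 : Algebra.lmul R _ (rootDel F P i (fgrX F (v • lam)) -
        algebraMap R _ ((P.coroot' i (v • lam) : ℤ) : R)) ∈ opOrder F M (-(1 : ℕ)) :=
      lmul_mem_opOrder (by rw [pow_one]; exact demazure_fgrX_sub_mem F _ _ _)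
    have h3 := mul_mem_opOrder h2 (delWord_mem_opOrder F b I)
    have h4 := add_mem (opOrder_mono F (k := ((i :: I).length : ℤ) - 2) (by simp; omega) h1)
      (opOrder_mono F (k := ((i :: I).length : ℤ) - 2) (by simp; omega) h3)
    convert h4 using 1
    have hc : P.coroot' (v⁻¹ • (i : ι)) lam = P.coroot' i (v • lam) := by
      rw [← coroot'_smul v, smul_inv_smul]
    have hs : (((deletions b I).map fun p => (p.1, i :: p.2)).map
        fun p => P.coroot' p.1 lam • delWord F b p.2).sum = rootDel F P i *
        ((deletions b I).map fun p => P.coroot' p.1 lam • delWord F b p.2).sum := by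
      rw [List.map_map, ← List.sum_map_mul_left]
      simp only [Function.comp_def, delWord_cons, mul_smul_comm]
    rw [deletions, List.map_cons, List.sum_cons, hs, hc, wordProd_cons, ← hv, delWord_cons,
      map_sub, lmul_intCast, mul_sub, mul_sub, ← mul_assoc (rootDel F P i),
      ← mul_assoc (rootDel F P i), rootDel_mul_lmul, weylMap_fgrX, mul_smul]
    simp only [add_mul, sub_mul, smul_mul_assoc, one_mul, mul_assoc]
    abel

lemma sum_map_sub_sum_map_mem {α E : Type*} [AddCommGroup E] [Module R E] (S : Submodule R E)
    (l : List α) (f g : α → E) (h : ∀ a ∈ l, f a - g a ∈ S) :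
    (l.map f).sum - (l.map g).sum ∈ S := by
  induction l with
  | nil => simp
  | cons a l ih =>
    simp only [List.map_cons, List.sum_cons, add_sub_add_comm]
    exact add_mem (h a List.mem_cons_self) (ih fun x hx => h x (List.mem_cons_of_mem _ hx))

/-- The two deletions of the word [i, i] leave the same word with opposite roots, so the leading
part of the twisted commutator cancels. -/
lemma rootDel_mul_self_mem (i : b.support) :
    rootDel F P (i : ι) * rootDel F P i ∈ opOrder F M 1 := by
  have h := delWord_mul_lmul F b [i, i]
  refine mem_opOrder_of_twisted F (fun lam => wordProd b [i, i] • lam) (k := 2) (by omega)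
    fun lam => ?_
  have h2 : ((deletions b [i, i]).map fun p => P.coroot' p.1 lam • delWord F b p.2).sum = 0 := by
    simp only [deletions, wordProd_cons, wordProd_nil, mul_one, ofIdx_inv, ofIdx_smul_self,
      inv_one, one_smul, List.map_cons, List.map_nil, List.sum_cons, List.sum_nil, coroot'_negIdx,
      add_zero]
    rw [neg_zsmul, neg_add_cancel]
  have h3 := h lam
  rw [h2, sub_zero, delWord_cons, delWord_cons, delWord_nil, mul_one] at h3
  exact h3

variable [Finite ι] [P.IsReduced]

/-- Both statements are proved together by induction on k. In a word i K that is not reduced, either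
K is not reduced, or s_i shortens the product of K. In the latter case K may be replaced, modulo
lower order, by a reduced word beginning with i, and the square of Δ_i drops the order. For two
reduced words of w, the twisted commutators with x_lam have the same leading sum over the inversions
of w, so their difference meets the criterion `mem_opOrder_of_twisted`. -/
lemma delWord_filtration (k : ℕ) :
    (∀ I : List b.support, I.length = k → ¬ IsReducedWord b I →
      delWord F b I ∈ opOrder F M (k - 1)) ∧
    ∀ I K : List b.support, I.length = k → K.length = k → IsReducedWord b I → IsReducedWord b K →
      wordProd b I = wordProd b K → delWord F b I - delWord F b K ∈ opOrder F M (k - 1) := by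
  classical
  induction k with
  | zero =>
    refine ⟨fun I hI h => ?_, fun I K hI hK _ _ _ => ?_⟩
    · rw [List.length_eq_zero_iff] at hI
      subst hI
      exact (h weylLength_one.symm).elim
    · rw [List.length_eq_zero_iff] at hI hK
      rw [hI, hK, sub_self]
      exact zero_mem _
  | succ k ih =>
    obtain ⟨ih1, ih2⟩ := ih
    constructor
    · intro I hI hred
      rcases I with _ | ⟨i, K⟩
      · simp at hI
      rw [List.length_cons, Nat.add_right_cancel_iff] at hI
      rw [delWord_cons]
      by_cases hK : IsReducedWord b K
      · rw [IsReducedWord, hI] at hK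
        rw [IsReducedWord, List.length_cons, wordProd_cons, hI] at hred
        have hl := (weylLength_ofIdx_mul i (wordProd b K)).resolve_left (by omega)
        obtain ⟨L, hL, hLl⟩ := exists_isReducedDecomp b
          (RootPairing.weylGroup.ofIdx P (i : ι) * wordProd b K)
        have hp : wordProd b (i :: L) = wordProd b K := by
          rw [wordProd_cons, hL, ← mul_assoc, ofIdx_mul_self, one_mul]
        have hlen : (i :: L).length = k := by rw [List.length_cons]; omega
        have h1 := ih2 K (i :: L) hI hlen (by rw [IsReducedWord]; omega)
          (by rw [IsReducedWord, hp]; omega) hp.symm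
        have h2 := mul_mem_opOrder (rootDel_mem_opOrder F P (i : ι)) h1
        have h3 := mul_mem_opOrder (rootDel_mul_self_mem F b i) (delWord_mem_opOrder F b L)
        have h4 := add_mem
          (opOrder_mono F (k := ((k + 1 : ℕ) : ℤ) - 1) (by push_cast; omega) h2)
          (opOrder_mono F (k := ((k + 1 : ℕ) : ℤ) - 1)
            (by rw [List.length_cons] at hlen; push_cast; omega) h3)
        rwa [delWord_cons, mul_sub, ← mul_assoc, sub_add_cancel] at h4
      · exact mul_mem_opOrder_of_le (rootDel_mem_opOrder F P _) (ih1 K hI hK) (by push_cast; omega)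
    · intro I K hI hK hIr hKr hIK
      choose red hred using exists_isReducedDecomp b
      set w := wordProd b I with hw
      -- Each shortened word is replaced by a fixed reduced word of its product w s_γ, or by 0 when
      -- it is not reduced. By the induction hypotheses this costs only lower order, and the
      -- resulting sum no longer depends on L.
      have key : ∀ L : List b.support, L.length = k + 1 → IsReducedWord b L → wordProd b L = w →
          ∀ lam : M, delWord F b L * Algebra.lmul R _ (fgrX F lam) -
            Algebra.lmul R _ (fgrX F (w • lam)) * delWord F b L -
            ∑ j ∈ inversions b w, P.coroot' j lam •
              (if weylLength b (w * RootPairing.weylGroup.ofIdx P j) = k then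
                delWord F b (red (w * RootPairing.weylGroup.ofIdx P j)) else 0) ∈
            opOrder F M (((k + 1 : ℕ) : ℤ) - 2) := by
        intro L hL hLr hLw lam
        have h1 := delWord_mul_lmul F b L lam
        rw [hL, hLw] at h1
        have h2 := sum_map_sub_sum_map_mem (opOrder F M (((k + 1 : ℕ) : ℤ) - 2)) (deletions b L)
          (fun p => P.coroot' p.1 lam • delWord F b p.2)
          (fun p => P.coroot' p.1 lam •
            (if weylLength b (w * RootPairing.weylGroup.ofIdx P p.1) = k then
                delWord F b (red (w * RootPairing.weylGroup.ofIdx P p.1)) else 0)) ?_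
        · have h3 := List.sum_toFinset (fun j => P.coroot' j lam •
              (if weylLength b (w * RootPairing.weylGroup.ofIdx P j) = k then
                delWord F b (red (w * RootPairing.weylGroup.ofIdx P j)) else 0))
            hLr.nodup_deletions
          rw [hLr.toFinset_deletions, hLw, List.map_map] at h3
          have h4 := add_mem h1 h2
          rw [sub_add_sub_cancel] at h4
          rw [h3]
          exact h4
        · intro p hp
          have hpl := length_of_mem_deletions b hp
          have hpw := wordProd_of_mem_deletions b hp
          rw [hLw] at hpw
          simp only [← zsmul_sub]
          refine zsmul_mem ?_ _
          refine opOrder_mono F (j := (k : ℤ) - 1) (by push_cast; omega) ?_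
          split_ifs with hk
          · refine ih2 _ _ (by omega) (by rw [(hred _).2, hk]) ?_ (hred _).isReducedWord ?_
            · rw [IsReducedWord, hpw, hk]; omega
            · rw [hpw, (hred _).1]
          · rw [sub_zero]
            refine ih1 _ (by omega) fun h => hk ?_
            rw [← hpw, ← h]; omega
      refine mem_opOrder_of_twisted F (fun lam => w • lam) (by push_cast; omega) fun lam => ?_
      have h := sub_mem (key I hI hIr rfl lam) (key K hK hKr hIK.symm lam)
      convert h using 1
      rw [sub_mul, mul_sub]
      abel

variable {b}

lemma delWord_mem_of_not_isReducedWord {I : List b.support} (hI : ¬ IsReducedWord b I) :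
    delWord F b I ∈ opOrder F M (I.length - 1) := (delWord_filtration F b _).1 I rfl hI

lemma delWord_sub_delWord_mem {I K : List b.support} {w : P.weylGroup} (hI : IsReducedDecomp b I w)
    (hK : IsReducedDecomp b K w) :
    delWord F b I - delWord F b K ∈ opOrder F M (weylLength b w - 1) :=
  (delWord_filtration F b _).2 I K hI.2 hK.2 hI.isReducedWord hK.isReducedWord
    (hI.1.trans hK.1.symm)

end Demazure

end

end FormalDemazure

namespace FormalDemazure

noncomputable section

/-! ### Lifting the torsion index to the formal group ring -/

section Torsion

lemma ι_ne_zero {M : Type*} [AddCommGroup M] [Module.Free ℤ M] {x : M} (hx : x ≠ 0) :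
    SymmetricAlgebra.ι ℤ M x ≠ 0 := by
  intro h
  let e := Module.Free.chooseBasis ℤ M
  have h2 : ∀ i, e.repr x i = 0 := by
    intro i
    let f : M →ₗ[ℤ] Polynomial ℤ := (e.coord i).smulRight Polynomial.X
    have := congrArg (SymmetricAlgebra.lift f) h
    rw [SymmetricAlgebra.lift_ι_apply, map_zero] at this
    have h3 := congrArg (fun p => Polynomial.coeff p 1) this
    simpa [f] using h3
  exact hx (e.repr.map_eq_zero_iff.1 (Finsupp.ext h2))

variable {R : Type*} [CommRing R] (F : FormalGroup R) {M : Type*} [AddCommGroup M]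

variable (M) in
/-- Pairs of a homogeneous element of degree `m` of the symmetric algebra of `M`, and an element of
`I ^ m` with the corresponding class modulo `I ^ (m + 1)`. -/
def symLift (m : ℕ) : AddSubgroup (SymmetricAlgebra ℤ M × FormalGroupRing F M) :=
  AddSubgroup.closure ({p | p.1 = 0 ∧ p.2 ∈ fgrAugIdeal F M ^ (m + 1)} ∪
    {p | ∃ l : List M, l.length = m ∧
      p = ((l.map (SymmetricAlgebra.ι ℤ M)).prod, (l.map (fgrX F)).prod)})

variable {F}

lemma mem_symLift_of_mem {m : ℕ} {u : FormalGroupRing F M} (hu : u ∈ fgrAugIdeal F M ^ (m + 1)) :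
    (0, u) ∈ symLift F M m := AddSubgroup.subset_closure (Or.inl ⟨rfl, hu⟩)

lemma prod_mem_symLift {m : ℕ} {l : List M} (hl : l.length = m) :
    ((l.map (SymmetricAlgebra.ι ℤ M)).prod, (l.map (fgrX F)).prod) ∈ symLift F M m :=
  AddSubgroup.subset_closure (Or.inr ⟨l, hl, rfl⟩)

lemma list_prod_mem_pow (l : List M) : (l.map (fgrX F)).prod ∈ fgrAugIdeal F M ^ l.length := by
  induction l with
  | nil => rw [List.length_nil, pow_zero, Ideal.one_eq_top]; trivial
  | cons a l ih =>
    rw [List.map_cons, List.prod_cons, List.length_cons, pow_succ']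
    exact Ideal.mul_mem_mul (fgrAug_fgrX F a) ih

lemma mem_pow_of_mem_symLift {m : ℕ} {p : SymmetricAlgebra ℤ M × FormalGroupRing F M}
    (hp : p ∈ symLift F M m) : p.2 ∈ fgrAugIdeal F M ^ m := by
  induction hp using AddSubgroup.closure_induction with
  | mem x hx =>
    rcases hx with hx | ⟨l, hl, rfl⟩
    · exact Ideal.pow_le_pow_right (Nat.le_succ m) hx.2
    · rw [← hl]; exact list_prod_mem_pow l
  | zero => exact zero_mem _
  | add x y _ _ hx hy => exact add_mem hx hy
  | neg x _ hx => exact neg_mem hx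

lemma ι_mul_mem_symLift {m : ℕ} {p : SymmetricAlgebra ℤ M × FormalGroupRing F M}
    (hp : p ∈ symLift F M m) (lam : M) :
    (SymmetricAlgebra.ι ℤ M lam * p.1, fgrX F lam * p.2) ∈ symLift F M (m + 1) := by
  induction hp using AddSubgroup.closure_induction with
  | mem x hx =>
    rcases hx with hx | ⟨l, hl, rfl⟩
    · rw [hx.1, mul_zero]
      refine mem_symLift_of_mem ?_
      rw [pow_succ']
      exact Ideal.mul_mem_mul (fgrAug_fgrX F lam) hx.2
    · have := prod_mem_symLift (F := F) (m := m + 1) (l := lam :: l) (by simp [hl])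
      simpa only [List.map_cons, List.prod_cons] using this
  | zero => rw [Prod.fst_zero, Prod.snd_zero, mul_zero, mul_zero]; exact zero_mem _
  | add x y _ _ hx hy => simpa [mul_add] using add_mem hx hy
  | neg x _ hx => simpa using neg_mem hx

lemma exists_mem_symLift {m : ℕ} {a : SymmetricAlgebra ℤ M}
    (ha : a ∈ LinearMap.range (SymmetricAlgebra.ι ℤ M) ^ m) :
    ∃ u, (a, u) ∈ symLift F M m := by
  induction m generalizing a with
  | zero =>
    rw [pow_zero, Submodule.mem_one] at ha
    obtain ⟨n, rfl⟩ := ha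
    refine ⟨n • 1, ?_⟩
    have := zsmul_mem (prod_mem_symLift (F := F) (l := ([] : List M)) rfl) n
    simpa [Algebra.algebraMap_eq_smul_one] using this
  | succ m ih =>
    rw [pow_succ'] at ha
    refine Submodule.mul_induction_on ha ?_ ?_
    · rintro _ ⟨lam, rfl⟩ n hn
      obtain ⟨u, hu⟩ := ih hn
      exact ⟨_, ι_mul_mem_symLift hu lam⟩
    · rintro x y ⟨u, hu⟩ ⟨v, hv⟩
      exact ⟨u + v, add_mem hu hv⟩

lemma fgrAug_of_mem_symLift {p : SymmetricAlgebra ℤ M × FormalGroupRing F M}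
    (hp : p ∈ symLift F M 0) : ∃ n : ℤ, p.1 = algebraMap ℤ _ n ∧ fgrAug F M p.2 = n := by
  induction hp using AddSubgroup.closure_induction with
  | mem x hx =>
    rcases hx with hx | ⟨l, hl, rfl⟩
    · refine ⟨0, by simp [hx.1], ?_⟩
      have := hx.2
      rw [zero_add, pow_one] at this
      rw [Int.cast_zero]
      exact this
    · rw [List.length_eq_zero_iff] at hl
      subst hl
      exact ⟨1, by simp, by simp⟩
  | zero => exact ⟨0, by simp, by simp⟩
  | add x y _ _ hx hy =>
    obtain ⟨m, hm, hm'⟩ := hx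
    obtain ⟨n, hn, hn'⟩ := hy
    exact ⟨m + n, by simp [hm, hn], by simp [hm', hn']⟩
  | neg x _ hx =>
    obtain ⟨m, hm, hm'⟩ := hx
    exact ⟨-m, by simp [hm], by simp [hm']⟩

variable [F.IsComm] [Module.Free ℤ M] [Module.Finite ℤ M] {ι N : Type*} [AddCommGroup N]
  {P : RootPairing ι ℤ M N}

variable (P) in
/-- The reflection of index `i` on the symmetric algebra. -/
def symReflection (i : ι) : SymmetricAlgebra ℤ M →ₐ[ℤ] SymmetricAlgebra ℤ M :=
  SymmetricAlgebra.lift (SymmetricAlgebra.ι ℤ M ∘ₗ (P.reflection i).toLinearMap)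

omit [Module.Free ℤ M] [Module.Finite ℤ M] in
lemma symReflection_ι (i : ι) (lam : M) : symReflection P i (SymmetricAlgebra.ι ℤ M lam) =
    SymmetricAlgebra.ι ℤ M (RootPairing.weylGroup.ofIdx P i • lam) := by
  rw [symReflection, SymmetricAlgebra.lift_ι_apply]; rfl

omit [Module.Finite ℤ M] in
-- The symmetric algebra is a domain and the root is nonzero, so the chosen quotient is the only
-- one.
lemma symDemazure_eq {i : ι} {u v : SymmetricAlgebra ℤ M}
    (h : v * SymmetricAlgebra.ι ℤ M (P.root i) = u - symReflection P i u) :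
    symDemazure P i u = v := by
  have hex : ∃ v, v * SymmetricAlgebra.ι ℤ M (P.root i) =
    u - SymmetricAlgebra.lift (SymmetricAlgebra.ι ℤ M ∘ₗ (P.reflection i).toLinearMap) u := ⟨v, h⟩
  rw [symDemazure, dif_pos hex]
  exact mul_right_cancel₀ (ι_ne_zero (P.ne_zero i)) (hex.choose_spec.trans h.symm)

/-- The classical and the formal operators obey the same twisted Leibniz rule and have the same
value on a single factor modulo I, so induction on the number of factors keeps the leading terms
equal. -/
lemma exists_symDemazure_prod (i : ι) (lam : M) (l : List M) :
    ∃ a, a * SymmetricAlgebra.ι ℤ M (P.root i) =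
      ((lam :: l).map (SymmetricAlgebra.ι ℤ M)).prod -
        symReflection P i ((lam :: l).map (SymmetricAlgebra.ι ℤ M)).prod ∧
      (a, rootDel F P i ((lam :: l).map (fgrX F)).prod) ∈ symLift F M l.length := by
  have hd : ∀ (lam : M) (l : List M), (P.coroot' i lam • (l.map (SymmetricAlgebra.ι ℤ M)).prod,
      rootDel F P i (fgrX F lam) * (l.map (fgrX F)).prod) ∈ symLift F M l.length := by
    intro lam l
    have h1 := zsmul_mem (prod_mem_symLift (F := F) (l := l) rfl) (P.coroot' i lam)
    have h2 := demazure_fgrX_sub_mem F (P.coroot' i) (P.root i) lam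
    have h3 : (rootDel F P i (fgrX F lam) - algebraMap R _ (P.coroot' i lam : R)) *
        (l.map (fgrX F)).prod ∈ fgrAugIdeal F M ^ (l.length + 1) := by
      rw [pow_succ']
      exact Ideal.mul_mem_mul h2 (list_prod_mem_pow l)
    have h4 := add_mem h1 (mem_symLift_of_mem h3)
    rw [Prod.smul_mk, Prod.mk_add_mk, add_zero, sub_mul, map_intCast, zsmul_eq_mul,
      zsmul_eq_mul, add_sub_cancel] at h4
    rwa [zsmul_eq_mul]
  have hs : ∀ lam : M, SymmetricAlgebra.ι ℤ M lam - symReflection P i (SymmetricAlgebra.ι ℤ M lam) =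
      P.coroot' i lam • SymmetricAlgebra.ι ℤ M (P.root i) := by
    intro lam
    rw [symReflection_ι, ofIdx_smul_eq, map_sub, sub_sub_cancel, map_zsmul]
  induction l generalizing lam with
  | nil =>
    refine ⟨P.coroot' i lam • 1, ?_, ?_⟩
    · simp only [List.map_cons, List.map_nil, List.prod_cons, List.prod_nil, mul_one]
      rw [hs, smul_mul_assoc, one_mul]
    · simpa using hd lam []
  | cons mu l ih =>
    obtain ⟨a, ha, ha'⟩ := ih mu
    set q := ((mu :: l).map (SymmetricAlgebra.ι ℤ M)).prod with hq
    set r := ((mu :: l).map (fgrX F)).prod with hr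
    refine ⟨P.coroot' i lam • q +
      SymmetricAlgebra.ι ℤ M (RootPairing.weylGroup.ofIdx P i • lam) * a, ?_, ?_⟩
    · rw [List.map_cons, List.prod_cons, ← hq, map_mul, add_mul, mul_assoc, ha, ← symReflection_ι,
        smul_mul_assoc, mul_comm q, ← smul_mul_assoc, ← hs]
      ring
    · rw [List.map_cons, List.prod_cons, ← hr]
      have h1 := ι_mul_mem_symLift ha' (RootPairing.weylGroup.ofIdx P i • lam)
      have h2 := add_mem (hd lam (mu :: l)) h1
      rw [← hq, ← hr] at h2
      have h3 : rootDel F P i (fgrX F lam * r) = rootDel F P i (fgrX F lam) * r +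
          fgrX F (RootPairing.weylGroup.ofIdx P i • lam) * rootDel F P i r := by
        rw [← weylMap_fgrX, ← fgrMap_reflectionHom]
        exact demazure_mul F _ _ _ _
      rw [h3]
      exact h2

lemma symDemazure_mem_symLift (i : ι) {m : ℕ} {p : SymmetricAlgebra ℤ M × FormalGroupRing F M}
    (hp : p ∈ symLift F M (m + 1)) :
    (symDemazure P i p.1, rootDel F P i p.2) ∈ symLift F M m := by
  suffices h : ∃ a, a * SymmetricAlgebra.ι ℤ M (P.root i) = p.1 - symReflection P i p.1 ∧
      (a, rootDel F P i p.2) ∈ symLift F M m by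
    obtain ⟨a, ha, h⟩ := h
    rwa [symDemazure_eq ha]
  induction hp using AddSubgroup.closure_induction with
  | mem x hx =>
    rcases hx with hx | ⟨l, hl, rfl⟩
    · exact ⟨0, by simp [hx.1], mem_symLift_of_mem (demazure_mem_pow F _ _ hx.2)⟩
    · rcases l with _ | ⟨lam, l⟩
      · simp at hl
      obtain rfl : l.length = m := by simpa using hl
      exact exists_symDemazure_prod i lam l
  | zero => exact ⟨0, by simp, by rw [Prod.snd_zero, map_zero]; exact zero_mem _⟩
  | add x y _ _ hx hy =>
    obtain ⟨a, ha, ha'⟩ := hx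
    obtain ⟨c, hc, hc'⟩ := hy
    refine ⟨a + c, ?_, ?_⟩
    · rw [add_mul, ha, hc, Prod.fst_add, map_add]; ring
    · rw [Prod.snd_add, map_add]; exact add_mem ha' hc'
  | neg x _ hx =>
    obtain ⟨a, ha, ha'⟩ := hx
    refine ⟨-a, ?_, ?_⟩
    · rw [neg_mul, ha, Prod.fst_neg, map_neg]; ring
    · rw [Prod.snd_neg, map_neg]; exact neg_mem ha'

lemma symDemazureWord_mem_symLift (b : P.Base) (I : List b.support) {m : ℕ}
    {p : SymmetricAlgebra ℤ M × FormalGroupRing F M} (hp : p ∈ symLift F M (m + I.length)) :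
    (symDemazureWord b I p.1, delWord F b I p.2) ∈ symLift F M m := by
  induction I generalizing m with
  | nil => exact hp
  | cons i I ih =>
    rw [delWord_cons]
    refine symDemazure_mem_symLift (p := (symDemazureWord b I p.1, delWord F b I p.2)) (i : ι)
      (ih ?_)
    rwa [List.length_cons, ← add_assoc, add_right_comm] at hp

variable [Finite ι] [P.IsReduced]

/-- The torsion index as a value of the formal divided difference operators of maximal length. -/
lemma exists_fgrAug_delWord_eq_torsionIndex (b : P.Base) {w₀ : P.weylGroup}
    (hw₀ : IsLongest b w₀) :
    ∃ u ∈ fgrAugIdeal F M ^ weylLength b w₀, ∀ I, IsReducedDecomp b I w₀ →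
      fgrAug F M (delWord F b I u) = torsionIndex b := by
  rcases Set.eq_empty_or_nonempty {n : ℕ | 0 < n ∧ ∃ (w₀ : P.weylGroup) (I : List b.support),
    IsLongest b w₀ ∧ IsReducedDecomp b I w₀ ∧
    ∃ a ∈ LinearMap.range (SymmetricAlgebra.ι ℤ M) ^ weylLength b w₀,
      symDemazureWord b I a = algebraMap ℤ (SymmetricAlgebra ℤ M) n} with h | h
  -- If no positive value is attained, the infimum is 0 by convention and u = 0 serves.
  · have h0 : torsionIndex b = 0 := by rw [torsionIndex, h, Nat.sInf_empty]
    refine ⟨0, zero_mem _, fun I _ => ?_⟩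
    rw [map_zero, map_zero, h0, Nat.cast_zero]
  · have h0 := Nat.sInf_mem h
    rw [← torsionIndex] at h0
    obtain ⟨-, w, I, hw, hI, a, ha, haI⟩ := h0
    -- The infimum comes with its own longest element, which is the given one by uniqueness.
    obtain rfl : w = w₀ := hw₀.eq_of_weylLength_eq (le_antisymm (hw₀ w) (hw w₀))
    obtain ⟨u, hu⟩ := exists_mem_symLift (F := F) ha
    refine ⟨u, mem_pow_of_mem_symLift hu, fun K hK => ?_⟩
    have h1 := symDemazureWord_mem_symLift (m := 0) b I (p := (a, u)) (by rwa [hI.2, zero_add])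
    obtain ⟨n, hn, hn'⟩ := fgrAug_of_mem_symLift h1
    simp only [haI, SymmetricAlgebra.algebraMap_inj] at hn hn'
    -- Another reduced word changes the operator by one of order N - 1, which sends u into I.
    have h2 := delWord_sub_delWord_mem F hK hI (weylLength b w) 1 (by omega) u
      (mem_pow_of_mem_symLift hu)
    rw [pow_one, mem_fgrAugIdeal, LinearMap.sub_apply, map_sub, hn', sub_eq_zero] at h2
    rw [h2, ← hn, Int.cast_natCast]

end Torsion

end

end FormalDemazure

namespace FormalDemazure

noncomputable section

/-! ### Triangular matrices -/

section Triangular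

variable {R W : Type*} [CommRing R] [Fintype W] (len : W → ℕ) (a : Matrix W W R)

/-- Descending induction on length: in row w the columns of length at most len w vanish off the
diagonal, and the longer ones have coefficient zero already. Only the regular diagonal entry
remains. -/
lemma eq_zero_of_triangular (hdiag : ∀ w, a w w ∈ R⁰)
    (h0 : ∀ v w, len w ≤ len v → w ≠ v → a v w = 0) (p : ℕ) (r : W → R)
    (hr : ∀ v, p ≤ len v → ∑ w, r w * a v w = 0) {w : W} (hw : p ≤ len w) : r w = 0 := by
  obtain ⟨m, hm⟩ := (Set.finite_range len).bddAbove
  replace hm : ∀ w, len w ≤ m := fun w => hm ⟨w, rfl⟩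
  induction hd : m - len w using Nat.strong_induction_on generalizing w with
  | _ d ih =>
    have h1 := hr w hw
    rw [Finset.sum_eq_single w] at h1
    · exact (mem_nonZeroDivisors_iff.1 (hdiag w)).2 _ h1
    · intro v _ hv
      by_cases hlen : len v ≤ len w
      · rw [h0 w v hlen hv, mul_zero]
      · have := hm w
        have := hm v
        rw [ih (m - len v) (by omega) (by omega) rfl, zero_mul]
    · exact fun h => (h (Finset.mem_univ w)).elim

/-- The matrix is block triangular for the length with diagonal blocks. The submonoid S is kept
general so as to cover both regular elements and units. -/
lemma det_mem_of_triangular [DecidableEq W] (S : Submonoid R) (hdiag : ∀ w, a w w ∈ S)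
    (h0 : ∀ v w, len w ≤ len v → w ≠ v → a v w = 0) : a.det ∈ S := by
  classical
  have hb : a.BlockTriangular len := fun v w h => h0 v w h.le fun h' => by
    rw [h'] at h; exact lt_irrefl _ h
  rw [hb.det]
  refine prod_mem fun k _ => ?_
  have : a.toSquareBlock len k = Matrix.diagonal fun w : {w // len w = k} => a w w := by
    ext v w
    by_cases h : v = w
    · subst h; simp [Matrix.toSquareBlock_def]
    · rw [Matrix.diagonal_apply_ne _ h, Matrix.toSquareBlock_def]
      exact h0 _ _ (by rw [w.2, v.2]) fun h' => h (Subtype.ext h'.symm)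
  rw [this, Matrix.det_diagonal]
  exact prod_mem fun w _ => hdiag w

end Triangular

/-! ### Divided difference operators and twisted group algebras -/

section TwistedGroupAlgebra

variable {ι M N R : Type*} [AddCommGroup M] [AddCommGroup N] [CommRing R]
  {P : RootPairing ι ℤ M N} (b : P.Base)
  {A : Type*} [CommRing A] [Algebra R A]

/-- The composition of operators `D i` along a word. -/
def opWord (D : ι → Module.End R A) (I : List b.support) : Module.End R A :=
  (I.map fun i => D i).prod

lemma opWord_nil (D : ι → Module.End R A) : opWord b D [] = 1 := rfl

lemma opWord_cons (D : ι → Module.End R A) (i : b.support) (I : List b.support) :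
    opWord b D (i :: I) = D i * opWord b D I := by simp [opWord]

lemma opWord_append (D : ι → Module.End R A) (I K : List b.support) :
    opWord b D (I ++ K) = opWord b D I * opWord b D K := by simp [opWord]

variable (ρ : P.weylGroup →* (A →ₐ[R] A)) (x : ι → A) (D : ι → Module.End R A)

/-- The action of `w` as a linear endomorphism. -/
def twistedOp (w : P.weylGroup) : Module.End R A := (ρ w).toLinearMap

lemma twistedOp_mul (v w : P.weylGroup) :
    twistedOp ρ (v * w) = twistedOp ρ v * twistedOp ρ w := by
  rw [twistedOp, map_mul]; rfl

lemma twistedOp_one : twistedOp ρ 1 = 1 := by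
  rw [twistedOp, map_one]; rfl

lemma twistedOp_mul_smul (w : P.weylGroup) (a : A) (E : Module.End R A) :
    twistedOp ρ w * (a • E) = ρ w a • (twistedOp ρ w * E) :=
  LinearMap.ext fun u => map_mul (ρ w) a (E u)

lemma neg_smul_end (a : A) (E : Module.End R A) : (-a) • E = -(a • E) :=
  LinearMap.ext fun u => neg_mul a (E u)

/-- The `A`-span of the operators of the elements of the Weyl group of length less than `n`. -/
def twistedSpan (n : ℕ) : Submodule A (Module.End R A) :=
  Submodule.span A {E | ∃ w, weylLength b w < n ∧ E = twistedOp ρ w}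

variable {ρ}

lemma twistedOp_mem {n : ℕ} {w : P.weylGroup} (h : weylLength b w < n) :
    twistedOp ρ w ∈ twistedSpan b ρ n := Submodule.subset_span ⟨w, h, rfl⟩

lemma twistedSpan_mono {m n : ℕ} (h : m ≤ n) : twistedSpan b ρ m ≤ twistedSpan b ρ n :=
  Submodule.span_mono fun _ ⟨w, hw, hE⟩ => ⟨w, hw.trans_le h, hE⟩

lemma twistedOp_mul_mem {V : Submodule A (Module.End R A)} {s : Set (Module.End R A)}
    {w : P.weylGroup} (h : ∀ E ∈ s, twistedOp ρ w * E ∈ V) {E : Module.End R A}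
    (hE : E ∈ Submodule.span A s) : twistedOp ρ w * E ∈ V := by
  induction hE using Submodule.span_induction with
  | mem E hE => exact h E hE
  | zero => rw [mul_zero]; exact zero_mem _
  | add E E' _ _ h1 h2 => rw [mul_add]; exact add_mem h1 h2
  | smul a E _ h1 => rw [twistedOp_mul_smul]; exact Submodule.smul_mem _ _ h1

variable [Finite ι] [P.IsReduced]

lemma ofIdx_mul_mem_twistedSpan (i : b.support) {n : ℕ} {E : Module.End R A}
    (hE : E ∈ twistedSpan b ρ n) :
    twistedOp ρ (RootPairing.weylGroup.ofIdx P i) * E ∈ twistedSpan b ρ (n + 1) := by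
  refine twistedOp_mul_mem ?_ hE
  rintro _ ⟨w, hw, rfl⟩
  rw [← twistedOp_mul]
  exact twistedOp_mem b (by rcases weylLength_ofIdx_mul i w with h | h <;> omega)

/-- The multiplicative set generated by `-1` and the elements `x i`. -/
def rootMonoid (x : ι → A) : Submonoid A := Submonoid.closure ({-1} ∪ Set.range x)

omit [Finite ι] in
omit [P.IsReduced] in
lemma map_mem_rootMonoid (hx : ∀ w i, ρ w (x i) = x (w • i)) (w : P.weylGroup) {y : A}
    (hy : y ∈ rootMonoid x) : ρ w y ∈ rootMonoid x := by
  have h : rootMonoid x ≤ (rootMonoid x).comap (ρ w) := by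
    refine Submonoid.closure_le.2 ?_
    rintro y (rfl | ⟨i, rfl⟩)
    · refine Submonoid.subset_closure (Or.inl ?_)
      rw [map_neg, map_one]; rfl
    · exact Submonoid.subset_closure (Or.inr ⟨_, (hx w i).symm⟩)
  exact h hy

variable {x D}

omit [Finite ι] in
omit [P.IsReduced] in
-- If y clears the denominators of E, those of D i * E are cleared by x i * s(y) * y, where s is the
-- reflection of index i: one factor of y is needed for each of the two terms of D i.
lemma smul_mul_eq (hD : ∀ i u, x i * D i u = u - ρ (RootPairing.weylGroup.ofIdx P i) u) (i : ι)
    (y : A) (E : Module.End R A) :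
    (x i * ρ (RootPairing.weylGroup.ofIdx P i) y * y) • (D i * E) =
      ρ (RootPairing.weylGroup.ofIdx P i) y • (y • E) -
        y • (twistedOp ρ (RootPairing.weylGroup.ofIdx P i) * (y • E)) := by
  refine LinearMap.ext fun u => ?_
  change (x i * ρ _ y * y) * D i (E u) = ρ _ y * (y * E u) - y * ρ _ (y * E u)
  rw [map_mul, mul_comm (x i * _) y, mul_comm (x i), mul_assoc, mul_assoc, hD]
  ring

/-- Expanding each D i as (1 - s_i)/x_i, the only term of a word that can reach its full length is
the one taking -s_i/x_i at every letter. This is that expansion with denominators cleared. -/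
lemma exists_smul_opWord_sub_mem (hx : ∀ w i, ρ w (x i) = x (w • i))
    (hD : ∀ i u, x i * D i u = u - ρ (RootPairing.weylGroup.ofIdx P i) u) (I : List b.support) :
    ∃ y ∈ rootMonoid x, ∃ a ∈ rootMonoid x,
      y • opWord b D I - a • twistedOp ρ (wordProd b I) ∈ twistedSpan b ρ I.length := by
  induction I with
  | nil =>
    refine ⟨1, one_mem _, 1, one_mem _, ?_⟩
    rw [wordProd_nil, twistedOp_one, opWord_nil, sub_self]
    exact zero_mem _
  | cons i I ih =>
    obtain ⟨y, hy, a, ha, h⟩ := ih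
    set s := RootPairing.weylGroup.ofIdx P (i : ι)
    have hxi : x i ∈ rootMonoid x := Submonoid.subset_closure (Or.inr ⟨_, rfl⟩)
    have hm1 : (-1 : A) ∈ rootMonoid x := Submonoid.subset_closure (Or.inl rfl)
    refine ⟨x i * ρ s y * y, mul_mem (mul_mem hxi (map_mem_rootMonoid x hx s hy)) hy,
      -1 * y * ρ s a, mul_mem (mul_mem hm1 hy) (map_mem_rootMonoid x hx s ha), ?_⟩
    have h1 : twistedOp ρ (wordProd b I) ∈ twistedSpan b ρ (i :: I).length :=
      twistedOp_mem b (Nat.lt_succ_of_le (weylLength_wordProd_le b I))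
    have h2 : _ ∈ twistedSpan b ρ (i :: I).length := twistedSpan_mono b (Nat.le_succ I.length) h
    have h3 : _ ∈ twistedSpan b ρ (i :: I).length := ofIdx_mul_mem_twistedSpan b i h
    have h4 := sub_mem (Submodule.smul_mem _ (ρ s y) (add_mem h2 (Submodule.smul_mem _ a h1)))
      (Submodule.smul_mem _ y h3)
    convert h4 using 1
    rw [opWord_cons, smul_mul_eq hD, sub_add_cancel, mul_sub, twistedOp_mul_smul ρ s a,
      ← twistedOp_mul, ← wordProd_cons, smul_sub, neg_one_mul, neg_mul, neg_smul_end, mul_smul y]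
    abel

variable {I : P.weylGroup → List b.support} (hI : ∀ w, IsReducedDecomp b (I w) w)
  (hx : ∀ w i, ρ w (x i) = x (w • i))
  (hD : ∀ i u, x i * D i u = u - ρ (RootPairing.weylGroup.ofIdx P i) u)
  (hsat : ∀ i E, x i • E ∈ Submodule.span A (Set.range fun w => opWord b D (I w)) →
    E ∈ Submodule.span A (Set.range fun w => opWord b D (I w)))

include hsat in
omit [Finite ι] [P.IsReduced] in
lemma mem_span_of_smul_mem {y : A} (hy : y ∈ rootMonoid x) {E : Module.End R A}
    (h : y • E ∈ Submodule.span A (Set.range fun w => opWord b D (I w))) :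
    E ∈ Submodule.span A (Set.range fun w => opWord b D (I w)) := by
  induction hy using Submonoid.closure_induction generalizing E with
  | mem y hy =>
    rcases hy with rfl | ⟨i, rfl⟩
    · have h2 := neg_mem h
      rwa [neg_smul_end, one_smul, neg_neg] at h2
    · exact hsat i E h
  | one => rwa [one_smul] at h
  | mul y z _ _ h1 h2 =>
    rw [mul_smul] at h
    exact h2 (h1 h)

include hI hx hD hsat in
-- Induction on length: a multiple of w by an element of `rootMonoid` is a combination of one
-- operator of the span and of shorter group elements; saturation removes the multiplier.
lemma twistedOp_mem_span (w : P.weylGroup) :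
    twistedOp ρ w ∈ Submodule.span A (Set.range fun w => opWord b D (I w)) := by
  induction hn : weylLength b w using Nat.strong_induction_on generalizing w with
  | _ n ih =>
    obtain ⟨y, hy, a, ha, h⟩ := exists_smul_opWord_sub_mem b hx hD (I w)
    have hle : twistedSpan b ρ (I w).length ≤
        Submodule.span A (Set.range fun w => opWord b D (I w)) := by
      refine Submodule.span_le.2 ?_
      rintro _ ⟨v, hv, rfl⟩
      exact ih _ (by rw [← hn, ← (hI w).2]; exact hv) v rfl
    refine mem_span_of_smul_mem b hsat ha ?_
    rw [(hI w).1] at h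
    have h1 : opWord b D (I w) ∈ Submodule.span A (Set.range fun w => opWord b D (I w)) :=
      Submodule.subset_span ⟨w, rfl⟩
    have h2 := sub_mem (Submodule.smul_mem _ y h1) (hle h)
    rwa [sub_sub_cancel] at h2

include hI hx hD hsat in
/-- If the span of the operators along reduced words is saturated, then it is stable under
composition with divided difference operators. -/
lemma mul_opWord_mem_span (j : ι) (w : P.weylGroup) :
    D j * opWord b D (I w) ∈ Submodule.span A (Set.range fun w => opWord b D (I w)) := by
  obtain ⟨y, hy, a, ha, h⟩ := exists_smul_opWord_sub_mem b hx hD (I w)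
  set s := RootPairing.weylGroup.ofIdx P j
  have hle : Submodule.span A (Set.range (twistedOp ρ)) ≤
      Submodule.span A (Set.range fun w => opWord b D (I w)) := by
    refine Submodule.span_le.2 ?_
    rintro _ ⟨v, rfl⟩
    exact twistedOp_mem_span b hI hx hD hsat v
  have hT : twistedSpan b ρ (I w).length ≤ Submodule.span A (Set.range (twistedOp ρ)) :=
    Submodule.span_mono fun E ⟨v, _, hE⟩ => ⟨v, hE.symm⟩
  have h1 := add_mem (hT h) (Submodule.smul_mem _ a (Submodule.subset_span ⟨wordProd b (I w), rfl⟩))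
  rw [sub_add_cancel] at h1
  have h2 : twistedOp ρ s * (y • opWord b D (I w)) ∈
      Submodule.span A (Set.range (twistedOp ρ)) := by
    refine twistedOp_mul_mem ?_ h1
    rintro _ ⟨v, rfl⟩
    rw [← twistedOp_mul]
    exact Submodule.subset_span ⟨_, rfl⟩
  -- After multiplication by this element the composite lies in the span of the Weyl group, which is
  -- stable under s and contained in the target.
  refine mem_span_of_smul_mem b hsat (y := x j * ρ s y * y) ?_ ?_
  · exact mul_mem (mul_mem (Submonoid.subset_closure (Or.inr ⟨_, rfl⟩))
      (map_mem_rootMonoid x hx s hy)) hy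
  · rw [smul_mul_eq hD]
    exact hle (sub_mem (Submodule.smul_mem _ _ h1) (Submodule.smul_mem _ _ h2))

end TwistedGroupAlgebra

end

end FormalDemazure

namespace FormalDemazure

noncomputable section

/-! ### A lattice in which the roots become primitive -/

section GenericLattice

variable {ι M N : Type*} [AddCommGroup M] [AddCommGroup N] (P : RootPairing ι ℤ M N)

/-- The lattice `M ⊕ Q`, where `Q` is the root lattice. -/
abbrev GenLattice : Type _ := M × P.rootSpan ℤ

/-- The lift `(α, α)` of a root `α` to `M ⊕ Q`. -/
def genRoot (i : ι) : GenLattice P := (P.root i, P.rootSpanMem ℤ i)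

/-- The linear form `(lam, q) ↦ α^∨ lam`. -/
def genCoroot (i : ι) : GenLattice P →ₗ[ℤ] ℤ := P.coroot' i ∘ₗ LinearMap.fst ℤ _ _

variable {P}

lemma smul_sub_mem_rootSpan (w : P.weylGroup) (lam : M) : w • lam - lam ∈ P.rootSpan ℤ := by
  induction w using weylGroup_induction with
  | one => rw [one_smul, sub_self]; exact zero_mem _
  | mul i v ih =>
    rw [mul_smul, ofIdx_smul_eq, sub_right_comm]
    exact sub_mem ih (Submodule.smul_mem _ _ (P.rootSpanMem ℤ i).2)

/-- The action `(lam, q) ↦ (w lam, q + w lam - lam)` of the Weyl group on `M ⊕ Q`. -/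
def genAct (w : P.weylGroup) : GenLattice P →+ GenLattice P :=
  AddMonoidHom.mk' (fun p => (w • p.1, p.2 + ⟨w • p.1 - p.1, smul_sub_mem_rootSpan w p.1⟩))
    fun p q => by
      refine Prod.ext (smul_add w p.1 q.1) (Subtype.ext ?_)
      simp only [Prod.fst_add, Prod.snd_add, smul_add, Submodule.coe_add]
      abel

lemma genAct_fst (w : P.weylGroup) (p : GenLattice P) : (genAct w p).1 = w • p.1 := rfl

lemma genAct_snd (w : P.weylGroup) (p : GenLattice P) :
    ((genAct w p).2 : M) = p.2 + (w • p.1 - p.1) := rfl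

lemma gen_ext {p q : GenLattice P} (h1 : p.1 = q.1) (h2 : (p.2 : M) = q.2) : p = q :=
  Prod.ext h1 (Subtype.ext h2)

lemma genAct_one : genAct (1 : P.weylGroup) = AddMonoidHom.id (GenLattice P) :=
  AddMonoidHom.ext fun p => gen_ext (by rw [genAct_fst, one_smul]; rfl)
    (by rw [genAct_snd, one_smul, sub_self, add_zero]; rfl)

lemma genAct_mul (v w : P.weylGroup) : genAct (v * w) = (genAct v).comp (genAct w) :=
  AddMonoidHom.ext fun p => gen_ext (mul_smul v w p.1) <| by
    rw [AddMonoidHom.comp_apply, genAct_snd, genAct_snd, genAct_snd, genAct_fst, mul_smul]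
    abel

lemma genAct_genRoot (w : P.weylGroup) (i : ι) : genAct w (genRoot P i) = genRoot P (w • i) :=
  gen_ext (root_smul w i).symm <| by
    rw [genAct_snd]
    change P.root i + (w • P.root i - P.root i) = P.root (w • i)
    rw [root_smul]; abel

lemma reflectionHom_genRoot (i : ι) : reflectionHom (genRoot P i) (genCoroot P i) =
    genAct (RootPairing.weylGroup.ofIdx P i) :=
  AddMonoidHom.ext fun p => gen_ext (ofIdx_smul_eq i p.1).symm <| by
    rw [genAct_snd, ofIdx_smul_eq]
    change (p.2 : M) - P.coroot' i p.1 • P.root i = _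
    abel

/-- A simple root is a basis vector of the root lattice, and every root is reached from simple ones
by reflections, which preserve primitivity. In M itself a root may be divisible. -/
lemma exists_genRoot_eq_one [Finite ι] [P.IsReduced] (b : P.Base) (i : ι) :
    ∃ f : GenLattice P →ₗ[ℤ] ℤ, f (genRoot P i) = 1 := by
  suffices h : ∃ g : P.rootSpan ℤ →ₗ[ℤ] ℤ, g (P.rootSpanMem ℤ i) = 1 by
    obtain ⟨g, hg⟩ := h
    exact ⟨g ∘ₗ LinearMap.snd ℤ _ _, hg⟩
  induction i using b.induction_reflect with
  | h₀ i ih =>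
    obtain ⟨g, hg⟩ := ih
    refine ⟨-g, ?_⟩
    have : P.rootSpanMem ℤ (P.reflectionPerm i i) = - P.rootSpanMem ℤ i :=
      Subtype.ext (root_negIdx i)
    rw [this, LinearMap.neg_apply, map_neg, neg_neg, hg]
  | h₁ i hi =>
    refine ⟨b.toWeightBasisInt.coord ⟨i, hi⟩, ?_⟩
    have : P.rootSpanMem ℤ i = b.toWeightBasisInt ⟨i, hi⟩ :=
      Subtype.ext (b.coe_toWeightBasisInt_apply ⟨i, hi⟩).symm
    rw [this, Module.Basis.coord_apply, Module.Basis.repr_self, Finsupp.single_eq_same]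
  | h₂ i j ih hj =>
    obtain ⟨g, hg⟩ := ih
    let s : P.rootSpan ℤ →ₗ[ℤ] P.rootSpan ℤ := LinearMap.id -
      (P.coroot' j ∘ₗ (P.rootSpan ℤ).subtype).smulRight (P.rootSpanMem ℤ j)
    refine ⟨g ∘ₗ s, ?_⟩
    have : s (P.rootSpanMem ℤ (P.reflectionPerm j i)) = P.rootSpanMem ℤ i := by
      refine Subtype.ext ?_
      change P.root (P.reflectionPerm j i) - P.coroot' j (P.root (P.reflectionPerm j i)) •
        P.root j = P.root i
      rw [← ofIdx_smul_eq, ← root_smul, ← ofIdx_smul_idx, ← mul_smul, ofIdx_mul_self, one_smul]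
    rw [LinearMap.comp_apply, this, hg]

lemma finite_weylGroup [Finite ι] [P.IsReduced] (b : P.Base) : Finite P.weylGroup := by
  refine Finite.of_injective (fun (w : P.weylGroup) (i : ι) => w • i) fun v w h => ?_
  refine inv_mul_eq_one.1 (eq_one_of_weylLength_eq_zero (b := b) ?_)
  rw [weylLength_eq_card, Finset.card_eq_zero, Finset.eq_empty_iff_forall_notMem]
  intro i hi
  have hvw : v • i = w • i := congrFun h i
  rw [mem_inversions, mul_smul, ← hvw, inv_smul_smul] at hi
  exact hi.2 hi.1

end GenericLattice

/-! ### Divided difference operators span the algebra of operators -/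

section Spanning

variable {R : Type*} [CommRing R] (F : FormalGroup R) [F.IsComm] {M : Type*} [AddCommGroup M]
  [Module.Free ℤ M] [Module.Finite ℤ M] {ι N : Type*} [AddCommGroup N] {P : RootPairing ι ℤ M N}
  (b : P.Base)

variable {F} in
omit [F.IsComm] [Module.Free ℤ M] [Module.Finite ℤ M] in
lemma fgrAug_eq_zero_of_mem_opOrder {k : ℤ} {n : ℕ} (hk : k < n)
    {D : Module.End R (FormalGroupRing F M)} (hD : D ∈ opOrder F M k) {u : FormalGroupRing F M}
    (hu : u ∈ fgrAugIdeal F M ^ n) : fgrAug F M (D u) = 0 := by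
  have h := hD n 1 (by omega) u hu
  rwa [pow_one] at h

variable [Finite ι] [P.IsReduced]

/-- `u` is an element of `I ^ N` at which the divided difference operators of the reduced
decompositions of the longest element have augmentation `t`. -/
structure IsTorsionElement (w₀ : P.weylGroup) (t : R) (u : FormalGroupRing F M) : Prop where
  isLongest : IsLongest b w₀
  mem : u ∈ fgrAugIdeal F M ^ weylLength b w₀
  fgrAug_delWord : ∀ I, IsReducedDecomp b I w₀ → fgrAug F M (delWord F b I u) = t

variable {F b} {w₀ : P.weylGroup} {t : R} {u : FormalGroupRing F M}

/-- Such a word is shorter than N or is not reduced; in both cases its operator has order less than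
N and sends I^N into I. -/
lemma IsTorsionElement.fgrAug_eq_zero (h : IsTorsionElement F b w₀ t u) {I : List b.support}
    (hI : I.length ≤ weylLength b w₀) (hw : wordProd b I ≠ w₀) :
    fgrAug F M (delWord F b I u) = 0 := by
  rcases hI.lt_or_eq with hlt | heq
  · exact fgrAug_eq_zero_of_mem_opOrder (by exact_mod_cast hlt) (delWord_mem_opOrder F b I) h.mem
  · refine fgrAug_eq_zero_of_mem_opOrder (k := I.length - 1) (by omega)
      (delWord_mem_of_not_isReducedWord F fun hr => hw ?_) h.mem
    exact h.isLongest.eq_of_weylLength_eq (by rw [← hr, heq])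

omit [F.IsComm] [Module.Free ℤ M] [Module.Finite ℤ M] in
lemma IsLongest.inv_eq (h : IsLongest b w₀) : w₀⁻¹ = w₀ :=
  h.eq_of_weylLength_eq (weylLength_inv w₀)

omit [Module.Free ℤ M] [Module.Finite ℤ M] in
lemma IsLongest.weylLength_inv_mul (h : IsLongest b w₀) (w : P.weylGroup) :
    weylLength b (w⁻¹ * w₀) + weylLength b w = weylLength b w₀ := by
  have := h.weylLength_mul_inv w⁻¹
  rwa [inv_inv, weylLength_inv, ← weylLength_inv (w₀ * w), mul_inv_rev, h.inv_eq] at this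

variable {I : P.weylGroup → List b.support} (hI : ∀ w, IsReducedDecomp b (I w) w)

include hI in
omit [F.IsComm] in
lemma IsTorsionElement.fgrAug_pairing_self (h : IsTorsionElement F b w₀ t u) (w : P.weylGroup) :
    fgrAug F M (delWord F b (I w ++ I (w⁻¹ * w₀)) u) = t := by
  refine h.fgrAug_delWord _ ⟨?_, ?_⟩
  · rw [wordProd_append, (hI _).1, (hI _).1, mul_inv_cancel_left]
  · rw [List.length_append, (hI _).2, (hI _).2, ← h.isLongest.weylLength_inv_mul w, add_comm]

include hI in
-- The concatenated word has length l(w) + N - l(v) ≤ N and product w v⁻¹ w₀ ≠ w₀. With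
-- `fgrAug_pairing_self`, the pairing matrix is triangular with t on the diagonal.
lemma IsTorsionElement.fgrAug_pairing_ne (h : IsTorsionElement F b w₀ t u) {v w : P.weylGroup}
    (hl : weylLength b w ≤ weylLength b v) (hne : w ≠ v) :
    fgrAug F M (delWord F b (I w ++ I (v⁻¹ * w₀)) u) = 0 := by
  refine h.fgrAug_eq_zero ?_ ?_
  · rw [List.length_append, (hI _).2, (hI _).2, ← h.isLongest.weylLength_inv_mul v, add_comm]
    omega
  · rw [wordProd_append, (hI _).1, (hI _).1, ← mul_assoc]
    intro h'
    exact hne (mul_inv_eq_one.1 (mul_eq_right.1 h'))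

variable (F P) in
/-- The divided difference operators attached to the roots of the lattice `M ⊕ Q`. -/
def genDel (i : ι) : Module.End R (FormalGroupRing F (GenLattice P)) :=
  demazure F (genRoot P i) (genCoroot P i)

variable (F P) in
/-- The action of the Weyl group on `R⟦M ⊕ Q⟧_F`. -/
def genRep : P.weylGroup →* (FormalGroupRing F (GenLattice P) →ₐ[R]
    FormalGroupRing F (GenLattice P)) where
  toFun w := fgrMap F (genAct w)
  map_one' := AlgHom.ext fun u => by rw [genAct_one, fgrMap_id]; rfl
  map_mul' v w := AlgHom.ext fun u => by
    rw [genAct_mul, ← fgrMap_comp]; rfl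

omit [P.IsReduced] in
lemma fgrMap_fst_opWord (L : List b.support) (v : FormalGroupRing F (GenLattice P)) :
    fgrMap F (AddMonoidHom.fst M (P.rootSpan ℤ)) (opWord b (genDel F P) L v) =
      delWord F b L (fgrMap F (AddMonoidHom.fst M (P.rootSpan ℤ)) v) := by
  induction L with
  | nil => rfl
  | cons i L ih =>
    rw [opWord_cons, delWord_cons]
    change fgrMap F _ (demazure F _ _ _) = demazure F _ _ _
    rw [← ih]
    exact fgrMap_demazure F _ _ _ rfl (fun _ => rfl) _

omit [F.IsComm] [Module.Free ℤ M] [Module.Finite ℤ M] [Finite ι] [P.IsReduced] in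
lemma fgrMap_fst_inl (v : FormalGroupRing F M) :
    fgrMap F (AddMonoidHom.fst M (P.rootSpan ℤ))
      (fgrMap F (AddMonoidHom.inl M (P.rootSpan ℤ)) v) = v := by
  rw [fgrMap_comp, AddMonoidHom.fst_comp_inl, fgrMap_id]

omit [P.IsReduced] in
lemma fgrAug_opWord (L : List b.support) (v : FormalGroupRing F M) :
    fgrAug F (GenLattice P)
      (opWord b (genDel F P) L (fgrMap F (AddMonoidHom.inl M (P.rootSpan ℤ)) v)) =
      fgrAug F M (delWord F b L v) := by
  rw [← fgrAug_fgrMap F (AddMonoidHom.fst M (P.rootSpan ℤ)), fgrMap_fst_opWord, fgrMap_fst_inl]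

omit [P.IsReduced] in
lemma genDel_mul (i : ι) (v : FormalGroupRing F (GenLattice P)) :
    fgrX F (genRoot P i) * genDel F P i v =
      v - genRep F P (RootPairing.weylGroup.ofIdx P i) v := by
  rw [genDel, fgrX_mul_demazure, reflectionHom_genRoot]; rfl

include hI in
-- Evaluating x E = Σ c_w Δ_{I_w} at the elements Δ_{I_{v⁻¹w₀}}(u) gives a linear system whose right
-- side is divisible by x. Its determinant has regular augmentation, so, x being primitive, x
-- divides every c_w and can be cancelled.
lemma mem_span_of_fgrX_smul_mem (h : IsTorsionElement F b w₀ t u) (ht : t ∈ R⁰) (i : ι)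
    (E : Module.End R (FormalGroupRing F (GenLattice P)))
    (hE : fgrX F (genRoot P i) • E ∈ Submodule.span (FormalGroupRing F (GenLattice P))
      (Set.range fun w => opWord b (genDel F P) (I w))) :
    E ∈ Submodule.span (FormalGroupRing F (GenLattice P))
      (Set.range fun w => opWord b (genDel F P) (I w)) := by
  classical
  have := finite_weylGroup b
  have := Fintype.ofFinite P.weylGroup
  obtain ⟨f, hf⟩ := exists_genRoot_eq_one b i
  obtain ⟨c, hc⟩ := (Submodule.mem_span_range_iff_exists_fun _).1 hE
  set u' := fgrMap F (AddMonoidHom.inl M (P.rootSpan ℤ)) u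
  let a : Matrix P.weylGroup P.weylGroup (FormalGroupRing F (GenLattice P)) :=
    fun v w => opWord b (genDel F P) (I w ++ I (v⁻¹ * w₀)) u'
  have hdet : fgrAug F (GenLattice P) a.det ∈ R⁰ := by
    rw [AlgHom.map_det]
    refine det_mem_of_triangular (weylLength b) _ _ (fun w => ?_) fun v w hl hne => ?_
    · change fgrAug F _ (opWord b (genDel F P) _ _) ∈ _
      rw [fgrAug_opWord, h.fgrAug_pairing_self hI]
      exact ht
    · change fgrAug F _ (opWord b (genDel F P) _ _) = _
      rw [fgrAug_opWord, h.fgrAug_pairing_ne hI hl hne]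
  have h1 : a.mulVec c = fgrX F (genRoot P i) •
      fun v => E (opWord b (genDel F P) (I (v⁻¹ * w₀)) u') := by
    funext v
    have := LinearMap.congr_fun hc (opWord b (genDel F P) (I (v⁻¹ * w₀)) u')
    rw [LinearMap.sum_apply] at this
    change ∑ w, a v w * c w = fgrX F (genRoot P i) * E _
    refine Eq.trans ?_ this
    refine Finset.sum_congr rfl fun w _ => ?_
    change opWord b (genDel F P) (I w ++ I (v⁻¹ * w₀)) u' * c w =
      c w * opWord b (genDel F P) (I w) _
    rw [opWord_append, mul_comm]
    rfl
  -- Cramer's rule: the adjugate isolates each coefficient up to the determinant.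
  have h2 : a.det • c = fgrX F (genRoot P i) •
      a.adjugate.mulVec fun v => E (opWord b (genDel F P) (I (v⁻¹ * w₀)) u') := by
    rw [← Matrix.mulVec_smul, ← h1, Matrix.mulVec_mulVec, Matrix.adjugate_mul, Matrix.smul_mulVec,
      Matrix.one_mulVec]
  have h3 : ∀ w, ∃ d, c w = fgrX F (genRoot P i) * d := fun w =>
    fgrX_dvd_of_dvd_mul F hf hdet ⟨_, congrFun h2 w⟩
  choose d hd using h3
  rw [Submodule.mem_span_range_iff_exists_fun]
  refine ⟨d, LinearMap.ext fun v => ?_⟩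
  have h4 := LinearMap.congr_fun hc v
  refine sub_eq_zero.1 ((mem_nonZeroDivisors_iff.1 (fgrX_mem_nonZeroDivisors F hf)).1 _ ?_)
  rw [mul_sub, sub_eq_zero]
  change _ = fgrX F (genRoot P i) * E v at h4
  rw [← h4, LinearMap.sum_apply, LinearMap.sum_apply, Finset.mul_sum]
  refine Finset.sum_congr rfl fun w _ => ?_
  rw [hd w]
  change _ * (d w * _) = (_ * d w) * _
  rw [mul_assoc]

include hI in
-- The relation holds over M ⊕ Q, where the x of each lifted root is regular. Evaluated on elements
-- coming from M and projected back, it becomes the relation over M, since divided differences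
-- commute with the projection.
lemma rootDel_mul_delWord_mem_span (h : IsTorsionElement F b w₀ t u) (ht : t ∈ R⁰) (j : ι)
    (w : P.weylGroup) : rootDel F P j * delWord F b (I w) ∈
      Submodule.span (FormalGroupRing F M) (Set.range fun w => delWord F b (I w)) := by
  have := finite_weylGroup b
  have := Fintype.ofFinite P.weylGroup
  have h1 := mul_opWord_mem_span b hI (ρ := genRep F P) (x := fun i => fgrX F (genRoot P i))
    (D := genDel F P) (fun w i => (fgrMap_fgrX F _ _).trans (by rw [genAct_genRoot]))
    (fun i v => genDel_mul i v) (mem_span_of_fgrX_smul_mem hI h ht) j w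
  obtain ⟨c, hc⟩ := (Submodule.mem_span_range_iff_exists_fun _).1 h1
  rw [Submodule.mem_span_range_iff_exists_fun]
  refine ⟨fun v => fgrMap F (AddMonoidHom.fst M (P.rootSpan ℤ)) (c v), LinearMap.ext fun v => ?_⟩
  have h2 := congrArg (fgrMap F (AddMonoidHom.fst M (P.rootSpan ℤ)))
    (LinearMap.congr_fun hc (fgrMap F (AddMonoidHom.inl M (P.rootSpan ℤ)) v))
  rw [LinearMap.sum_apply, map_sum] at h2
  rw [LinearMap.sum_apply]
  refine (Finset.sum_congr rfl fun w _ => ?_).trans (h2.trans ?_)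
  · change fgrMap F _ (c w) * _ = fgrMap F _ (c w * _)
    rw [map_mul, fgrMap_fst_opWord, fgrMap_fst_inl]
  · change fgrMap F _ (demazure F _ _ _) = demazure F _ _ (delWord F b (I w) v)
    rw [fgrMap_demazure F (P.coroot' j) (P.root j) (AddMonoidHom.fst M (P.rootSpan ℤ)) rfl
      (fun _ => rfl), fgrMap_fst_opWord, fgrMap_fst_inl]

omit [Finite ι] [P.IsReduced] in
lemma rootDel_mul_smul (j : ι) (a : FormalGroupRing F M) (E : Module.End R (FormalGroupRing F M)) :
    rootDel F P j * (a • E) = weylMap F (RootPairing.weylGroup.ofIdx P j) a • (rootDel F P j * E) +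
      rootDel F P j a • E := by
  rw [smul_eq_lmul_mul, ← mul_assoc, rootDel_mul_lmul, add_mul, mul_assoc]
  rfl

include hI in
/-- The operators along reduced words span the algebra of operators. -/
lemma opAlgebra_le_span (h : IsTorsionElement F b w₀ t u) (ht : t ∈ R⁰)
    {D : Module.End R (FormalGroupRing F M)} (hD : D ∈ opAlgebra F P) :
    D ∈ Submodule.span (FormalGroupRing F M) (Set.range fun w => delWord F b (I w)) := by
  -- The span contains the identity, as the operator of the empty word, so stability under left
  -- multiplication suffices.
  suffices key : ∀ E ∈ Submodule.span (FormalGroupRing F M) (Set.range fun w => delWord F b (I w)),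
      D * E ∈ Submodule.span (FormalGroupRing F M) (Set.range fun w => delWord F b (I w)) by
    have h1 : (1 : Module.End R (FormalGroupRing F M)) ∈
        Submodule.span (FormalGroupRing F M) (Set.range fun w => delWord F b (I w)) := by
      refine Submodule.subset_span ⟨1, ?_⟩
      have : I 1 = [] := List.length_eq_zero_iff.1 ((hI 1).2.trans weylLength_one)
      change delWord F b (I 1) = 1
      rw [this, delWord_nil]
    have := key 1 h1
    rwa [mul_one] at this
  induction hD using Algebra.adjoin_induction with
  | mem D hD =>
    intro E hE
    rcases hD with ⟨j, rfl⟩ | ⟨a, rfl⟩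
    · induction hE using Submodule.span_induction with
      | mem E hE =>
        obtain ⟨w, rfl⟩ := hE
        exact rootDel_mul_delWord_mem_span hI h ht j w
      | zero => rw [mul_zero]; exact zero_mem _
      | add E E' _ _ h1 h2 => rw [mul_add]; exact add_mem h1 h2
      | smul a E hE h1 =>
        rw [rootDel_mul_smul]
        exact add_mem (Submodule.smul_mem _ _ h1) (Submodule.smul_mem _ _ hE)
    · exact Submodule.smul_mem _ a hE
  | algebraMap r =>
    intro E hE
    rw [← AlgHom.commutes (Algebra.lmul R (FormalGroupRing F M))]
    exact Submodule.smul_mem _ (algebraMap R _ r) hE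
  | add D D' _ _ h1 h2 => intro E hE; rw [add_mul]; exact add_mem (h1 E hE) (h2 E hE)
  | mul D D' _ _ h1 h2 => intro E hE; rw [mul_assoc]; exact h1 _ (h2 E hE)

end Spanning

end

end FormalDemazure

namespace FormalDemazure

noncomputable section

/-! ### Families of operators with the same leading terms as the divided differences -/

section Leading

variable {R : Type*} [CommRing R] (F : FormalGroup R) {M : Type*} [AddCommGroup M]
  {ι N : Type*} [AddCommGroup N] (P : RootPairing ι ℤ M N)

/-- The operators `E i` agree with `s Δ_i`, where `s * s = 1`, up to operators of order `0`. -/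
structure IsLeading (s : R) (E : ι → Module.End R (FormalGroupRing F M)) : Prop where
  sq : s * s = 1
  mem : ∀ i, E i ∈ opAlgebra F P
  sub_mem : ∀ i, E i - s • rootDel F P i ∈ opOrder F M 0

lemma isLeading_rootDel : IsLeading F P 1 (rootDel F P) where
  sq := mul_one 1
  mem := rootDel_mem F P
  sub_mem i := by rw [one_smul, sub_self]; exact zero_mem _

lemma isLeading_rootC : IsLeading F P (-1) (rootC F P) where
  sq := by rw [neg_mul_neg, mul_one]
  mem := rootC_mem F P
  sub_mem i := by
    have : rootC F P i - (-1 : R) • rootDel F P i = Algebra.lmul R _ (eElt F (P.root i)) := by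
      refine LinearMap.ext fun v => ?_
      change eElt F (P.root i) * v - demazure F _ _ v - (-1 : R) • demazure F _ _ v = _ * v
      rw [neg_smul, one_smul, sub_neg_eq_add, sub_add_cancel]
    rw [this]
    exact lmul_mem_opOrder_zero _

variable {F P} (b : P.Base) {s : R} {E : ι → Module.End R (FormalGroupRing F M)}

lemma IsLeading.opWord_mem (hE : IsLeading F P s E) (L : List b.support) :
    opWord b E L ∈ opAlgebra F P :=
  list_prod_mem fun D hD => by
    obtain ⟨i, -, rfl⟩ := List.mem_map.1 hD
    exact hE.mem i

lemma IsLeading.pow_mul_pow (hE : IsLeading F P s E) (n : ℕ) : s ^ n * s ^ n = 1 := by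
  rw [← mul_pow, hE.sq, one_pow]

variable [F.IsComm] [Module.Free ℤ M] [Module.Finite ℤ M]

lemma IsLeading.opWord_sub_mem (hE : IsLeading F P s E) (L : List b.support) :
    opWord b E L - s ^ L.length • delWord F b L ∈ opOrder F M (L.length - 1) := by
  induction L with
  | nil => rw [opWord_nil, delWord_nil, List.length_nil, pow_zero, one_smul, sub_self]
           exact zero_mem _
  | cons i L ih =>
    have h0 := (opOrder F M L.length).smul_mem (s ^ L.length) (delWord_mem_opOrder F b L)
    have h1 := add_mem (opOrder_mono F (by omega) ih) h0
    rw [sub_add_cancel] at h1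
    have h2 := mul_mem_opOrder_of_le (l := ((i :: L).length : ℤ) - 1) (hE.sub_mem i) h1
      (by rw [List.length_cons]; push_cast; omega)
    have h3 := mul_mem_opOrder_of_le (l := ((i :: L).length : ℤ) - 1)
      ((opOrder F M 1).smul_mem s (rootDel_mem_opOrder F P (i : ι))) ih
      (by rw [List.length_cons]; push_cast; omega)
    have h4 := add_mem h2 h3
    convert h4 using 1
    rw [opWord_cons, delWord_cons, List.length_cons, sub_mul, mul_sub, sub_add_sub_cancel,
      smul_mul_smul_comm, pow_succ']

lemma IsLeading.opWord_mem_opOrder (hE : IsLeading F P s E) (L : List b.support) :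
    opWord b E L ∈ opOrder F M L.length := by
  have h := add_mem (opOrder_mono F (by omega) (hE.opWord_sub_mem b L))
    ((opOrder F M L.length).smul_mem (s ^ L.length) (delWord_mem_opOrder F b L))
  rwa [sub_add_cancel] at h

variable [Finite ι] [P.IsReduced] {b} {w₀ : P.weylGroup}

lemma delWord_mem_of_ne (hw₀ : IsLongest b w₀) {L : List b.support}
    (hL : L.length ≤ weylLength b w₀) (hw : wordProd b L ≠ w₀) :
    delWord F b L ∈ opOrder F M (weylLength b w₀ - 1) := by
  rcases hL.lt_or_eq with hlt | heq
  · exact opOrder_mono F (by omega) (delWord_mem_opOrder F b L)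
  · rw [← heq]
    exact delWord_mem_of_not_isReducedWord F fun hr =>
      hw (hw₀.eq_of_weylLength_eq (by rw [← hr, heq]))

lemma IsLeading.opWord_mem_of_ne (hE : IsLeading F P s E) (hw₀ : IsLongest b w₀)
    {L : List b.support} (hL : L.length ≤ weylLength b w₀) (hw : wordProd b L ≠ w₀) :
    opWord b E L ∈ opOrder F M (weylLength b w₀ - 1) := by
  have h := add_mem (opOrder_mono F (by omega) (hE.opWord_sub_mem b L))
    ((opOrder F M (weylLength b w₀ - 1)).smul_mem (s ^ L.length) (delWord_mem_of_ne hw₀ hL hw))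
  rwa [sub_add_cancel] at h

lemma IsLeading.opWord_sub_mem_of_reduced (hE : IsLeading F P s E) {w : P.weylGroup}
    {K L : List b.support} (hL : IsReducedDecomp b L w) (hK : IsReducedDecomp b K w) :
    opWord b E L - s ^ weylLength b w • delWord F b K ∈ opOrder F M (weylLength b w - 1) := by
  have h1 := hE.opWord_sub_mem b L
  rw [hL.2] at h1
  have h := add_mem h1 ((opOrder F M (weylLength b w - 1)).smul_mem (s ^ weylLength b w)
    (delWord_sub_delWord_mem F hL hK))
  rwa [smul_sub, sub_add_sub_cancel] at h

variable {t : R} {u : FormalGroupRing F M} {I : P.weylGroup → List b.support}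
  (hI : ∀ w, IsReducedDecomp b (I w) w) [Fintype P.weylGroup]

include hI in
/-- The coefficients of an operator of order `k` at the operators of length more than `k` are
zero. -/
lemma IsLeading.coeff_eq_zero (hE : IsLeading F P s E) (h : IsTorsionElement F b w₀ t u)
    (ht : t ∈ R⁰) {k : ℤ} {D : Module.End R (FormalGroupRing F M)} (hD : D ∈ opOrder F M k)
    {r : P.weylGroup → R}
    (hr : augComp F M D = ∑ w, r w • augComp F M (opWord b E (I w))) {w : P.weylGroup}
    (hw : k < weylLength b w) : r w = 0 := by
  -- Passing from E to Δ changes the composite by an operator of order at most l(w) - 1 + N - l(v) <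
  -- N, invisible to ε on I^N.
  have key : ∀ v w, weylLength b w ≤ weylLength b v →
      fgrAug F M ((opWord b E (I w) * delWord F b (I (v⁻¹ * w₀))) u) =
        s ^ weylLength b w * fgrAug F M (delWord F b (I w ++ I (v⁻¹ * w₀)) u) := by
    intro v w hl
    have h1 := hE.opWord_sub_mem_of_reduced (hI w) (hI w)
    have h2 := mul_mem_opOrder h1 (delWord_mem_opOrder F b (I (v⁻¹ * w₀)))
    have h3 := fgrAug_eq_zero_of_mem_opOrder (n := weylLength b w₀) (by
      rw [(hI _).2, ← h.isLongest.weylLength_inv_mul v]; push_cast; omega) h2 h.mem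
    rw [sub_mul, smul_mul_assoc, ← delWord_append, LinearMap.sub_apply, map_sub,
      LinearMap.smul_apply, map_smul, sub_eq_zero] at h3
    exact h3
  refine eq_zero_of_triangular (weylLength b) (fun v w =>
    fgrAug F M ((opWord b E (I w) * delWord F b (I (v⁻¹ * w₀))) u)) (fun w => ?_)
    (fun v w hl hne => ?_) (k + 1).toNat r (fun v hv => ?_) (w := w) (by omega)
  · simp only [key w w le_rfl, h.fgrAug_pairing_self hI]
    exact mul_mem (IsUnit.mem_nonZeroDivisors (IsUnit.of_mul_eq_one _ (hE.pow_mul_pow _))) ht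
  · simp only [key v w hl, h.fgrAug_pairing_ne hI hl hne, mul_zero]
  -- For l(v) > k the composite of D with Δ_{I_{v⁻¹w₀}} has order k + N - l(v) < N, so row v of the
  -- system is zero.
  · have h1 := LinearMap.congr_fun hr (delWord F b (I (v⁻¹ * w₀)) u)
    have h2 := fgrAug_eq_zero_of_mem_opOrder (n := weylLength b w₀) (by
      rw [(hI _).2, ← h.isLongest.weylLength_inv_mul v]; push_cast; omega)
      (mul_mem_opOrder hD (delWord_mem_opOrder F b (I (v⁻¹ * w₀)))) h.mem
    rw [LinearMap.sum_apply] at h1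
    exact h1.symm.trans h2

include hI in
lemma exists_augComp_eq_sum_delWord (h : IsTorsionElement F b w₀ t u) (ht : t ∈ R⁰)
    {D : Module.End R (FormalGroupRing F M)} (hD : D ∈ opAlgebra F P) :
    ∃ r : P.weylGroup → R, augComp F M D = ∑ w, r w • augComp F M (delWord F b (I w)) := by
  obtain ⟨c, hc⟩ := (Submodule.mem_span_range_iff_exists_fun _).1 (opAlgebra_le_span hI h ht hD)
  refine ⟨fun w => fgrAug F M (c w), LinearMap.ext fun v => ?_⟩
  rw [← hc, LinearMap.sum_apply]
  change fgrAug F M ((∑ w, c w • delWord F b (I w)) v) = _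
  rw [LinearMap.sum_apply, map_sum]
  exact Finset.sum_congr rfl fun w _ => map_mul (fgrAug F M) _ _

include hI in
-- A unitriangular change of basis: s^l(w) E_{I_w} differs from Δ_{I_w} by an operator of order less
-- than l(w), whose form involves only the ε Δ_{I_v} with v shorter than w.
lemma IsLeading.exists_augComp_eq_sum (hE : IsLeading F P s E) (h : IsTorsionElement F b w₀ t u)
    (ht : t ∈ R⁰) {D : Module.End R (FormalGroupRing F M)} (hD : D ∈ opAlgebra F P) :
    ∃ r : P.weylGroup → R, augComp F M D = ∑ w, r w • augComp F M (opWord b E (I w)) := by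
  have key : ∀ w, augComp F M (delWord F b (I w)) ∈
      Submodule.span R (Set.range fun w => augComp F M (opWord b E (I w))) := by
    intro w
    induction hn : weylLength b w using Nat.strong_induction_on generalizing w with
    | _ n ih =>
      have h1 := (opOrder F M (weylLength b w - 1)).smul_mem (s ^ weylLength b w)
        (hE.opWord_sub_mem_of_reduced (hI w) (hI w))
      have h2 : s ^ weylLength b w • (opWord b E (I w) - s ^ weylLength b w • delWord F b (I w)) ∈
          opAlgebra F P :=
        Subalgebra.smul_mem _ (_root_.sub_mem (hE.opWord_mem b _)
          (Subalgebra.smul_mem _ (delWord_mem F P b _) _)) _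
      obtain ⟨r, hr⟩ := exists_augComp_eq_sum_delWord hI h ht h2
      have h3 : augComp F M (delWord F b (I w)) =
          s ^ weylLength b w • augComp F M (opWord b E (I w)) -
          ∑ v, r v • augComp F M (delWord F b (I v)) := by
        rw [← hr, smul_sub, smul_smul, hE.pow_mul_pow, one_smul, map_sub, map_smul, sub_sub_cancel]
      rw [h3]
      refine _root_.sub_mem (Submodule.smul_mem _ _ (Submodule.subset_span ⟨w, rfl⟩))
        (sum_mem fun v _ => ?_)
      by_cases hv : weylLength b v < weylLength b w
      · exact Submodule.smul_mem _ _ (ih _ (by omega) v rfl)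
      · rw [(isLeading_rootDel F P).coeff_eq_zero hI h ht h1 hr (w := v) (by omega), zero_smul]
        exact zero_mem _
  obtain ⟨r, hr⟩ := exists_augComp_eq_sum_delWord hI h ht hD
  have h1 : augComp F M D ∈
      Submodule.span R (Set.range fun w => augComp F M (opWord b E (I w))) := by
    rw [hr]; exact sum_mem fun w _ => Submodule.smul_mem _ _ (key w)
  obtain ⟨c, hc⟩ := (Submodule.mem_span_range_iff_exists_fun _).1 h1
  exact ⟨c, hc.symm⟩

include hI in
lemma IsLeading.linearIndependent (hE : IsLeading F P s E) (h : IsTorsionElement F b w₀ t u)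
    (ht : t ∈ R⁰) : LinearIndependent R fun w => augComp F M (opWord b E (I w)) := by
  refine Fintype.linearIndependent_iff.2 fun r hr w => ?_
  refine hE.coeff_eq_zero hI h ht (k := -1) (D := 0) (zero_mem _) (r := r) ?_ (by omega)
  rw [map_zero, hr]

include hI in
lemma IsLeading.span_eq (hE : IsLeading F P s E) (h : IsTorsionElement F b w₀ t u)
    (ht : t ∈ R⁰) :
    Submodule.span R (Set.range fun w => augComp F M (opWord b E (I w))) = augOp F P := by
  refine le_antisymm (Submodule.span_le.2 ?_) ?_
  · rintro _ ⟨w, rfl⟩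
    exact ⟨_, hE.opWord_mem b _, rfl⟩
  · rintro _ ⟨D, hD, rfl⟩
    obtain ⟨r, hr⟩ := hE.exists_augComp_eq_sum hI h ht hD
    rw [hr]
    exact sum_mem fun w _ => Submodule.smul_mem _ _ (Submodule.subset_span ⟨w, rfl⟩)

/-- The linear forms `ε E_{I_w}` form a basis of `ε 𝒟(M)_F`. -/
def IsLeading.basis (hE : IsLeading F P s E) (h : IsTorsionElement F b w₀ t u) (ht : t ∈ R⁰)
    (hI : ∀ w, IsReducedDecomp b (I w) w) : Module.Basis P.weylGroup R (augOp F P) :=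
  (Module.Basis.span (hE.linearIndependent hI h ht)).map
    (LinearEquiv.ofEq _ _ (hE.span_eq hI h ht))

lemma IsLeading.basis_apply (hE : IsLeading F P s E) (h : IsTorsionElement F b w₀ t u)
    (ht : t ∈ R⁰) (hI : ∀ w, IsReducedDecomp b (I w) w) (w : P.weylGroup) :
    hE.basis h ht hI w = augOpMk F P (opWord b E (I w)) (hE.opWord_mem b _) := by
  refine Subtype.ext ?_
  rw [IsLeading.basis, Module.Basis.map_apply, LinearEquiv.coe_ofEq_apply,
    Module.Basis.span_apply]
  rfl

omit [Finite ι] [P.IsReduced] [Fintype P.weylGroup] in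
lemma mem_opOrder_of_mem_opFil {j : ℤ} {D : Module.End R (FormalGroupRing F M)}
    (hD : D ∈ opFil F P j) : D ∈ opAlgebra F P ∧ D ∈ opOrder F M (-j) := by
  induction hD using Submodule.span_induction with
  | mem D hD =>
    obtain ⟨m, l, v, hj, hv, rfl⟩ := hD
    have h1 : (l.map (rootDel F P)).prod ∈ opAlgebra F P ∧
        (l.map (rootDel F P)).prod ∈ opOrder F M l.length := by
      clear hj
      induction l with
      | nil => exact ⟨one_mem _, one_mem_opOrder⟩
      | cons i l ih =>
        rw [List.map_cons, List.prod_cons]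
        exact ⟨mul_mem (rootDel_mem F P i) ih.1, mul_mem_opOrder_of_le
          (rootDel_mem_opOrder F P i) ih.2 (by rw [List.length_cons]; push_cast; omega)⟩
    exact ⟨mul_mem (lmul_mem F P v) h1.1,
      mul_mem_opOrder_of_le (lmul_mem_opOrder hv) h1.2 (by omega)⟩
  | zero => exact ⟨zero_mem _, zero_mem _⟩
  | add D D' _ _ h1 h2 => exact ⟨add_mem h1.1 h2.1, add_mem h1.2 h2.2⟩
  | smul a D _ h1 => exact ⟨mul_mem (lmul_mem F P a) h1.1, smul_mem_opOrder a h1.2⟩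

end Leading

end

end FormalDemazure

namespace FormalDemazure

noncomputable section

/-! ### The dual of the operators -/

section DualBasis

variable {R : Type*} [CommRing R] {F : FormalGroup R} {M : Type*} [AddCommGroup M]
  {ι N : Type*} [AddCommGroup N] {P : RootPairing ι ℤ M N} (b : P.Base)

lemma delWord_eq_prod_map (L : List b.support) :
    delWord F b L = ((L.map Subtype.val).map (rootDel F P)).prod := by
  induction L with
  | nil => rfl
  | cons i L ih => rw [List.map_cons, List.map_cons, List.prod_cons, ← ih]; simp [delWord]

/-- The composition along a word of the duals of the right multiplications by the `E i`. -/
def dualWord (E : ι → Module.End R (FormalGroupRing F M)) (hE : ∀ i, E i ∈ opAlgebra F P)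
    (L : List b.support) : Module.End R (HMF F P) :=
  (L.map fun i => (mulRight F P (E i) (hE i)).dualMap).prod

/-- Dualizing reverses composition and so does right multiplication, so the word is read in its
original order. -/
lemma dualWord_apply {E : ι → Module.End R (FormalGroupRing F M)} (hE : ∀ i, E i ∈ opAlgebra F P)
    (L : List b.support) (f : HMF F P) {D D' : Module.End R (FormalGroupRing F M)}
    (hD : D ∈ opAlgebra F P) (hD' : D' ∈ opAlgebra F P) (h : D' = D * opWord b E L) :
    dualWord b E hE L f (augOpMk F P D hD) = f (augOpMk F P D' hD') := by
  induction L generalizing D with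
  | nil =>
    rw [opWord_nil, mul_one] at h
    subst h
    rfl
  | cons i L ih =>
    rw [opWord_cons, ← mul_assoc] at h
    exact ih (mul_mem hD (hE i)) h

/-- The form `z` vanishes on the operators of order less than the length of `w₀`, and is
invertible at the divided difference operators of the reduced decompositions of `w₀`. -/
structure IsTopForm (w₀ : P.weylGroup) (z : HMF F P) : Prop where
  apply_eq_zero : ∀ D hD, D ∈ opOrder F M (weylLength b w₀ - 1) → z (augOpMk F P D hD) = 0
  isUnit : ∀ K, IsReducedDecomp b K w₀ →
    IsUnit (z (augOpMk F P (delWord F b K) (delWord_mem F P b K)))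

variable {b} {w₀ : P.weylGroup} {z : HMF F P}

lemma apply_augOpMk_eq_mul {D D' : Module.End R (FormalGroupRing F M)}
    (hD : D ∈ opAlgebra F P) (hD' : D' ∈ opAlgebra F P) {c : R}
    (h : z (augOpMk F P (D - c • D') (sub_mem hD (Subalgebra.smul_mem _ hD' c))) = 0) :
    z (augOpMk F P D hD) = c * z (augOpMk F P D' hD') := by
  have h2 : augOpMk F P D hD = augOpMk F P (D - c • D')
      (sub_mem hD (Subalgebra.smul_mem _ hD' c)) + c • augOpMk F P D' hD' :=
    Subtype.ext (by
      change augComp F M _ = augComp F M _ + c • augComp F M _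
      rw [← map_smul, ← map_add, sub_add_cancel])
  rw [h2, map_add, map_smul, h, zero_add, smul_eq_mul]

lemma IsTopForm.congr (hz : IsTopForm b w₀ z) {D D' : Module.End R (FormalGroupRing F M)}
    (hD : D ∈ opAlgebra F P) (hD' : D' ∈ opAlgebra F P) {c : R}
    (h : D - c • D' ∈ opOrder F M (weylLength b w₀ - 1)) :
    z (augOpMk F P D hD) = c * z (augOpMk F P D' hD') :=
  apply_augOpMk_eq_mul hD hD' (hz.apply_eq_zero _ _ h)

variable [F.IsComm] [Module.Free ℤ M] [Module.Finite ℤ M] [Finite ι] [P.IsReduced]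
  {s : R} {E : ι → Module.End R (FormalGroupRing F M)} (hE : IsLeading F P s E)

include hE in
lemma IsTopForm.isUnit_opWord (hz : IsTopForm b w₀ z) {L : List b.support}
    (hL : IsReducedDecomp b L w₀) :
    IsUnit (z (augOpMk F P (opWord b E L) (hE.opWord_mem b L))) := by
  rw [hz.congr (hE.opWord_mem b L) (delWord_mem F P b L) (hE.opWord_sub_mem_of_reduced hL hL)]
  exact (IsUnit.of_mul_eq_one _ (hE.pow_mul_pow _)).mul (hz.isUnit L hL)

variable {I : P.weylGroup → List b.support} (hI : ∀ w, IsReducedDecomp b (I w) w)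

include hI in
lemma IsTopForm.dualWord_self (hw₀ : IsLongest b w₀) (hz : IsTopForm b w₀ z) (w : P.weylGroup) :
    IsUnit (dualWord b E hE.mem (I w) z
      (augOpMk F P (opWord b E (I (w₀ * w⁻¹))) (hE.opWord_mem b _))) := by
  rw [dualWord_apply b hE.mem (I w) z _ (hE.opWord_mem b (I (w₀ * w⁻¹) ++ I w))
    (opWord_append b E _ _)]
  refine hz.isUnit_opWord hE ⟨?_, ?_⟩
  · rw [wordProd_append, (hI _).1, (hI _).1, inv_mul_cancel_right]
  · rw [List.length_append, (hI _).2, (hI _).2, hw₀.weylLength_mul_inv]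

include hI in
-- The value is that of z on the concatenated word, of length at most N and product different from
-- w₀, hence of order less than N.
lemma IsTopForm.dualWord_eq_zero (hw₀ : IsLongest b w₀) (hz : IsTopForm b w₀ z)
    {v w : P.weylGroup} (hl : weylLength b v + weylLength b w ≤ weylLength b w₀)
    (hne : v * w ≠ w₀) : dualWord b E hE.mem (I w) z
      (augOpMk F P (opWord b E (I v)) (hE.opWord_mem b _)) = 0 := by
  rw [dualWord_apply b hE.mem (I w) z _ (hE.opWord_mem b (I v ++ I w)) (opWord_append b E _ _)]
  refine hz.apply_eq_zero _ _ (hE.opWord_mem_of_ne hw₀ ?_ ?_)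
  · rwa [List.length_append, (hI _).2, (hI _).2]
  · rwa [wordProd_append, (hI _).1, (hI _).1]

variable {t : R} {u : FormalGroupRing F M} [Fintype P.weylGroup]

include hI in
-- Vanishing on a filtration piece reduces to finitely many basis forms, because an operator of
-- order less than i involves only words of length less than i.
lemma IsLeading.mem_hFil_iff (h : IsTorsionElement F b w₀ t u) (ht : t ∈ R⁰) {i : ℤ}
    {f : HMF F P} : f ∈ hFil F P i ↔ ∀ w, (weylLength b w : ℤ) < i →
      f (augOpMk F P (opWord b E (I w)) (hE.opWord_mem b _)) = 0 := by
  -- Stated for any leading family: one direction expands in Δ, whose words visibly lie in the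
  -- filtration piece, the other in E.
  have hfil : ∀ {D : Module.End R (FormalGroupRing F M)} (hD : D ∈ opAlgebra F P)
      (hD' : D ∈ opOrder F M (i - 1)) {s : R} {E : ι → Module.End R (FormalGroupRing F M)}
      (hE : IsLeading F P s E) {f : HMF F P}, (∀ w, (weylLength b w : ℤ) < i →
        f (augOpMk F P (opWord b E (I w)) (hE.opWord_mem b _)) = 0) →
        f (augOpMk F P D hD) = 0 := by
    intro D hD hD' s E hE f hf
    obtain ⟨r, hr⟩ := hE.exists_augComp_eq_sum hI h ht hD
    have h1 : augOpMk F P D hD =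
        ∑ w, r w • augOpMk F P (opWord b E (I w)) (hE.opWord_mem b _) := by
      refine Subtype.ext ?_
      rw [AddSubmonoidClass.coe_finsetSum]
      exact hr
    rw [h1, map_sum]
    refine Finset.sum_eq_zero fun w _ => ?_
    rw [map_smul]
    by_cases hw : (weylLength b w : ℤ) < i
    · rw [hf w hw, smul_zero]
    · rw [hE.coeff_eq_zero hI h ht hD' hr (w := w) (by omega), zero_smul]
  constructor
  · intro hf w hw
    refine hfil (hE.opWord_mem b _) (opOrder_mono F (by rw [(hI w).2]; omega)
      (hE.opWord_mem_opOrder b (I w))) (isLeading_rootDel F P) fun v hv => ?_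
    refine hf _ ⟨delWord F b (I v), Submodule.subset_span
      ⟨0, (I v).map Subtype.val, 1, ?_, ?_, ?_⟩, rfl⟩
    · rw [List.length_map, (hI v).2]; omega
    · rw [Int.toNat_zero, pow_zero, Ideal.one_eq_top]; trivial
    · rw [one_smul, delWord_eq_prod_map]
  · rintro hf ⟨_, hg⟩ ⟨D, hD, rfl⟩
    obtain ⟨h1, h2⟩ := mem_opOrder_of_mem_opFil hD
    exact hfil h1 (opOrder_mono F (by omega) h2) hE hf

include hI in
/-- If a combination of the forms obtained from `z` vanishes on the operators of order less than
`i`, its coefficients in lengths greater than `N - i` are zero. -/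
lemma IsTopForm.coeff_eq_zero (hw₀ : IsLongest b w₀) (hz : IsTopForm b w₀ z) {i : ℤ}
    {r : P.weylGroup → R}
    (hr : ∀ v, (weylLength b v : ℤ) < i → (∑ w, r w • dualWord b E hE.mem (I w) z)
      (augOpMk F P (opWord b E (I v)) (hE.opWord_mem b _)) = 0) {w : P.weylGroup}
    (hw : weylLength b w₀ - i < weylLength b w) : r w = 0 := by
  -- Rows are indexed through v ↦ w₀ v⁻¹, which exchanges lengths l and N - l: the hypothesis in
  -- lengths less than i concerns the rows with l(v) > N - i.
  refine eq_zero_of_triangular (weylLength b) (fun v w => dualWord b E hE.mem (I w) z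
    (augOpMk F P (opWord b E (I (w₀ * v⁻¹))) (hE.opWord_mem b _)))
    (fun w => (hz.dualWord_self hE hI hw₀ w).mem_nonZeroDivisors) (fun v w hl hne => ?_)
    (weylLength b w₀ - i + 1).toNat r (fun v hv => ?_) (w := w) (by omega)
  · have := hw₀.weylLength_mul_inv v
    refine hz.dualWord_eq_zero hE hI hw₀ (by omega) fun h => hne ?_
    rwa [mul_assoc, mul_eq_left, inv_mul_eq_one, eq_comm] at h
  · have := hw₀.weylLength_mul_inv v
    have h1 := hr (w₀ * v⁻¹) (by omega)
    rw [LinearMap.sum_apply] at h1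
    exact h1

include hI in
lemma IsTopForm.exists_eq_sum (h : IsTorsionElement F b w₀ t u) (ht : t ∈ R⁰)
    (hz : IsTopForm b w₀ z) (f : HMF F P) :
    ∃ r : P.weylGroup → R, f = ∑ w, r w • dualWord b E hE.mem (I w) z := by
  classical
  have hw₀ := h.isLongest
  let a : Matrix P.weylGroup P.weylGroup R := fun v w => dualWord b E hE.mem (I w) z
    (augOpMk F P (opWord b E (I (w₀ * v⁻¹))) (hE.opWord_mem b _))
  have hdet : IsUnit a.det := by
    refine det_mem_of_triangular (weylLength b) a (IsUnit.submonoid R)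
      (fun w => hz.dualWord_self hE hI hw₀ w) fun v w hl hne => ?_
    have := hw₀.weylLength_mul_inv v
    refine hz.dualWord_eq_zero hE hI hw₀ (by omega) fun h => hne ?_
    rwa [mul_assoc, mul_eq_left, inv_mul_eq_one, eq_comm] at h
  let c : P.weylGroup → R := fun v =>
    f (augOpMk F P (opWord b E (I (w₀ * v⁻¹))) (hE.opWord_mem b _))
  refine ⟨a⁻¹.mulVec c, (hE.basis h ht hI).ext fun w => ?_⟩
  have h1 : a.mulVec (a⁻¹.mulVec c) = c := by
    rw [Matrix.mulVec_mulVec, Matrix.mul_nonsing_inv a hdet, Matrix.one_mulVec]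
  obtain ⟨v, rfl⟩ : ∃ v, w = w₀ * v⁻¹ :=
    ⟨w⁻¹ * w₀, by rw [mul_inv_rev, inv_inv, mul_inv_cancel_left]⟩
  have h2 := congrFun h1 v
  rw [hE.basis_apply h ht hI, LinearMap.sum_apply]
  refine h2.symm.trans (Finset.sum_congr rfl fun w _ => mul_comm _ _)

include hI in
lemma IsTopForm.linearIndependent (hw₀ : IsLongest b w₀) (hz : IsTopForm b w₀ z) :
    LinearIndependent R fun w => dualWord b E hE.mem (I w) z := by
  refine Fintype.linearIndependent_iff.2 fun r hr w => ?_
  -- With i = N + 1 the length condition on w reads l(w) > -1.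
  refine hz.coeff_eq_zero hE hI hw₀ (i := weylLength b w₀ + 1) (r := r) (fun v _ => ?_) (by omega)
  rw [hr, LinearMap.zero_apply]

include hI in
lemma IsTopForm.span_eq_top (h : IsTorsionElement F b w₀ t u) (ht : t ∈ R⁰)
    (hz : IsTopForm b w₀ z) :
    Submodule.span R (Set.range fun w => dualWord b E hE.mem (I w) z) = ⊤ := by
  refine Submodule.eq_top_iff'.2 fun f => ?_
  obtain ⟨r, hr⟩ := hz.exists_eq_sum hE hI h ht f
  exact (Submodule.mem_span_range_iff_exists_fun _).2 ⟨r, hr.symm⟩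

include hI in
-- If l(w) ≤ N - i and l(v) < i, then l(v) + l(w) < N, so v w ≠ w₀ and the pairing vanishes.
-- Conversely, the triangular system kills the coefficients in lengths above N - i.
lemma IsTopForm.span_eq_hFil (h : IsTorsionElement F b w₀ t u) (ht : t ∈ R⁰)
    (hz : IsTopForm b w₀ z) (i : ℤ) :
    Submodule.span R (Set.range
      fun w : {w : P.weylGroup // (weylLength b w : ℤ) ≤ weylLength b w₀ - i} =>
        dualWord b E hE.mem (I w) z) = hFil F P i := by
  have hw₀ := h.isLongest
  refine le_antisymm (Submodule.span_le.2 ?_) fun f hf => ?_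
  · rintro _ ⟨⟨w, hw⟩, rfl⟩
    refine (hE.mem_hFil_iff hI h ht).2 fun v hv => ?_
    refine hz.dualWord_eq_zero hE hI hw₀ (w := w) (by omega) fun h' => ?_
    have := weylLength_mul_le (b := b) v w
    rw [h'] at this
    omega
  · obtain ⟨r, hr⟩ := hz.exists_eq_sum hE hI h ht f
    have h1 := (hE.mem_hFil_iff hI h ht).1 hf
    rw [hr] at h1 ⊢
    refine sum_mem fun w _ => ?_
    by_cases hw : (weylLength b w : ℤ) ≤ weylLength b w₀ - i
    · exact Submodule.smul_mem _ _ (Submodule.subset_span ⟨⟨w, hw⟩, rfl⟩)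
    · rw [hz.coeff_eq_zero hE hI hw₀ h1 (w := w) (by omega), zero_smul]
      exact zero_mem _

variable {J : P.weylGroup → List b.support} (hJ : ∀ w, IsReducedDecomp b (J w) w)

include hJ in
lemma exists_isCharBasis (h : IsTorsionElement F b w₀ t u) (ht : t ∈ R⁰) :
    ∃ z, IsCharBasis F b J z := by
  classical
  let B := (isLeading_rootC F P).basis h ht hJ
  refine ⟨B.dualBasis, B.dualBasis.linearIndependent, B.dualBasis.span_eq, fun v => ?_⟩
  rw [finsum_eq_sum_of_fintype]
  refine B.ext fun w => ?_
  rw [LinearMap.sum_apply, Finset.sum_eq_single w]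
  · rw [LinearMap.smul_apply, Module.Basis.dualBasis_apply_self, if_pos rfl, smul_eq_mul, mul_one]
    exact congrArg (charMap F P v) ((isLeading_rootC F P).basis_apply h ht hJ w)
  · intro w' _ hne
    rw [LinearMap.smul_apply, Module.Basis.dualBasis_apply_self, if_neg hne.symm, smul_zero]
  · exact fun h => (h (Finset.mem_univ w)).elim

include hJ in
-- The expansion of the characteristic map, evaluated at ε C_{J_v}, expresses this form through the
-- independent forms ε C_{J_w}; comparing coefficients shows that the chosen basis is the dual one.
lemma charBasis_apply (h : IsTorsionElement F b w₀ t u) (ht : t ∈ R⁰) [DecidableEq P.weylGroup]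
    (v w : P.weylGroup) :
    charBasis F b J w (augOpMk F P (cWord F b (J v)) (cWord_mem F P b _)) =
      if w = v then 1 else 0 := by
  have hex := exists_isCharBasis hJ h ht
  have hz : IsCharBasis F b J (charBasis F b J) := by
    rw [charBasis, dif_pos hex]; exact hex.choose_spec
  have hli := (isLeading_rootC F P).linearIndependent hJ h ht
  have h1 : ∑ w, charBasis F b J w (augOpMk F P (cWord F b (J v)) (cWord_mem F P b _)) •
        augComp F M (opWord b (rootC F P) (J w)) =
      ∑ w, (if w = v then 1 else 0 : R) • augComp F M (opWord b (rootC F P) (J w)) := by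
    rw [Finset.sum_eq_single_of_mem (f := fun w => (if w = v then 1 else 0 : R) •
      augComp F M (opWord b (rootC F P) (J w))) v (Finset.mem_univ v)
      fun w _ hw => by rw [if_neg hw, zero_smul], if_pos rfl, one_smul]
    refine LinearMap.ext fun y => ?_
    have h2 := LinearMap.congr_fun (hz.2.2 y) (augOpMk F P (cWord F b (J v)) (cWord_mem F P b _))
    rw [finsum_eq_sum_of_fintype, LinearMap.sum_apply] at h2
    rw [LinearMap.sum_apply]
    exact (Finset.sum_congr rfl fun w _ => mul_comm _ _).trans h2.symm
  exact Fintype.linearIndependent_iffₛ.1 hli _ _ h1 w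

include hJ in
-- An operator of order less than N has no component along C_{J_{w₀}}. Since C_{J_{w₀}} is (-1)^N
-- Δ_K modulo such operators, the value on Δ_K is a unit.
lemma isTopForm_charBasis (h : IsTorsionElement F b w₀ t u) (ht : t ∈ R⁰) :
    IsTopForm b w₀ (charBasis F b J w₀) := by
  classical
  have hz : ∀ D hD, D ∈ opOrder F M (weylLength b w₀ - 1) →
      charBasis F b J w₀ (augOpMk F P D hD) = 0 := by
    intro D hD hD'
    obtain ⟨r, hr⟩ := (isLeading_rootC F P).exists_augComp_eq_sum hJ h ht hD
    have h1 : augOpMk F P D hD =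
        ∑ w, r w • augOpMk F P (cWord F b (J w)) (cWord_mem F P b _) := by
      refine Subtype.ext ?_
      rw [AddSubmonoidClass.coe_finsetSum]
      exact hr
    rw [h1, map_sum]
    refine Finset.sum_eq_zero fun w _ => ?_
    rw [map_smul, charBasis_apply hJ h ht]
    by_cases hw : w₀ = w
    · rw [(isLeading_rootC F P).coeff_eq_zero hJ h ht hD' hr (w := w) (by rw [hw]; omega),
        zero_smul]
    · rw [if_neg hw, smul_zero]
  refine ⟨hz, fun K hK => ?_⟩
  have h1 := charBasis_apply hJ h ht w₀ w₀
  rw [if_pos rfl] at h1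
  have h2 := (isLeading_rootC F P).opWord_sub_mem_of_reduced (hJ w₀) hK
  rw [apply_augOpMk_eq_mul (cWord_mem F P b _) (delWord_mem F P b K) (hz _ _ h2)] at h1
  exact IsUnit.of_mul_eq_one ((-1) ^ weylLength b w₀) (by rw [mul_comm]; exact h1)

end DualBasis

end

end FormalDemazure
-- Bases of the dual and of its filtration
open FormalDemazure in
theorem mainTheorem6 {ι M N R : Type*} [Finite ι] [AddCommGroup M] [Module.Free ℤ M]
    [Module.Finite ℤ M] [AddCommGroup N] [CommRing R] (F : FormalGroup R) [F.IsComm]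
    (P : RootPairing ι ℤ M N) [P.IsReduced] (b : P.Base)
    (ht : (torsionIndex b : R) ∈ nonZeroDivisors R)
    (w₀ : P.weylGroup) (hw₀ : IsLongest b w₀)
    (J : P.weylGroup → List b.support) (hJ : ∀ w, IsReducedDecomp b (J w) w)
    (I : P.weylGroup → List b.support) (hI : ∀ w, IsReducedDecomp b (I w) w)
    (z₀ : HMF F P) (hz₀ : z₀ = charBasis F b J w₀) :
    (∀ i : ℤ,
      (LinearIndependent R
          (fun w : {w : P.weylGroup // (weylLength b w : ℤ) ≤ weylLength b w₀ - i} =>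
            wordA F b (I w) z₀) ∧
        Submodule.span R (Set.range
          (fun w : {w : P.weylGroup // (weylLength b w : ℤ) ≤ weylLength b w₀ - i} =>
            wordA F b (I w) z₀)) = hFil F P i) ∧
      (LinearIndependent R
          (fun w : {w : P.weylGroup // (weylLength b w : ℤ) ≤ weylLength b w₀ - i} =>
            wordB F b (I w) z₀) ∧
        Submodule.span R (Set.range
          (fun w : {w : P.weylGroup // (weylLength b w : ℤ) ≤ weylLength b w₀ - i} =>
            wordB F b (I w) z₀)) = hFil F P i)) ∧
    (LinearIndependent R (fun w => wordA F b (I w) z₀) ∧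
      Submodule.span R (Set.range fun w => wordA F b (I w) z₀) = ⊤) ∧
    (LinearIndependent R (fun w => wordB F b (I w) z₀) ∧
      Submodule.span R (Set.range fun w => wordB F b (I w) z₀) = ⊤) := by
  have := finite_weylGroup b
  have := Fintype.ofFinite P.weylGroup
  obtain ⟨u, hu, htor⟩ := exists_fgrAug_delWord_eq_torsionIndex (F := F) b hw₀
  have h : IsTorsionElement F b w₀ (torsionIndex b : R) u := ⟨hw₀, hu, htor⟩
  have hz : IsTopForm b w₀ z₀ := hz₀ ▸ isTopForm_charBasis hJ h ht
  -- By definition `wordA` and `wordB` are the dual words of the two leading families, with sign -1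
  -- for C and 1 for Δ.
  have hA := hz.linearIndependent (isLeading_rootC F P) hI hw₀
  have hB := hz.linearIndependent (isLeading_rootDel F P) hI hw₀
  exact ⟨fun i =>
    ⟨⟨hA.comp _ Subtype.val_injective, hz.span_eq_hFil (isLeading_rootC F P) hI h ht i⟩,
      ⟨hB.comp _ Subtype.val_injective, hz.span_eq_hFil (isLeading_rootDel F P) hI h ht i⟩⟩,
    ⟨hA, hz.span_eq_top (isLeading_rootC F P) hI h ht⟩,
    ⟨hB, hz.span_eq_top (isLeading_rootDel F P) hI h ht⟩⟩
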